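/- Let $L^2_c = L^2([0,1],\mathbb C)^2$ with norm $\|\varphi\|^2=\int_0^1(|\varphi_1|^2+|\varphi_2|^2)\,dt$, and let $L^2_r=\{\varphi=(\varphi_1,\varphi_2)\in L^2_c : \varphi_2=\overline{\varphi_1}\}$ be the real Hilbert space of potentials of real type. For $\varphi\in L^2_c$ consider the Zakharov–Shabat operator $$L(\varphi)=\begin{pmatrix} i&0\\0&-i\end{pmatrix}\frac{d}{dt}+\begin{pmatrix}0&\varphi_1\\ \varphi_2&0\end{pmatrix}.$$ A number $\lambda\in\mathbb C$ is a periodic eigenvalue of $\varphi$ if $L(\varphi)f=\lambda f$ for some nonzero $f\in H^1([0,1],\mathbb C)^2$ with $f(1)=f(0)$ or $f(1)=-f(0)$; its algebraic multiplicity is its order as a zero of the entire function $\Delta^2(\lambda)-4$, where $\Delta(\lambda)=\operatorname{tr}M(1,\lambda)$ and $M(t,\lambda)$ is the fundamental solution of $L(\varphi)M=\lambda M$, $M(0)=\mathrm{Id}$. For each $\varphi\in L^2_r$ the periodic eigenvalues, counted with algebraic multiplicity, can be written in exactly one way as a doubly infinite, lexicographically ordered sequence $$\cdots\preceq\lambda^+_{n-1}\preceq\lambda^-_n\preceq\lambda^+_n\preceq\lambda^-_{n+1}\preceq\cdots,\qquad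 n\in\mathbb Z,$$ such that $|\lambda^\pm_n-n\pi|<\pi/4$ for all sufficiently large $|n|$. (Here $a\preceq b$ means that $\operatorname{Re}a<\operatorname{Re}b$, or $\operatorname{Re}a=\operatorname{Re}b$ and $\operatorname{Im}a\le\operatorname{Im}b$.) The $n$-th gap of $\varphi$ is collapsed if $\lambda^-_n(\varphi)=\lambda^+_n(\varphi)$, and open otherwise. For every $n\in\mathbb Z$, the set $$Y_n=\{\varphi\in L^2_r:\lambda^-_n(\varphi)=\lambda^+_n(\varphi)\}$$ is a real analytic submanifold of $L^2_r$ of codimension $2$; that is, near each of its points some real analytic diffeomorphism between open subsets of $L^2_r$ maps $Y_n$ to a closed linear subspace of codimension $2$. Consequently, generically all gaps are open: the set of all $\varphi\in L^2_r$ for which every gap is open is residual (its complement $\bigcup_{n\in\mathbb Z}Y_n$ is of first Baire category), and hence dense, in $L^2_r$. -/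

import Mathlib

open MeasureTheory Set

namespace ZS

noncomputable section

/-- Lebesgue measure on the unit interval `[0,1]`. -/
abbrev unitVolume : Measure ℝ := volume.restrict (Icc (0 : ℝ) 1)

/-- `L² ([0,1], ℂ)`. -/
abbrev L2 : Type := Lp ℂ 2 unitVolume

/-- The space `L²([0,1], ℂ)²` of potentials `φ = (φ₁, φ₂)`, with the norm
`‖φ‖² = ∫₀¹ (|φ₁|² + |φ₂|²) dt`. -/
abbrev L2c : Type := WithLp 2 (L2 × L2)

/-- The real subspace of potentials of real type, `φ₂ = conj φ₁` (almost everywhere). -/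
def L2r : Submodule ℝ L2c where
  carrier := {φ | ∀ᵐ t ∂unitVolume, (φ.snd : ℝ → ℂ) t = star ((φ.fst : ℝ → ℂ) t)}
  add_mem' := by
    intro a b ha hb
    simp only [mem_ofPred_eq, WithLp.add_fst, WithLp.add_snd] at *
    filter_upwards [ha, hb, Lp.coeFn_add a.fst b.fst, Lp.coeFn_add a.snd b.snd]
      with t h1 h2 h3 h4
    rw [h3, h4, Pi.add_apply, Pi.add_apply, h1, h2, star_add]
  zero_mem' := by
    simp only [mem_ofPred_eq, WithLp.zero_fst, WithLp.zero_snd]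
    filter_upwards [Lp.coeFn_zero ℂ 2 unitVolume] with t h
    rw [h, Pi.zero_apply, star_zero]
  smul_mem' := by
    intro c a ha
    simp only [mem_ofPred_eq, WithLp.smul_fst, WithLp.smul_snd] at *
    filter_upwards [ha, Lp.coeFn_smul c a.fst, Lp.coeFn_smul c a.snd] with t h1 h2 h3
    rw [h2, h3, Pi.smul_apply, Pi.smul_apply, h1, star_smul, star_trivial c]

/-! ### The fundamental solution and the characteristic function -/

/-- The fundamental solution `diag (e^{-iλt}, e^{iλt})` for the zero potential. -/
def freeSol (lam : ℂ) (t : ℝ) : Matrix (Fin 2) (Fin 2) ℂ :=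
  !![Complex.exp (-Complex.I * lam * t), 0; 0, Complex.exp (Complex.I * lam * t)]

/-- The matrix `iRΦ(t)`, where `R = diag (1, -1)` and `Φ = !![0, φ₁; φ₂, 0]`. -/
def potMatrix (φ : L2c) (t : ℝ) : Matrix (Fin 2) (Fin 2) ℂ :=
  !![0, Complex.I * (φ.fst : ℝ → ℂ) t; -Complex.I * (φ.snd : ℝ → ℂ) t, 0]

/-- The term of degree `n` in `φ` of the series of the fundamental solution:
`M₀ = E_λ` and `M_{n+1}(t) = ∫₀ᵗ E_λ(t-s) iRΦ(s) M_n(s) ds`. -/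
def fundTerm (φ : L2c) (lam : ℂ) : ℕ → ℝ → Matrix (Fin 2) (Fin 2) ℂ
  | 0 => freeSol lam
  | n + 1 => fun t => Matrix.of fun i j =>
      ∫ s in (0 : ℝ)..t, (freeSol lam (t - s) * potMatrix φ s * fundTerm φ lam n s) i j

/-- The fundamental solution `M(t, λ, φ)`: `L(φ) M = λ M`, `M(0) = Id`. -/
def fundSol (φ : L2c) (lam : ℂ) (t : ℝ) : Matrix (Fin 2) (Fin 2) ℂ :=
  Matrix.of fun i j => ∑' n : ℕ, fundTerm φ lam n t i j

/-- The discriminant `Δ(λ) = tr M(1, λ)`. -/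
def discriminant (φ : L2c) (lam : ℂ) : ℂ := (fundSol φ lam 1).trace

/-- The characteristic function `χ_p = Δ² - 4` of the periodic spectrum. -/
def charFun (φ : L2c) (lam : ℂ) : ℂ := discriminant φ lam ^ 2 - 4

/-! ### The periodic spectrum -/

/-- `f` is (the continuous representative of) an element of `H¹([0,1], ℂ)`, and `g` is its
weak derivative. -/
def HasH1Deriv (f g : ℝ → ℂ) : Prop :=
  MemLp g 2 unitVolume ∧ ∀ t ∈ Icc (0 : ℝ) 1, f t = f 0 + ∫ s in (0 : ℝ)..t, g s

/-- `λ` is a periodic eigenvalue of `L(φ) = i R d/dt + Φ`: there is a nonzero `f ∈ H¹ × H¹` with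
`f(1) = f(0)` or `f(1) = -f(0)`, and `L(φ) f = λ f`. -/
def IsPeriodicEigenvalue (φ : L2c) (lam : ℂ) : Prop :=
  ∃ f₁ f₂ g₁ g₂ : ℝ → ℂ,
    HasH1Deriv f₁ g₁ ∧ HasH1Deriv f₂ g₂ ∧
    ((f₁ 1 = f₁ 0 ∧ f₂ 1 = f₂ 0) ∨ (f₁ 1 = -f₁ 0 ∧ f₂ 1 = -f₂ 0)) ∧
    (∃ t ∈ Icc (0 : ℝ) 1, f₁ t ≠ 0 ∨ f₂ t ≠ 0) ∧
    (∀ᵐ t ∂unitVolume,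
      Complex.I * g₁ t + (φ.fst : ℝ → ℂ) t * f₂ t = lam * f₁ t ∧
      -Complex.I * g₂ t + (φ.snd : ℝ → ℂ) t * f₁ t = lam * f₂ t)

/-- The lexicographic order on complex numbers. -/
def LexLE (a b : ℂ) : Prop := a.re < b.re ∨ (a.re = b.re ∧ a.im ≤ b.im)

/-- `(lm n)` and `(lp n)` are the sequences `(λ⁻_n)` and `(λ⁺_n)` of the periodic eigenvalues
of `φ`. -/
structure IsPeriodicSpectrum (φ : L2c) (lm lp : ℤ → ℂ) : Prop where
  /-- the terms are exactly the periodic eigenvalues -/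
  mem_iff : ∀ lam : ℂ, ((∃ n, lm n = lam) ∨ ∃ n, lp n = lam) ↔ IsPeriodicEigenvalue φ lam
  /-- they are repeated according to their algebraic multiplicity -/
  mult : ∀ lam : ℂ, {n | lm n = lam}.encard + {n | lp n = lam}.encard =
    analyticOrderAt (charFun φ) lam
  /-- `⋯ ≼ λ⁺_{n-1} ≼ λ⁻_n ≼ λ⁺_n ≼ λ⁻_{n+1} ≼ ⋯` -/
  lm_le_lp : ∀ n, LexLE (lm n) (lp n)
  lp_le_lm : ∀ n, LexLE (lp n) (lm (n + 1))
  /-- for `|n|` large, `λ⁻_n` and `λ⁺_n` lie in the disc of radius `π/4` around `nπ` -/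
  mem_disc : ∃ N : ℤ, ∀ n : ℤ, N < |n| →
    lm n ∈ Metric.ball ((n : ℂ) * Real.pi) (Real.pi / 4) ∧
    lp n ∈ Metric.ball ((n : ℂ) * Real.pi) (Real.pi / 4)

/-- The pair of sequences `((λ⁻_n), (λ⁺_n))` of `φ`. -/
def periodicSpectrum (φ : L2c) : (ℤ → ℂ) × (ℤ → ℂ) :=
  Classical.epsilon fun p => IsPeriodicSpectrum φ p.1 p.2

/-- `λ⁻_n(φ)`. -/
def lamMinus (φ : L2c) (n : ℤ) : ℂ := (periodicSpectrum φ).1 n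

/-- `λ⁺_n(φ)`. -/
def lamPlus (φ : L2c) (n : ℤ) : ℂ := (periodicSpectrum φ).2 n

/-- The set `Y_n` of potentials of real type whose `n`-th gap is collapsed. -/
def collapsed (n : ℤ) : Set L2r := {φ | lamMinus (φ : L2c) n = lamPlus (φ : L2c) n}

/-! ### Submanifolds of a Banach space -/

/-- `S` is a real analytic submanifold of codimension `k` of the real normed space `E`: near each
of its points, a real analytic diffeomorphism between open subsets of `E` maps `S` to a closed
subspace of codimension `k`. -/
def IsAnalyticSubmanifold {E : Type*} [NormedAddCommGroup E] [NormedSpace ℝ E]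
    (S : Set E) (k : ℕ) : Prop :=
  ∀ p ∈ S, ∃ (G : Submodule ℝ E) (e : OpenPartialHomeomorph E E),
    IsClosed (G : Set E) ∧ Module.rank ℝ (E ⧸ G) = k ∧ p ∈ e.source ∧
    AnalyticOnNhd ℝ e e.source ∧ AnalyticOnNhd ℝ e.symm e.target ∧
    ∀ x ∈ e.source, x ∈ S ↔ e x ∈ G

end

end ZS

namespace ZS

noncomputable section

open Filter Topology

/-! For φ of real type and real x, the matrix M(1, x) lies in SU(1,1): its first row is (a, b), its
second row (conj b, conj a), and |a|² - |b|² = 1 (`conj_symmetry`, `normSq_sub_normSq`). Hence Δ = 2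
Re a, and the whole real spectrum is encoded in the curve x ↦ (a, b), abstracted as `SpectralCurve`.
Write a = |a| e^{-iθ} with θ continuous and θ(x) - x → 0 as |x| → ∞, and let ρ ∈ [0, π/2) satisfy
sin ρ = |b/a|. Then (Δ² - 4)/4 = -|a|² sin(θ+ρ) sin(θ-ρ) (`re_sq_sub_one_eq_sin`).

The key fact is Prüfer monotonicity: θ+ρ and θ-ρ are strictly increasing (`gp_strictMono`,
`gm_strictMono`). They are the upper and lower envelopes of the phases of a + b w over |w| = 1, and
each of these phases has positive derivative because |q| < p (`norm_qInt_lt`, `im_derivative_neg`).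
So λ⁻_n is the unique solution of θ+ρ = nπ and λ⁺_n the unique solution of θ-ρ = nπ. Interlacing
follows from 0 ≤ ρ < π/2, the asymptotics from θ - x → 0 and ρ → 0, and the multiplicities from the
local expansions in `order_eq`. Non-real eigenvalues are excluded by an energy identity. Any other
admissible enumeration coincides with this one by a pigeonhole argument (`le_of_equiv`).

The n-th gap is collapsed exactly when θ = nπ and b = 0 at a common x (`mem_collapsed_iff`). Locally
this means Im a = 0 and b = 0: three real equations with one auxiliary real unknown x, whence
codimension 2. The equation Im a = 0 is solved for x = Λ(φ) by the implicit function theorem, as ∂ₓ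
Im a ≠ 0. The differential of φ ↦ b(Λ(φ), φ) is an integral functional whose kernels at t = 0 are
explicit, since M(0) = Id; this makes it surjective onto ℂ (`integral_functional_surjective`), and a
submersion chart finishes the argument.

Analyticity comes from solving the system as a Volterra equation: M is given by (1 - V)⁻¹, whose
Neumann series converges for all parameters (`V_pow_norm_le`), and derivatives come from variation
of constants. Residuality holds because each collapsed set is closed and, having positive
codimension, has empty interior; Baire's theorem then gives density. -/

/-! ### Calculus of absolutely continuous functions on the unit interval -/

/-- `f` is absolutely continuous on `[0,1]` with almost everywhere derivative `f'`. -/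
structure ACD (f f' : ℝ → ℂ) : Prop where
  ac : AbsolutelyContinuousOnInterval f 0 1
  der : ∀ᵐ x, x ∈ Icc (0 : ℝ) 1 → HasDerivAt f (f' x) x

theorem AbsolutelyContinuousOnInterval.congr' {f g : ℝ → ℂ}
    (hf : AbsolutelyContinuousOnInterval f 0 1) (h : EqOn f g (Icc 0 1)) :
    AbsolutelyContinuousOnInterval g 0 1 := by
  rw [absolutelyContinuousOnInterval_iff] at hf ⊢
  intro ε hε
  obtain ⟨δ, hδ, H⟩ := hf ε hε
  refine ⟨δ, hδ, fun E hE hlt => ?_⟩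
  have := H E hE hlt
  convert this using 1
  refine Finset.sum_congr rfl fun i hi => ?_
  have h2 := hE.1 i hi
  rw [uIcc_of_le zero_le_one] at h2
  rw [h h2.1, h h2.2]

theorem AbsolutelyContinuousOnInterval.lipschitz_comp {f : ℝ → ℂ} {g : ℂ → ℂ} {K : NNReal}
    (hf : AbsolutelyContinuousOnInterval f 0 1) (hg : LipschitzOnWith K g (f '' Icc 0 1)) :
    AbsolutelyContinuousOnInterval (fun x => g (f x)) 0 1 := by
  rw [absolutelyContinuousOnInterval_iff] at hf ⊢
  intro ε hε
  -- The `+ 1` covers the case K = 0.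
  obtain ⟨δ, hδ, H⟩ := hf (ε / (K + 1)) (by positivity)
  refine ⟨δ, hδ, fun E hE hlt => ?_⟩
  have h1 := H E hE hlt
  have h2 : ∑ i ∈ Finset.range E.1, dist (g (f (E.2 i).1)) (g (f (E.2 i).2)) ≤
      K * ∑ i ∈ Finset.range E.1, dist (f (E.2 i).1) (f (E.2 i).2) := by
    rw [Finset.mul_sum]
    refine Finset.sum_le_sum fun i hi => ?_
    have h2 := hE.1 i hi
    rw [uIcc_of_le zero_le_one] at h2
    exact hg.dist_le_mul _ (mem_image_of_mem f h2.1) _ (mem_image_of_mem f h2.2)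
  have h3 : 0 ≤ ∑ i ∈ Finset.range E.1, dist (f (E.2 i).1) (f (E.2 i).2) :=
    Finset.sum_nonneg fun _ _ => dist_nonneg
  rw [lt_div_iff₀ (by positivity)] at h1
  nlinarith

namespace ACD

variable {f f' g g' : ℝ → ℂ}

theorem congr_deriv (h : ACD f f') (e : ∀ᵐ x, x ∈ Icc (0 : ℝ) 1 → f' x = g' x) : ACD f g' :=
  ⟨h.ac, by filter_upwards [h.der, e] with x h1 h2 hx; rw [← h2 hx]; exact h1 hx⟩

theorem add (hf : ACD f f') (hg : ACD g g') : ACD (fun x => f x + g x) (fun x => f' x + g' x) :=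
  ⟨hf.ac.fun_add hg.ac, by
    filter_upwards [hf.der, hg.der] with x h1 h2 hx
    exact (h1 hx).add (h2 hx)⟩

theorem sub (hf : ACD f f') (hg : ACD g g') : ACD (fun x => f x - g x) (fun x => f' x - g' x) :=
  ⟨hf.ac.fun_sub hg.ac, by
    filter_upwards [hf.der, hg.der] with x h1 h2 hx
    exact (h1 hx).sub (h2 hx)⟩

theorem mul (hf : ACD f f') (hg : ACD g g') :
    ACD (fun x => f x * g x) (fun x => f' x * g x + f x * g' x) :=
  ⟨hf.ac.fun_smul hg.ac, by
    filter_upwards [hf.der, hg.der] with x h1 h2 hx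
    exact (h1 hx).mul (h2 hx)⟩

theorem const_mul (c : ℂ) (hf : ACD f f') : ACD (fun x => c * f x) (fun x => c * f' x) :=
  ⟨hf.ac.const_smul c, by
    filter_upwards [hf.der] with x h1 hx
    exact (h1 hx).const_mul c⟩

theorem conj (hf : ACD f f') :
    ACD (fun x => (starRingEnd ℂ) (f x)) (fun x => (starRingEnd ℂ) (f' x)) :=
  ⟨AbsolutelyContinuousOnInterval.lipschitz_comp (K := 1) hf.ac
    (LipschitzWith.lipschitzOnWith (Complex.conjLIE.isometry.lipschitz)), by
    filter_upwards [hf.der] with x h1 hx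
    exact (h1 hx).star⟩

theorem of_contDiff (h : ContDiff ℝ 1 f) (hd : ∀ x, HasDerivAt f (f' x) x) : ACD f f' :=
  ⟨h.contDiffOn.absolutelyContinuousOnInterval, ae_of_all _ fun x _ => hd x⟩

/-- An absolutely continuous function is bounded on the interval, and the exponential is Lipschitz
on bounded discs. -/
theorem cexp (hf : ACD f f') :
    ACD (fun x => Complex.exp (f x)) (fun x => f' x * Complex.exp (f x)) := by
  refine ⟨?_, ?_⟩
  · obtain ⟨C, hC⟩ := hf.ac.exists_bound
    rw [uIcc_of_le zero_le_one] at hC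
    have h1 : ContDiffOn ℝ 1 Complex.exp (Metric.closedBall (0 : ℂ) C) :=
      (Complex.contDiff_exp (𝕜 := ℝ)).contDiffOn
    obtain ⟨K, hK⟩ := h1.exists_lipschitzOnWith (by decide) (convex_closedBall _ _)
      (isCompact_closedBall _ _)
    refine AbsolutelyContinuousOnInterval.lipschitz_comp hf.ac (hK.mono ?_)
    rintro _ ⟨x, hx, rfl⟩
    simpa using hC x hx
  · filter_upwards [hf.der] with x h1 hx
    rw [mul_comm]
    exact (h1 hx).cexp

theorem continuousOn (hf : ACD f f') : ContinuousOn f (Icc 0 1) := by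
  simpa using hf.ac.continuousOn

theorem eq_const (hf : ACD f f') (h0 : ∀ᵐ x, x ∈ Icc (0 : ℝ) 1 → f' x = 0) :
    ∀ t ∈ Icc (0 : ℝ) 1, f t = f 0 := by
  obtain ⟨C, hC⟩ := hf.ac.const_of_ae_hasDerivAt_zero (by
    filter_upwards [hf.der, h0] with x h1 h2 hx
    rw [uIcc_of_le zero_le_one] at hx
    rw [← h2 hx]; exact h1 hx)
  rw [uIcc_of_le zero_le_one] at hC
  intro t ht
  rw [hC t ht, hC 0 (by simp)]

/-- Lebesgue differentiation. Together with `integral_eq` it makes the integral and the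
almost-everywhere differential form of an equation interchangeable, which is needed because the
coefficients are only square integrable. -/
theorem of_integral (c : ℂ) (hg : IntervalIntegrable f' volume 0 1)
    (h : ∀ t ∈ Icc (0 : ℝ) 1, f t = c + ∫ s in (0 : ℝ)..t, f' s) : ACD f f' := by
  refine ⟨?_, ?_⟩
  · have h1 : AbsolutelyContinuousOnInterval (fun x => ∫ s in (0 : ℝ)..x, (f' s).re) 0 1 :=
      IntervalIntegrable.absolutelyContinuousOnInterval_intervalIntegral
        ⟨hg.1.re, hg.2.re⟩ (by simp)
    have h2 : AbsolutelyContinuousOnInterval (fun x => ∫ s in (0 : ℝ)..x, (f' s).im) 0 1 :=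
      IntervalIntegrable.absolutelyContinuousOnInterval_intervalIntegral
        ⟨hg.1.im, hg.2.im⟩ (by simp)
    have hc : ∀ z : ℂ, AbsolutelyContinuousOnInterval (fun _ : ℝ => z) 0 1 := fun z =>
      ((LipschitzWith.const' z (K := 0)).lipschitzOnWith (s := uIcc 0 1)).absolutelyContinuousOnInterval
    refine AbsolutelyContinuousOnInterval.congr'
      ((hc c).fun_add ((h1.fun_smul (hc 1)).fun_add (h2.fun_smul (hc Complex.I)))) ?_
    intro t ht
    have ht' : IntervalIntegrable f' volume 0 t := hg.mono_set (by
      rw [uIcc_of_le ht.1, uIcc_of_le zero_le_one]; exact Icc_subset_Icc_right ht.2)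
    have e1 : ∫ s in (0 : ℝ)..t, (f' s).re = (∫ s in (0 : ℝ)..t, f' s).re :=
      Complex.reCLM.intervalIntegral_comp_comm ht'
    have e2 : ∫ s in (0 : ℝ)..t, (f' s).im = (∫ s in (0 : ℝ)..t, f' s).im :=
      Complex.imCLM.intervalIntegral_comp_comm ht'
    simp only [e1, e2, h t ht]
    congr 1
    simp [Complex.re_add_im]
  -- The formula for f holds only on [0,1], so two-sided derivatives are available only off the
  -- endpoints.
  · have h1 : ∀ᵐ x : ℝ, x ≠ 0 := by simp [ae_iff, measure_singleton]
    have h2 : ∀ᵐ x : ℝ, x ≠ 1 := by simp [ae_iff, measure_singleton]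
    filter_upwards [hg.ae_hasDerivAt_integral, h1, h2] with x hx h1 h2 hx'
    have := (hx (by simpa using hx') 0 (by simp)).const_add c
    refine this.congr_of_eventuallyEq ?_
    have : Ioo (0 : ℝ) 1 ∈ 𝓝 x :=
      Ioo_mem_nhds (lt_of_le_of_ne hx'.1 h1.symm) (lt_of_le_of_ne hx'.2 h2)
    filter_upwards [this] with y hy
    exact h y (Ioo_subset_Icc_self hy)

theorem integral_eq (hf : ACD f f') (hi : IntervalIntegrable f' volume 0 1) :
    ∀ t ∈ Icc (0 : ℝ) 1, f t = f 0 + ∫ s in (0 : ℝ)..t, f' s := by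
  intro t ht
  have h1 : ACD (fun t => ∫ s in (0 : ℝ)..t, f' s) f' := of_integral 0 hi (by simp)
  have := (hf.sub h1).eq_const (by simp) t ht
  simp at this
  rw [← this]; ring

end ACD

/-! ### The Volterra operator -/

/-- Continuous functions on the unit interval. -/
abbrev X : Type := C(Icc (0 : ℝ) 1, ℂ)

/-- Constant extension of a function on the unit interval. -/
def ext (f : X) : ℝ → ℂ := IccExtend zero_le_one f

theorem ext_continuous (f : X) : Continuous (ext f) := f.continuous.Icc_extend'

theorem ext_of_mem (f : X) {t : ℝ} (ht : t ∈ Icc (0 : ℝ) 1) : ext f t = f ⟨t, ht⟩ :=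
  IccExtend_of_mem _ _ ht

theorem norm_ext_le (f : X) (t : ℝ) : ‖ext f t‖ ≤ ‖f‖ := f.norm_coe_le_norm _

@[simp] theorem ext_add (f g : X) (t : ℝ) : ext (f + g) t = ext f t + ext g t := rfl
@[simp] theorem ext_sub (f g : X) (t : ℝ) : ext (f - g) t = ext f t - ext g t := rfl
@[simp] theorem ext_mul (f g : X) (t : ℝ) : ext (f * g) t = ext f t * ext g t := rfl
@[simp] theorem ext_smul (c : ℂ) (f : X) (t : ℝ) : ext (c • f) t = c * ext f t := rfl
@[simp] theorem ext_one (t : ℝ) : ext 1 t = 1 := rfl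

theorem ae_unit {P : ℝ → Prop} (h : ∀ᵐ t ∂unitVolume, P t) :
    ∀ᵐ t, t ∈ Icc (0 : ℝ) 1 → P t := (ae_restrict_iff' measurableSet_Icc).1 h

instance : IsFiniteMeasure unitVolume := ⟨by simp⟩

theorem L2_memLp (a : L2) : MemLp a 2 unitVolume := Lp.memLp a

theorem L2_intervalIntegrable (a : L2) : IntervalIntegrable a volume 0 1 := by
  rw [intervalIntegrable_iff_integrableOn_Icc_of_le zero_le_one]
  exact (L2_memLp a).integrable one_le_two

theorem mem_sub_interval {t : ℝ} (ht : t ∈ Icc (0 : ℝ) 1) : uIcc 0 t ⊆ uIcc (0 : ℝ) 1 := by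
  rw [uIcc_of_le ht.1, uIcc_of_le zero_le_one]; exact Icc_subset_Icc_right ht.2

theorem L2_mul_integrable (a : L2) {g : ℝ → ℂ} (hg : ContinuousOn g (Icc 0 1)) :
    IntervalIntegrable (fun s => a s * g s) volume 0 1 :=
  (L2_intervalIntegrable a).mul_continuousOn (by simpa using hg)

theorem L2_mul_integrable' (a : L2) {g : ℝ → ℂ} (hg : ContinuousOn g (Icc 0 1)) {t : ℝ}
    (ht : t ∈ Icc (0 : ℝ) 1) : IntervalIntegrable (fun s => a s * g s) volume 0 t :=
  (L2_mul_integrable a hg).mono_set (mem_sub_interval ht)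

theorem L2_integral_sq (a : L2) : ∫ s in Icc (0 : ℝ) 1, ‖a s‖ ^ 2 = ‖a‖ ^ 2 := by
  have h := L2.inner_def (𝕜 := ℂ) a a
  rw [inner_self_eq_norm_sq_to_K] at h
  have : ∀ s, inner ℂ (a s) (a s) = ((‖a s‖ ^ 2 : ℝ) : ℂ) := fun s => by
    rw [inner_self_eq_norm_sq_to_K]; norm_cast
  simp only [this] at h
  have h2 : ∫ s, ((‖a s‖ ^ 2 : ℝ) : ℂ) ∂unitVolume = ((∫ s, ‖a s‖ ^ 2 ∂unitVolume : ℝ) : ℂ) :=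
    integral_ofReal
  rw [h2] at h
  have h3 : ((‖a‖ ^ 2 : ℝ) : ℂ) = ((∫ s, ‖a s‖ ^ 2 ∂unitVolume : ℝ) : ℂ) := by
    rw [← h]; push_cast; rfl
  exact (Complex.ofReal_injective h3).symm

/-- The factor ‖a‖ is taken over the whole interval while h is integrated only up to t; keeping the
dependence on t is what produces factorials after iteration. -/
theorem L2_cauchy_schwarz (a : L2) {h : ℝ → ℝ} (hc : Continuous h) (h0 : ∀ s, 0 ≤ h s) {t : ℝ}
    (ht : t ∈ Icc (0 : ℝ) 1) :
    ∫ s in (0 : ℝ)..t, ‖a s‖ * h s ≤ ‖a‖ * Real.sqrt (∫ s in (0 : ℝ)..t, h s ^ 2) := by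
  have hsub : Ioc 0 t ⊆ Icc (0 : ℝ) 1 := fun s hs => ⟨hs.1.le, hs.2.trans ht.2⟩
  have hle : volume.restrict (Ioc 0 t) ≤ unitVolume := Measure.restrict_mono_set _ hsub
  have ha : MemLp (fun s => ‖a s‖) 2 (volume.restrict (Ioc 0 t)) :=
    ((L2_memLp a).mono_measure hle).norm
  have hh : MemLp h 2 (volume.restrict (Ioc 0 t)) := by
    obtain ⟨C, hC⟩ := (isCompact_Icc (a := (0:ℝ)) (b := t)).exists_bound_of_continuousOn
      hc.continuousOn
    refine MemLp.of_bound hc.aestronglyMeasurable C ?_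
    rw [ae_restrict_iff' measurableSet_Ioc]
    exact ae_of_all _ fun s hs => hC s (Ioc_subset_Icc_self hs)
  have := integral_mul_le_Lp_mul_Lq_of_nonneg (μ := volume.restrict (Ioc 0 t))
    Real.HolderConjugate.two_two (f := fun s => ‖a s‖) (g := h)
    (ae_of_all _ fun s => norm_nonneg _) (ae_of_all _ h0) (by simpa using ha) (by simpa using hh)
  rw [intervalIntegral.integral_of_le ht.1, intervalIntegral.integral_of_le ht.1]
  refine this.trans ?_
  simp only [Real.rpow_two, ← Real.sqrt_eq_rpow]
  gcongr
  rw [← Real.sqrt_sq (norm_nonneg a), ← L2_integral_sq]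
  apply Real.sqrt_le_sqrt
  exact setIntegral_mono_set ((L2_memLp a).integrable_norm_pow (by norm_num))
    (ae_of_all _ fun s => by positivity) hsub.eventuallyLE

theorem volterra_continuous (a : L2) (f : X) :
    Continuous fun t : Icc (0 : ℝ) 1 => ∫ s in (0 : ℝ)..t, a s * ext f s := by
  have := intervalIntegral.continuousOn_primitive_interval
    (f := fun s => a s * ext f s) (a := 0) (b := 1) (μ := volume) (by
      rw [uIcc_of_le zero_le_one, ← intervalIntegrable_iff_integrableOn_Icc_of_le zero_le_one]
      exact L2_mul_integrable a (ext_continuous f).continuousOn)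
  rw [uIcc_of_le zero_le_one] at this
  exact continuousOn_iff_continuous_domRestrict.1 this

theorem volterra_pointwise (a : L2) (f : X) {h : ℝ → ℝ} (hc : Continuous h) (h0 : ∀ s, 0 ≤ h s)
    (hf : ∀ s ∈ Icc (0 : ℝ) 1, ‖ext f s‖ ≤ h s) {t : ℝ} (ht : t ∈ Icc (0 : ℝ) 1) :
    ‖∫ s in (0 : ℝ)..t, a s * ext f s‖ ≤ ‖a‖ * Real.sqrt (∫ s in (0 : ℝ)..t, h s ^ 2) := by
  refine le_trans ?_ (L2_cauchy_schwarz a hc h0 ht)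
  refine intervalIntegral.norm_integral_le_of_norm_le ht.1 (ae_of_all _ fun s hs => ?_) ?_
  · rw [norm_mul]
    exact mul_le_mul_of_nonneg_left (hf s ⟨hs.1.le, hs.2.trans ht.2⟩) (norm_nonneg _)
  · refine IntervalIntegrable.mul_continuousOn ?_ hc.continuousOn
    exact ((L2_intervalIntegrable a).mono_set (mem_sub_interval ht)).norm

/-- `(B a f)(t) = ∫₀ᵗ a f`. -/
def B : L2 →L[ℂ] X →L[ℂ] X :=
  LinearMap.mkContinuous₂
    (LinearMap.mk₂ ℂ (fun (a : L2) (f : X) =>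
        (⟨fun t => ∫ s in (0 : ℝ)..t, a s * ext f s, volterra_continuous a f⟩ : X))
      (by
        intro a b f
        ext t
        change ∫ s in (0 : ℝ)..t, (a + b : L2) s * ext f s =
          (∫ s in (0 : ℝ)..t, a s * ext f s) + ∫ s in (0 : ℝ)..t, b s * ext f s
        rw [← intervalIntegral.integral_add
          (L2_mul_integrable' a (ext_continuous f).continuousOn t.2)
          (L2_mul_integrable' b (ext_continuous f).continuousOn t.2)]
        refine intervalIntegral.integral_congr_ae ?_
        filter_upwards [ae_unit (Lp.coeFn_add a b)] with s hs hst
        rw [uIoc_of_le t.2.1] at hst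
        rw [hs ⟨hst.1.le, hst.2.trans t.2.2⟩, Pi.add_apply, add_mul])
      (by
        intro c a f
        ext t
        change ∫ s in (0 : ℝ)..t, (c • a : L2) s * ext f s =
          c • ∫ s in (0 : ℝ)..t, a s * ext f s
        rw [← intervalIntegral.integral_smul]
        refine intervalIntegral.integral_congr_ae ?_
        filter_upwards [ae_unit (Lp.coeFn_smul c a)] with s hs hst
        rw [uIoc_of_le t.2.1] at hst
        rw [hs ⟨hst.1.le, hst.2.trans t.2.2⟩, Pi.smul_apply, smul_mul_assoc])
      (by
        intro a f g
        ext t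
        change ∫ s in (0 : ℝ)..t, a s * ext (f + g) s =
          (∫ s in (0 : ℝ)..t, a s * ext f s) + ∫ s in (0 : ℝ)..t, a s * ext g s
        rw [← intervalIntegral.integral_add
          (L2_mul_integrable' a (ext_continuous f).continuousOn t.2)
          (L2_mul_integrable' a (ext_continuous g).continuousOn t.2)]
        simp only [ext_add, mul_add])
      (by
        intro c a f
        ext t
        change ∫ s in (0 : ℝ)..t, a s * ext (c • f) s =
          c • ∫ s in (0 : ℝ)..t, a s * ext f s
        rw [← intervalIntegral.integral_smul]
        simp only [ext_smul, smul_eq_mul, mul_left_comm]))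
    1 (by
      intro a f
      rw [ContinuousMap.norm_le _ (by positivity)]
      intro t
      refine (volterra_pointwise a f (h := fun _ => ‖f‖) continuous_const (fun _ => norm_nonneg _)
        (fun s _ => norm_ext_le f s) t.2).trans ?_
      rw [one_mul]
      gcongr
      rw [Real.sqrt_le_left (norm_nonneg _)]
      simp only [intervalIntegral.integral_const, sub_zero, smul_eq_mul]
      nlinarith [t.2.2, sq_nonneg ‖f‖])

theorem ext_B (a : L2) (f : X) {t : ℝ} (ht : t ∈ Icc (0 : ℝ) 1) :
    ext (B a f) t = ∫ s in (0 : ℝ)..t, a s * ext f s := by rw [ext_of_mem _ ht]; rfl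

/-- The profile `√(tⁿ / n!)` of the iterated Volterra bound. -/
def profile (n : ℕ) (t : ℝ) : ℝ := Real.sqrt (|t| ^ n / n.factorial)

theorem profile_continuous (n : ℕ) : Continuous (profile n) := by
  unfold profile; fun_prop

theorem profile_nonneg (n : ℕ) (t : ℝ) : 0 ≤ profile n t := Real.sqrt_nonneg _

/-- The profiles are reproduced by Cauchy–Schwarz because ∫₀ᵗ sⁿ/n! ds = tⁿ⁺¹/(n+1)!. -/
theorem integral_profile_sq (n : ℕ) (C : ℝ) (hC : 0 ≤ C) {t : ℝ} (ht : 0 ≤ t) :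
    Real.sqrt (∫ s in (0 : ℝ)..t, (C * profile n s) ^ 2) = C * profile (n + 1) t := by
  have : ∫ s in (0 : ℝ)..t, (C * profile n s) ^ 2 = C ^ 2 * (|t| ^ (n + 1) / (n + 1).factorial) := by
    have e : ∀ s ∈ uIcc 0 t, (C * profile n s) ^ 2 = C ^ 2 / n.factorial * s ^ n := by
      intro s hs
      rw [uIcc_of_le ht] at hs
      rw [mul_pow, profile, Real.sq_sqrt (by positivity), abs_of_nonneg hs.1]; ring
    rw [intervalIntegral.integral_congr e, intervalIntegral.integral_const_mul, integral_pow,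
      abs_of_nonneg ht, Nat.factorial_succ]
    have : (n.factorial : ℝ) ≠ 0 := by positivity
    push_cast
    field_simp
    simp
  rw [this, Real.sqrt_mul (by positivity), Real.sqrt_sq hC, profile]

theorem B_profile (a : L2) (f : X) (n : ℕ) {C : ℝ} (hC : 0 ≤ C)
    (hf : ∀ s ∈ Icc (0 : ℝ) 1, ‖ext f s‖ ≤ C * profile n s) {t : ℝ} (ht : t ∈ Icc (0 : ℝ) 1) :
    ‖ext (B a f) t‖ ≤ ‖a‖ * (C * profile (n + 1) t) := by
  rw [ext_B a f ht, ← integral_profile_sq n C hC ht.1]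
  exact volterra_pointwise a f (by have := profile_continuous n; fun_prop)
    (fun s => mul_nonneg hC (profile_nonneg _ _)) hf ht

/-! ### The Zakharov–Shabat system as a Volterra operator on pairs -/

/-- Spectral parameters and potentials. -/
abbrev Param : Type := ℂ × L2c

/-- Pairs of continuous functions. -/
def XX : Type := X × X

instance : NormedAddCommGroup XX := inferInstanceAs (NormedAddCommGroup (X × X))
instance : NormedSpace ℂ XX := inferInstanceAs (NormedSpace ℂ (X × X))
instance : CompleteSpace XX := inferInstanceAs (CompleteSpace (X × X))

/-- The constant function `1` in `L²`. -/
def oneL2 : L2 := (memLp_const (1 : ℂ)).toLp _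

theorem oneL2_ae : ∀ᵐ t, t ∈ Icc (0 : ℝ) 1 → oneL2 t = 1 :=
  ae_unit (MemLp.coeFn_toLp _)

/-- The operator `(f₁, f₂) ↦ (-iλ B 1 f₁ + i B φ₁ f₂, iλ B 1 f₂ - i B φ₂ f₁)` on pairs, linear in
the parameters. -/
def systemOp {A E P : Type*} [NormedAddCommGroup A] [NormedSpace ℂ A] [NormedAddCommGroup E]
    [NormedSpace ℂ E] [NormedAddCommGroup P] [NormedSpace ℂ P] (b : A →L[ℂ] E →L[ℂ] E) (one : A)
    (l : P →L[ℂ] ℂ) (q₁ q₂ : P →L[ℂ] A) : P →L[ℂ] (E × E) →L[ℂ] (E × E) :=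
  let slot (i : E →L[ℂ] E × E) (j : E × E →L[ℂ] E) : A →L[ℂ] (E × E) →L[ℂ] (E × E) :=
    (ContinuousLinearMap.compL ℂ (E × E) E (E × E) i) ∘L
      ((ContinuousLinearMap.compL ℂ (E × E) E E).flip j) ∘L b
  ((-Complex.I) • slot (.inl ℂ E E) (.fst ℂ E E) + Complex.I • slot (.inr ℂ E E) (.snd ℂ E E)) ∘L
      ((ContinuousLinearMap.toSpanSingleton ℂ one) ∘L l) +
  (Complex.I • slot (.inl ℂ E E) (.snd ℂ E E)) ∘L q₁ +
  ((-Complex.I) • slot (.inr ℂ E E) (.fst ℂ E E)) ∘L q₂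

theorem systemOp_apply {A E P : Type*} [NormedAddCommGroup A] [NormedSpace ℂ A]
    [NormedAddCommGroup E] [NormedSpace ℂ E] [NormedAddCommGroup P] [NormedSpace ℂ P]
    (b : A →L[ℂ] E →L[ℂ] E) (one : A) (l : P →L[ℂ] ℂ) (q₁ q₂ : P →L[ℂ] A) (p : P) (f : E × E) :
    systemOp b one l q₁ q₂ p f =
      ((-Complex.I * l p) • b one f.1 + Complex.I • b (q₁ p) f.2,
        (Complex.I * l p) • b one f.2 - Complex.I • b (q₂ p) f.1) := by
  ext <;> simp [systemOp, smul_smul, sub_eq_add_neg]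

/-- The operator `(V p f)(t) = ∫₀ᵗ (-iλR + iRΦ) f` for `p = (λ, φ)`. -/
def V : Param →L[ℂ] XX →L[ℂ] XX :=
  systemOp B oneL2 (.fst ℂ ℂ L2c) ((WithLp.fstL 2 ℂ L2 L2) ∘L (.snd ℂ ℂ L2c))
    ((WithLp.sndL 2 ℂ L2 L2) ∘L (.snd ℂ ℂ L2c))

theorem V_apply_fst (p : Param) (f : XX) :
    (V p f).1 = (-Complex.I * p.1) • B oneL2 f.1 + Complex.I • B p.2.fst f.2 :=
  congrArg Prod.fst (systemOp_apply _ _ _ _ _ p f)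

theorem V_apply_snd (p : Param) (f : XX) :
    (V p f).2 = (Complex.I * p.1) • B oneL2 f.2 - Complex.I • B p.2.snd f.1 :=
  congrArg Prod.snd (systemOp_apply _ _ _ _ _ p f)

/-- A bound for the coefficients of the system. -/
def coeffBound (p : Param) : ℝ := ‖p.1‖ * ‖oneL2‖ + ‖p.2.fst‖ + ‖p.2.snd‖

theorem coeffBound_nonneg (p : Param) : 0 ≤ coeffBound p := by unfold coeffBound; positivity

theorem V_profile (p : Param) (f : XX) (n : ℕ) {C : ℝ} (hC : 0 ≤ C)
    (h1 : ∀ s ∈ Icc (0 : ℝ) 1, ‖ext f.1 s‖ ≤ C * profile n s)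
    (h2 : ∀ s ∈ Icc (0 : ℝ) 1, ‖ext f.2 s‖ ≤ C * profile n s) {t : ℝ} (ht : t ∈ Icc (0 : ℝ) 1) :
    ‖ext (V p f).1 t‖ ≤ coeffBound p * C * profile (n + 1) t ∧
    ‖ext (V p f).2 t‖ ≤ coeffBound p * C * profile (n + 1) t := by
  have h3 := B_profile oneL2 f.1 n hC h1 ht
  have h4 := B_profile oneL2 f.2 n hC h2 ht
  have h5 := B_profile p.2.fst f.2 n hC h2 ht
  have h6 := B_profile p.2.snd f.1 n hC h1 ht
  have h7 : 0 ≤ C * profile (n + 1) t := mul_nonneg hC (profile_nonneg _ _)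
  have h8 := mul_le_mul_of_nonneg_left h3 (norm_nonneg p.1)
  have h9 := mul_le_mul_of_nonneg_left h4 (norm_nonneg p.1)
  have h10 := mul_nonneg (norm_nonneg p.2.fst) h7
  have h11 := mul_nonneg (norm_nonneg p.2.snd) h7
  rw [V_apply_fst, V_apply_snd, coeffBound]
  simp only [ext_add, ext_sub, ext_smul]
  constructor
  · refine (norm_add_le _ _).trans ?_
    simp only [norm_mul, norm_neg, Complex.norm_I, one_mul]
    linarith
  · refine (norm_sub_le _ _).trans ?_
    simp only [norm_mul, Complex.norm_I, one_mul]
    linarith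

theorem V_pow_profile (p : Param) (f : XX) (n : ℕ) :
    ∀ t ∈ Icc (0 : ℝ) 1,
    ‖ext ((V p ^ n) f).1 t‖ ≤ coeffBound p ^ n * ‖f‖ * profile n t ∧
    ‖ext ((V p ^ n) f).2 t‖ ≤ coeffBound p ^ n * ‖f‖ * profile n t := by
  induction n with
  | zero =>
    intro t ht
    simp only [pow_zero, profile, Nat.factorial_zero, Nat.cast_one, div_one, Real.sqrt_one, one_mul,
      mul_one]
    exact ⟨(norm_ext_le _ _).trans (norm_fst_le f), (norm_ext_le _ _).trans (norm_snd_le f)⟩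
  | succ n ih =>
    intro t ht
    have e : (V p ^ (n + 1)) f = V p ((V p ^ n) f) := by rw [pow_succ']; rfl
    rw [e]
    have hC : 0 ≤ coeffBound p ^ n * ‖f‖ :=
      mul_nonneg (pow_nonneg (coeffBound_nonneg p) _) (norm_nonneg _)
    have := V_profile p ((V p ^ n) f) n hC (fun s hs => (ih s hs).1) (fun s hs => (ih s hs).2) ht
    rwa [← mul_assoc, ← pow_succ'] at this

/-- Each application of V costs one factor of the coefficient bound and advances the profile by one.
The decay 1/√n!, rather than 1/n!, is the price of L² coefficients, and still beats every geometric
growth. -/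
theorem V_pow_norm_le (p : Param) (n : ℕ) :
    ‖V p ^ n‖ ≤ coeffBound p ^ n * Real.sqrt (1 / n.factorial) := by
  refine ContinuousLinearMap.opNorm_le_bound _
    (mul_nonneg (pow_nonneg (coeffBound_nonneg p) _) (Real.sqrt_nonneg _)) fun f => ?_
  have hC : 0 ≤ coeffBound p ^ n * ‖f‖ :=
    mul_nonneg (pow_nonneg (coeffBound_nonneg p) _) (norm_nonneg _)
  have key : ∀ t : Icc (0 : ℝ) 1, coeffBound p ^ n * ‖f‖ * profile n t ≤
      coeffBound p ^ n * Real.sqrt (1 / n.factorial) * ‖f‖ := by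
    intro t
    have : profile n t ≤ Real.sqrt (1 / n.factorial) := by
      unfold profile
      gcongr
      rw [abs_of_nonneg t.2.1]
      exact pow_le_one₀ t.2.1 t.2.2
    nlinarith [mul_le_mul_of_nonneg_left this hC]
  have hC' : 0 ≤ coeffBound p ^ n * Real.sqrt (1 / n.factorial) * ‖f‖ :=
    mul_nonneg (mul_nonneg (pow_nonneg (coeffBound_nonneg p) _) (Real.sqrt_nonneg _))
      (norm_nonneg _)
  change max ‖((V p ^ n) f).1‖ ‖((V p ^ n) f).2‖ ≤ _
  refine max_le ?_ ?_
  · rw [ContinuousMap.norm_le _ hC']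
    intro t
    have := (V_pow_profile p f n t t.2).1.trans (key t)
    rwa [ext_of_mem _ t.2] at this
  · rw [ContinuousMap.norm_le _ hC']
    intro t
    have := (V_pow_profile p f n t t.2).2.trans (key t)
    rwa [ext_of_mem _ t.2] at this

/-- The inequality 2uv ≤ u² + v² with u = 2⁻ⁿ and v = (2K)ⁿ/√n! dominates the terms by a geometric
plus an exponential series. -/
theorem summable_pow_mul_sqrt (K : ℝ) (hK : 0 ≤ K) :
    Summable fun n : ℕ => K ^ n * Real.sqrt (1 / n.factorial) := by
  have h1 : Summable fun n : ℕ => ((1 / 4 : ℝ) ^ n + (4 * K ^ 2) ^ n / n.factorial) / 2 :=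
    ((summable_geometric_of_lt_one (by norm_num) (by norm_num)).add
      (Real.summable_pow_div_factorial _)).div_const 2
  refine Summable.of_nonneg_of_le (fun n => by positivity) (fun n => ?_) h1
  have h2 := two_mul_le_add_sq ((1 / 2 : ℝ) ^ n) ((2 * K) ^ n * Real.sqrt (1 / n.factorial))
  have h3 : Real.sqrt (1 / (n.factorial : ℝ)) ^ 2 = 1 / n.factorial :=
    Real.sq_sqrt (by positivity)
  rw [mul_pow ((2 * K) ^ n), h3] at h2
  have h4 : ((1 / 2 : ℝ) ^ n) ^ 2 = (1 / 4) ^ n := by rw [← pow_mul, mul_comm, pow_mul]; norm_num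
  have h5 : ((2 * K) ^ n) ^ 2 = (4 * K ^ 2) ^ n := by
    rw [← pow_mul, mul_comm n, pow_mul, mul_pow]; norm_num
  have h6 : 2 * (1 / 2 : ℝ) ^ n * ((2 * K) ^ n * Real.sqrt (1 / n.factorial)) =
      2 * (K ^ n * Real.sqrt (1 / n.factorial)) := by
    rw [mul_pow, div_pow, one_pow]; field_simp
  rw [h4, h5, h6] at h2
  rw [← mul_div_assoc, mul_one] at h2
  linarith

/-! ### Neumann series and analytic dependence on parameters -/

section Resolvent

variable {E P : Type*} [NormedAddCommGroup E] [NormedSpace ℂ E]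
  [NormedAddCommGroup P] [NormedSpace ℂ P]

/-- `1 - T` as a unit of the algebra of operators, if the Neumann series converges. -/
def neumannUnit (T : E →L[ℂ] E) (h : Summable fun n : ℕ => T ^ n) : (E →L[ℂ] E)ˣ where
  val := 1 - T
  inv := ∑' n, T ^ n
  val_inv := h.one_sub_mul_tsum_pow
  inv_val := h.tsum_pow_mul_one_sub

theorem neumann_eq_inverse (T : E →L[ℂ] E) (h : Summable fun n : ℕ => T ^ n) :
    ∑' n, T ^ n = Ring.inverse (1 - T) :=
  (Ring.inverse_unit (neumannUnit T h)).symm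

theorem neumann_apply (T : E →L[ℂ] E) (h : Summable fun n : ℕ => T ^ n) (f : E) :
    (∑' n, T ^ n) f = f + T ((∑' n, T ^ n) f) := by
  have := congrArg (fun S : E →L[ℂ] E => S f) h.one_sub_mul_tsum_pow
  simp only [sub_mul, one_mul] at this
  change (∑' n, T ^ n) f - T ((∑' n, T ^ n) f) = f at this
  exact (sub_eq_iff_eq_add.1 this)

variable [CompleteSpace E]

/-- Inversion of units of a Banach algebra has derivative T ↦ -RTR; the sign cancels against that of
1 - W. -/
theorem neumann_hasFDerivAt (W : P →L[ℂ] E →L[ℂ] E) (h : ∀ p, Summable fun n : ℕ => W p ^ n)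
    (p : P) : HasFDerivAt (fun p => ∑' n, W p ^ n)
      (((ContinuousLinearMap.mulLeftRight ℂ (E →L[ℂ] E)) (∑' n, W p ^ n) (∑' n, W p ^ n)) ∘L W)
      p := by
  have h1 : HasFDerivAt (fun p : P => 1 - W p) (-W) p := by
    simpa using! (W.hasFDerivAt (x := p)).const_sub 1
  have h2 := (hasFDerivAt_ringInverse (𝕜 := ℂ) (neumannUnit (W p) (h p))).comp p h1
  have h3 : (Ring.inverse ∘ fun p : P => 1 - W p) = fun p => ∑' n, W p ^ n := by
    ext1 p; exact (neumann_eq_inverse _ (h p)).symm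
  rw [h3] at h2
  refine h2.congr_fderiv ?_
  ext1 d
  simp [neumannUnit]

theorem neumann_eval_hasFDerivAt (W : P →L[ℂ] E →L[ℂ] E)
    (h : ∀ p, Summable fun n : ℕ => W p ^ n) (ℓ : E →L[ℂ] ℂ) (c : E) (p : P) :
    ∃ D : P →L[ℂ] ℂ, HasFDerivAt (fun p => ℓ ((∑' n, W p ^ n) c)) D p ∧
      ∀ d, D d = ℓ ((∑' n, W p ^ n) (W d ((∑' n, W p ^ n) c))) := by
  have h1 := (ℓ ∘L (ContinuousLinearMap.apply ℂ E c)).hasFDerivAt.comp p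
    (neumann_hasFDerivAt W h p)
  exact ⟨_, h1, fun d => rfl⟩

theorem neumann_analyticAt (W : P →L[ℂ] E →L[ℂ] E) (h : ∀ p, Summable fun n : ℕ => W p ^ n)
    (p : P) : AnalyticAt ℂ (fun p => ∑' n, W p ^ n) p := by
  have h1 : AnalyticAt ℂ (fun p : P => 1 - W p) p :=
    analyticAt_const.sub (W.analyticAt p)
  have h2 := (analyticAt_inverse (𝕜 := ℂ) (neumannUnit (W p) (h p))).comp_of_eq h1 rfl
  have h3 : (Ring.inverse ∘ fun p : P => 1 - W p) = fun p => ∑' n, W p ^ n := by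
    ext1 p; exact (neumann_eq_inverse _ (h p)).symm
  rwa [h3] at h2

theorem neumann_eval_analyticAt (W : P →L[ℂ] E →L[ℂ] E)
    (h : ∀ p, Summable fun n : ℕ => W p ^ n) (ℓ : E →L[ℂ] ℂ) (c : E) (p : P) :
    AnalyticAt ℂ (fun p => ℓ ((∑' n, W p ^ n) c)) p :=
  ((ℓ ∘L (ContinuousLinearMap.apply ℂ E c)).analyticAt _).comp (neumann_analyticAt W h p)

end Resolvent

/-- The resolvent `(1 - V p)⁻¹`. -/
def resolvent (p : Param) : XX →L[ℂ] XX := ∑' n, V p ^ n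

theorem V_pow_summable (p : Param) : Summable fun n : ℕ => V p ^ n :=
  Summable.of_norm_bounded (summable_pow_mul_sqrt _ (coeffBound_nonneg p)) (V_pow_norm_le p)

theorem resolvent_norm_le (p : Param) :
    ‖resolvent p‖ ≤ ∑' n : ℕ, coeffBound p ^ n * Real.sqrt (1 / n.factorial) :=
  tsum_of_norm_bounded (summable_pow_mul_sqrt _ (coeffBound_nonneg p)).hasSum (V_pow_norm_le p)

theorem resolvent_apply (p : Param) (f : XX) : resolvent p f = f + V p (resolvent p f) :=
  neumann_apply (V p) (V_pow_summable p) f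

theorem resolvent_continuous (c : XX) : Continuous fun p => resolvent p c :=
  continuous_iff_continuousAt.2 fun p =>
    ((ContinuousLinearMap.apply ℂ XX c).continuous.continuousAt).comp
      (neumann_analyticAt V V_pow_summable p).continuousAt

theorem resolvent_eval_hasFDerivAt (ℓ : XX →L[ℂ] ℂ) (c : XX) (p : Param) :
    ∃ D : Param →L[ℂ] ℂ, HasFDerivAt (fun p => ℓ (resolvent p c)) D p ∧
      ∀ d, D d = ℓ (resolvent p (V d (resolvent p c))) :=
  neumann_eval_hasFDerivAt V V_pow_summable ℓ c p

theorem resolvent_eval_analyticAt (ℓ : XX →L[ℂ] ℂ) (c : XX) (p : Param) :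
    AnalyticAt ℂ (fun p => ℓ (resolvent p c)) p :=
  neumann_eval_analyticAt V V_pow_summable ℓ c p

/-! ### Solutions of the Zakharov–Shabat system -/

theorem V_integrand_integrable_fst (p : Param) (f : XX) :
    IntervalIntegrable (fun s => -Complex.I * p.1 * ext f.1 s +
      Complex.I * p.2.fst s * ext f.2 s) volume 0 1 := by
  refine IntervalIntegrable.add ?_ ?_
  · exact ((ext_continuous f.1).const_mul _).intervalIntegrable _ _
  · simpa only [mul_assoc] using
      (L2_mul_integrable p.2.fst (ext_continuous f.2).continuousOn).const_mul Complex.I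

theorem V_integrand_integrable_snd (p : Param) (f : XX) :
    IntervalIntegrable (fun s => Complex.I * p.1 * ext f.2 s -
      Complex.I * p.2.snd s * ext f.1 s) volume 0 1 := by
  refine IntervalIntegrable.sub ?_ ?_
  · exact ((ext_continuous f.2).const_mul _).intervalIntegrable _ _
  · simpa only [mul_assoc] using
      (L2_mul_integrable p.2.snd (ext_continuous f.1).continuousOn).const_mul Complex.I

theorem ext_B_one (f : X) {t : ℝ} (ht : t ∈ Icc (0 : ℝ) 1) :
    ext (B oneL2 f) t = ∫ s in (0 : ℝ)..t, ext f s := by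
  rw [ext_B _ _ ht]
  refine intervalIntegral.integral_congr_ae ?_
  filter_upwards [oneL2_ae] with s hs hst
  rw [uIoc_of_le ht.1] at hst
  rw [hs ⟨hst.1.le, hst.2.trans ht.2⟩, one_mul]

theorem ext_V_fst (p : Param) (f : XX) {t : ℝ} (ht : t ∈ Icc (0 : ℝ) 1) :
    ext (V p f).1 t = ∫ s in (0 : ℝ)..t, (-Complex.I * p.1 * ext f.1 s +
      Complex.I * p.2.fst s * ext f.2 s) := by
  rw [V_apply_fst, ext_add, ext_smul, ext_smul, ext_B_one _ ht, ext_B _ _ ht,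
    ← intervalIntegral.integral_const_mul, ← intervalIntegral.integral_const_mul,
    ← intervalIntegral.integral_add]
  · simp only [mul_assoc]
  · exact ((ext_continuous f.1).const_mul _).intervalIntegrable _ _
  · exact (L2_mul_integrable' p.2.fst (ext_continuous f.2).continuousOn ht).const_mul Complex.I

theorem ext_V_snd (p : Param) (f : XX) {t : ℝ} (ht : t ∈ Icc (0 : ℝ) 1) :
    ext (V p f).2 t = ∫ s in (0 : ℝ)..t, (Complex.I * p.1 * ext f.2 s -
      Complex.I * p.2.snd s * ext f.1 s) := by
  rw [V_apply_snd, ext_sub, ext_smul, ext_smul, ext_B_one _ ht, ext_B _ _ ht,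
    ← intervalIntegral.integral_const_mul, ← intervalIntegral.integral_const_mul,
    ← intervalIntegral.integral_sub]
  · simp only [mul_assoc]
  · exact ((ext_continuous f.2).const_mul _).intervalIntegrable _ _
  · exact (L2_mul_integrable' p.2.snd (ext_continuous f.1).continuousOn ht).const_mul Complex.I

theorem ACD_V_fst (p : Param) (f : XX) :
    ACD (ext (V p f).1) (fun s => -Complex.I * p.1 * ext f.1 s +
      Complex.I * p.2.fst s * ext f.2 s) :=
  ACD.of_integral 0 (V_integrand_integrable_fst p f) fun t ht => by rw [ext_V_fst p f ht, zero_add]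

theorem ACD_V_snd (p : Param) (f : XX) :
    ACD (ext (V p f).2) (fun s => Complex.I * p.1 * ext f.2 s -
      Complex.I * p.2.snd s * ext f.1 s) :=
  ACD.of_integral 0 (V_integrand_integrable_snd p f) fun t ht => by rw [ext_V_snd p f ht, zero_add]

/-- `f' = (-iλR + iRΦ) f + s` for the potential `(q₁, q₂)` and the source `s = (s₁, s₂)`. -/
structure IsForcedSol (q₁ q₂ : ℝ → ℂ) (lam : ℂ) (s₁ s₂ f₁ f₂ : ℝ → ℂ) : Prop where
  fst : ACD f₁ (fun s => -Complex.I * lam * f₁ s + Complex.I * q₁ s * f₂ s + s₁ s)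
  snd : ACD f₂ (fun s => Complex.I * lam * f₂ s - Complex.I * q₂ s * f₁ s + s₂ s)

/-- `f' = (-iλR + iRΦ) f` for the potential `(q₁, q₂)`. -/
abbrev IsSol (q₁ q₂ : ℝ → ℂ) (lam : ℂ) (f₁ f₂ : ℝ → ℂ) : Prop :=
  IsForcedSol q₁ q₂ lam (fun _ => 0) (fun _ => 0) f₁ f₂

/-- The coefficient matrix has trace zero, so the homogeneous terms cancel and only the source
paired with g survives. This one identity gives det M = 1, uniqueness and variation of constants. -/
theorem IsForcedSol.wronskian {q₁ q₂ s₁ s₂ f₁ f₂ g₁ g₂ : ℝ → ℂ} {lam : ℂ}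
    (hf : IsForcedSol q₁ q₂ lam s₁ s₂ f₁ f₂) (hg : IsSol q₁ q₂ lam g₁ g₂) :
    ACD (fun s => f₁ s * g₂ s - f₂ s * g₁ s) (fun s => s₁ s * g₂ s - s₂ s * g₁ s) :=
  ((hf.fst.mul hg.snd).sub (hf.snd.mul hg.fst)).congr_deriv (ae_of_all _ fun s _ => by ring)

theorem IsSol.wronskian_const {q₁ q₂ f₁ f₂ g₁ g₂ : ℝ → ℂ} {lam : ℂ}
    (hf : IsSol q₁ q₂ lam f₁ f₂) (hg : IsSol q₁ q₂ lam g₁ g₂) {t : ℝ} (ht : t ∈ Icc (0 : ℝ) 1) :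
    f₁ t * g₂ t - f₂ t * g₁ t = f₁ 0 * g₂ 0 - f₂ 0 * g₁ 0 :=
  (IsForcedSol.wronskian hf hg).eq_const (by simp) t ht

/-- The pair of constant functions `(c₁, c₂)`. -/
def constXX (c₁ c₂ : ℂ) : XX := ((c₁ • 1 : X), (c₂ • 1 : X))

/-- The solution with initial value `(c₁, c₂)`. -/
def sol (p : Param) (c₁ c₂ : ℂ) : XX := resolvent p (constXX c₁ c₂)

theorem zero_mem_unit : (0 : ℝ) ∈ Icc (0 : ℝ) 1 := by simp
theorem one_mem_unit : (1 : ℝ) ∈ Icc (0 : ℝ) 1 := by simp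

theorem sol_fst (p : Param) (c₁ c₂ : ℂ) (t : ℝ) :
    ext (sol p c₁ c₂).1 t = c₁ + ext (V p (sol p c₁ c₂)).1 t := by
  have h : sol p c₁ c₂ = constXX c₁ c₂ + V p (sol p c₁ c₂) := resolvent_apply p _
  conv_lhs => rw [h]
  change ext (c₁ • 1 : X) t + ext (V p (sol p c₁ c₂)).1 t = _
  rw [ext_smul, ext_one, mul_one]

theorem sol_snd (p : Param) (c₁ c₂ : ℂ) (t : ℝ) :
    ext (sol p c₁ c₂).2 t = c₂ + ext (V p (sol p c₁ c₂)).2 t := by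
  have h : sol p c₁ c₂ = constXX c₁ c₂ + V p (sol p c₁ c₂) := resolvent_apply p _
  conv_lhs => rw [h]
  change ext (c₂ • 1 : X) t + ext (V p (sol p c₁ c₂)).2 t = _
  rw [ext_smul, ext_one, mul_one]

theorem sol_isSol (p : Param) (c₁ c₂ : ℂ) :
    IsSol p.2.fst p.2.snd p.1 (ext (sol p c₁ c₂).1) (ext (sol p c₁ c₂).2) where
  fst := ACD.of_integral c₁ (by simpa using V_integrand_integrable_fst p _) fun t ht => by
    rw [sol_fst, ext_V_fst p _ ht]; simp
  snd := ACD.of_integral c₂ (by simpa using V_integrand_integrable_snd p _) fun t ht => by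
    rw [sol_snd, ext_V_snd p _ ht]; simp

theorem sol_fst_zero (p : Param) (c₁ c₂ : ℂ) : ext (sol p c₁ c₂).1 0 = c₁ := by
  rw [sol_fst, ext_V_fst p _ zero_mem_unit]; simp

theorem sol_snd_zero (p : Param) (c₁ c₂ : ℂ) : ext (sol p c₁ c₂).2 0 = c₂ := by
  rw [sol_snd, ext_V_snd p _ zero_mem_unit]; simp

/-- The entry `m₁₁` of the fundamental solution. -/
def m11 (p : Param) : ℝ → ℂ := ext (sol p 1 0).1
/-- The entry `m₂₁` of the fundamental solution. -/
def m21 (p : Param) : ℝ → ℂ := ext (sol p 1 0).2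
/-- The entry `m₁₂` of the fundamental solution. -/
def m12 (p : Param) : ℝ → ℂ := ext (sol p 0 1).1
/-- The entry `m₂₂` of the fundamental solution. -/
def m22 (p : Param) : ℝ → ℂ := ext (sol p 0 1).2

theorem m11_continuous (p : Param) : Continuous (m11 p) := ext_continuous _
theorem m21_continuous (p : Param) : Continuous (m21 p) := ext_continuous _
theorem m12_continuous (p : Param) : Continuous (m12 p) := ext_continuous _
theorem m22_continuous (p : Param) : Continuous (m22 p) := ext_continuous _

@[simp] theorem m11_zero (p : Param) : m11 p 0 = 1 := sol_fst_zero p _ _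
@[simp] theorem m21_zero (p : Param) : m21 p 0 = 0 := sol_snd_zero p _ _
@[simp] theorem m12_zero (p : Param) : m12 p 0 = 0 := sol_fst_zero p _ _
@[simp] theorem m22_zero (p : Param) : m22 p 0 = 1 := sol_snd_zero p _ _

theorem col1_isSol (p : Param) : IsSol p.2.fst p.2.snd p.1 (m11 p) (m21 p) := sol_isSol p 1 0
theorem col2_isSol (p : Param) : IsSol p.2.fst p.2.snd p.1 (m12 p) (m22 p) := sol_isSol p 0 1

theorem det_eq_one (p : Param) {t : ℝ} (ht : t ∈ Icc (0 : ℝ) 1) :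
    m11 p t * m22 p t - m21 p t * m12 p t = 1 := by
  rw [(col1_isSol p).wronskian_const (col2_isSol p) ht]; simp

/-- Uniqueness without Gronwall: the Wronskians with the two columns are constant, and det M = 1
lets Cramer's rule recover the solution from them. -/
theorem IsSol.eq_fundamental (p : Param) {f₁ f₂ : ℝ → ℂ} (hf : IsSol p.2.fst p.2.snd p.1 f₁ f₂)
    {t : ℝ} (ht : t ∈ Icc (0 : ℝ) 1) :
    f₁ t = f₁ 0 * m11 p t + f₂ 0 * m12 p t ∧ f₂ t = f₁ 0 * m21 p t + f₂ 0 * m22 p t := by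
  have h1 := hf.wronskian_const (col1_isSol p) ht
  have h2 := hf.wronskian_const (col2_isSol p) ht
  have h3 := det_eq_one p ht
  simp only [m11_zero, m21_zero, m12_zero, m22_zero] at h1 h2
  constructor
  · linear_combination (-f₁ t) * h3 + m11 p t * h2 - m12 p t * h1
  · linear_combination (-f₂ t) * h3 + m21 p t * h2 - m22 p t * h1

/-! ### Variation of constants -/

/-- The Wronskians with both columns vanish at 0, so at 1 they equal the integrals of the source
terms; Cramer's rule with det M = 1 then yields the value. -/
theorem forced_value (p : Param) {s₁ s₂ f₁ f₂ : ℝ → ℂ}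
    (hf : IsForcedSol p.2.fst p.2.snd p.1 s₁ s₂ f₁ f₂) (h1 : f₁ 0 = 0) (h2 : f₂ 0 = 0)
    (i1 : IntervalIntegrable s₁ volume 0 1) (i2 : IntervalIntegrable s₂ volume 0 1) :
    f₁ 1 = m11 p 1 * (∫ s in (0 : ℝ)..1, (s₁ s * m22 p s - s₂ s * m12 p s)) -
        m12 p 1 * (∫ s in (0 : ℝ)..1, (s₁ s * m21 p s - s₂ s * m11 p s)) ∧
    f₂ 1 = m21 p 1 * (∫ s in (0 : ℝ)..1, (s₁ s * m22 p s - s₂ s * m12 p s)) -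
        m22 p 1 * (∫ s in (0 : ℝ)..1, (s₁ s * m21 p s - s₂ s * m11 p s)) := by
  have w1 := (hf.wronskian (col1_isSol p)).integral_eq
    ((i1.mul_continuousOn (m21_continuous p).continuousOn).sub
      (i2.mul_continuousOn (m11_continuous p).continuousOn)) 1 one_mem_unit
  have w2 := (hf.wronskian (col2_isSol p)).integral_eq
    ((i1.mul_continuousOn (m22_continuous p).continuousOn).sub
      (i2.mul_continuousOn (m12_continuous p).continuousOn)) 1 one_mem_unit
  have h3 := det_eq_one p one_mem_unit
  simp only [h1, h2, zero_mul, sub_zero, zero_add] at w1 w2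
  rw [← w1, ← w2]
  constructor
  · linear_combination (-f₁ 1) * h3
  · linear_combination (-f₂ 1) * h3

/-! ### Derivatives of the monodromy matrix in the spectral parameter and the potential -/

/-- Evaluation of the components at a point. -/
def evalFst (t : Icc (0 : ℝ) 1) : XX →L[ℂ] ℂ :=
  (ContinuousMap.evalCLM ℂ t) ∘L (ContinuousLinearMap.fst ℂ X X)

/-- Evaluation of the second component. -/
def evalSnd (t : Icc (0 : ℝ) 1) : XX →L[ℂ] ℂ :=
  (ContinuousMap.evalCLM ℂ t) ∘L (ContinuousLinearMap.snd ℂ X X)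

theorem evalFst_apply (t : Icc (0 : ℝ) 1) (f : XX) : evalFst t f = ext f.1 t := by
  rw [ext_of_mem _ t.2]; rfl

theorem evalSnd_apply (t : Icc (0 : ℝ) 1) (f : XX) : evalSnd t f = ext f.2 t := by
  rw [ext_of_mem _ t.2]; rfl

/-- By the resolvent formula, the derivative of a solution u in direction d is R V(d) u; it solves
the system with the varied coefficients, applied to u, as source. -/
theorem resolvent_V_isForcedSol (p d : Param) (u : XX) :
    IsForcedSol p.2.fst p.2.snd p.1
      (fun s => -Complex.I * d.1 * ext u.1 s + Complex.I * d.2.fst s * ext u.2 s)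
      (fun s => Complex.I * d.1 * ext u.2 s - Complex.I * d.2.snd s * ext u.1 s)
      (ext (resolvent p (V d u)).1) (ext (resolvent p (V d u)).2) := by
  have h := resolvent_apply p (V d u)
  set w := resolvent p (V d u) with hw
  have e1 : ext w.1 = fun s => ext (V d u).1 s + ext (V p w).1 s := by
    funext s
    conv_lhs => rw [h]
    rfl
  have e2 : ext w.2 = fun s => ext (V d u).2 s + ext (V p w).2 s := by
    funext s
    conv_lhs => rw [h]
    rfl
  constructor
  · have := ((ACD_V_fst d u).add (ACD_V_fst p w)).congr_deriv
      (g' := fun s => -Complex.I * p.1 * ext w.1 s + Complex.I * p.2.fst s * ext w.2 s +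
        (-Complex.I * d.1 * ext u.1 s + Complex.I * d.2.fst s * ext u.2 s))
      (ae_of_all _ fun s _ => by ring)
    rwa [← e1] at this
  · have := ((ACD_V_snd d u).add (ACD_V_snd p w)).congr_deriv
      (g' := fun s => Complex.I * p.1 * ext w.2 s - Complex.I * p.2.snd s * ext w.1 s +
        (Complex.I * d.1 * ext u.2 s - Complex.I * d.2.snd s * ext u.1 s))
      (ae_of_all _ fun s _ => by ring)
    rwa [← e2] at this

theorem resolvent_V_zero (p d : Param) (u : XX) :
    ext (resolvent p (V d u)).1 0 = 0 ∧ ext (resolvent p (V d u)).2 0 = 0 := by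
  have h := resolvent_apply p (V d u)
  constructor
  · rw [h]
    change ext (V d u).1 0 + ext (V p _).1 0 = 0
    rw [ext_V_fst _ _ zero_mem_unit, ext_V_fst _ _ zero_mem_unit]; simp
  · rw [h]
    change ext (V d u).2 0 + ext (V p _).2 0 = 0
    rw [ext_V_snd _ _ zero_mem_unit, ext_V_snd _ _ zero_mem_unit]; simp

/-- The integrals in the variation of constants formula for the direction `d`. -/
def varInt (d : Param) (u₁ u₂ v₁ v₂ : ℝ → ℂ) : ℂ :=
  ∫ s in (0 : ℝ)..1, ((-Complex.I * d.1 * u₁ s + Complex.I * d.2.fst s * u₂ s) * v₂ s -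
    (Complex.I * d.1 * u₂ s - Complex.I * d.2.snd s * u₁ s) * v₁ s)

theorem m11_hasFDerivAt (p : Param) : ∃ D : Param →L[ℂ] ℂ,
    HasFDerivAt (fun p => m11 p 1) D p ∧ ∀ d, D d =
      m11 p 1 * varInt d (m11 p) (m21 p) (m12 p) (m22 p) -
      m12 p 1 * varInt d (m11 p) (m21 p) (m11 p) (m21 p) := by
  obtain ⟨D, hD, hD'⟩ := resolvent_eval_hasFDerivAt (evalFst ⟨1, one_mem_unit⟩) (constXX 1 0) p
  refine ⟨D, ?_, fun d => ?_⟩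
  · simpa only [evalFst_apply] using! hD
  · rw [hD', evalFst_apply]
    exact (forced_value p (resolvent_V_isForcedSol p d (sol p 1 0)) (resolvent_V_zero _ _ _).1
      (resolvent_V_zero _ _ _).2 (V_integrand_integrable_fst d _)
      (V_integrand_integrable_snd d _)).1

theorem m12_hasFDerivAt (p : Param) : ∃ D : Param →L[ℂ] ℂ,
    HasFDerivAt (fun p => m12 p 1) D p ∧ ∀ d, D d =
      m11 p 1 * varInt d (m12 p) (m22 p) (m12 p) (m22 p) -
      m12 p 1 * varInt d (m12 p) (m22 p) (m11 p) (m21 p) := by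
  obtain ⟨D, hD, hD'⟩ := resolvent_eval_hasFDerivAt (evalFst ⟨1, one_mem_unit⟩) (constXX 0 1) p
  refine ⟨D, ?_, fun d => ?_⟩
  · simpa only [evalFst_apply] using! hD
  · rw [hD', evalFst_apply]
    exact (forced_value p (resolvent_V_isForcedSol p d (sol p 0 1)) (resolvent_V_zero _ _ _).1
      (resolvent_V_zero _ _ _).2 (V_integrand_integrable_fst d _)
      (V_integrand_integrable_snd d _)).1

theorem m11_analyticAt (p : Param) : AnalyticAt ℂ (fun p => m11 p 1) p := by
  simpa only [evalFst_apply] using!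
    resolvent_eval_analyticAt (evalFst ⟨1, one_mem_unit⟩) (constXX 1 0) p

theorem m12_analyticAt (p : Param) : AnalyticAt ℂ (fun p => m12 p 1) p := by
  simpa only [evalFst_apply] using!
    resolvent_eval_analyticAt (evalFst ⟨1, one_mem_unit⟩) (constXX 0 1) p

theorem m22_analyticAt (p : Param) : AnalyticAt ℂ (fun p => m22 p 1) p := by
  simpa only [evalSnd_apply] using!
    resolvent_eval_analyticAt (evalSnd ⟨1, one_mem_unit⟩) (constXX 0 1) p

/-! ### Gauge transformation and the series of the fundamental solution -/

theorem memLp_mul_exp (a : L2) (lam : ℂ) :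
    MemLp (fun t : ℝ => a t * Complex.exp (lam * t)) 2 unitVolume := by
  obtain ⟨C, hC⟩ := (isCompact_Icc (a := (0:ℝ)) (b := 1)).exists_bound_of_continuousOn
    (f := fun t : ℝ => Complex.exp (lam * t)) (by fun_prop)
  refine MemLp.of_le_mul (c := C) (L2_memLp a) ?_ ?_
  · exact (L2_memLp a).1.mul (by fun_prop : Continuous fun t : ℝ => Complex.exp (lam * t)).aestronglyMeasurable
  · rw [ae_restrict_iff' measurableSet_Icc]
    refine ae_of_all _ fun t ht => ?_
    rw [norm_mul, mul_comm]
    exact mul_le_mul_of_nonneg_right (hC t ht) (norm_nonneg _)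

/-- The potential `(φ₁ e^{2iλt}, φ₂ e^{-2iλt})`. -/
def gauge (φ : L2c) (lam : ℂ) : L2c :=
  WithLp.toLp 2 ((memLp_mul_exp φ.fst (2 * Complex.I * lam)).toLp _,
    (memLp_mul_exp φ.snd (-(2 * Complex.I * lam))).toLp _)

theorem gauge_fst (φ : L2c) (lam : ℂ) : ∀ᵐ t, t ∈ Icc (0 : ℝ) 1 →
    (gauge φ lam).fst t = φ.fst t * Complex.exp (2 * Complex.I * lam * t) :=
  ae_unit (MemLp.coeFn_toLp (memLp_mul_exp φ.fst (2 * Complex.I * lam)))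

theorem gauge_snd (φ : L2c) (lam : ℂ) : ∀ᵐ t, t ∈ Icc (0 : ℝ) 1 →
    (gauge φ lam).snd t = φ.snd t * Complex.exp (-(2 * Complex.I * lam) * t) :=
  ae_unit (MemLp.coeFn_toLp (memLp_mul_exp φ.snd (-(2 * Complex.I * lam))))

theorem cexp_linear_ACD (c : ℂ) : ACD (fun t : ℝ => Complex.exp (c * t))
    (fun t => c * Complex.exp (c * t)) := by
  have : ∀ x : ℝ, HasDerivAt (fun t : ℝ => Complex.exp (c * t)) (c * Complex.exp (c * x)) x := by
    intro x
    have h : HasDerivAt (fun t : ℝ => c * (t : ℂ)) c x := by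
      simpa using (Complex.ofRealCLM.hasDerivAt (x := x)).const_mul c
    simpa [mul_comm] using h.cexp
  exact ACD.of_contDiff (contDiff_const.mul Complex.ofRealCLM.contDiff).cexp this

/-- Conjugation by diag(e^{-iλt}, e^{iλt}) moves λ into an oscillating factor of the potential. This
serves twice: it identifies the perturbation series of the definition, and it turns large real λ
into a Riemann–Lebesgue situation. -/
theorem gauge_isSol (φ : L2c) (lam : ℂ) {f₁ f₂ : ℝ → ℂ}
    (hf : IsSol (gauge φ lam).fst (gauge φ lam).snd 0 f₁ f₂) :
    IsSol φ.fst φ.snd lam (fun t => Complex.exp (-Complex.I * lam * t) * f₁ t)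
      (fun t => Complex.exp (Complex.I * lam * t) * f₂ t) where
  fst := ((cexp_linear_ACD (-Complex.I * lam)).mul hf.fst).congr_deriv (by
    filter_upwards [gauge_fst φ lam] with t h1 ht
    rw [h1 ht]
    have : Complex.exp (Complex.I * lam * t) = Complex.exp (-Complex.I * lam * t) *
        Complex.exp (2 * Complex.I * lam * t) := by rw [← Complex.exp_add]; congr 1; ring
    rw [this]; ring)
  snd := ((cexp_linear_ACD (Complex.I * lam)).mul hf.snd).congr_deriv (by
    filter_upwards [gauge_snd φ lam] with t h1 ht
    rw [h1 ht]
    have : Complex.exp (-Complex.I * lam * t) = Complex.exp (Complex.I * lam * t) *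
        Complex.exp (-(2 * Complex.I * lam) * t) := by rw [← Complex.exp_add]; congr 1; ring
    rw [this]; ring)

/-- Entries of the fundamental solution in terms of the gauged system at `λ = 0`. -/
theorem gauge_entries (φ : L2c) (lam : ℂ) {t : ℝ} (ht : t ∈ Icc (0 : ℝ) 1) :
    Complex.exp (-Complex.I * lam * t) * m11 (0, gauge φ lam) t = m11 (lam, φ) t ∧
    Complex.exp (Complex.I * lam * t) * m21 (0, gauge φ lam) t = m21 (lam, φ) t ∧
    Complex.exp (-Complex.I * lam * t) * m12 (0, gauge φ lam) t = m12 (lam, φ) t ∧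
    Complex.exp (Complex.I * lam * t) * m22 (0, gauge φ lam) t = m22 (lam, φ) t := by
  have h1 := (gauge_isSol φ lam (col1_isSol (0, gauge φ lam))).eq_fundamental (lam, φ) ht
  have h2 := (gauge_isSol φ lam (col2_isSol (0, gauge φ lam))).eq_fundamental (lam, φ) ht
  simpa [and_assoc] using And.intro h1 h2

/-- The components of a pair of functions, indexed by `Fin 2`. -/
def comp (f : XX) (i : Fin 2) : ℝ → ℂ := if i = 0 then ext f.1 else ext f.2

/-- The standard initial values. -/
def basisXX (j : Fin 2) : XX := if j = 0 then constXX 1 0 else constXX 0 1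

/-- The diagonal entries of the free solution. -/
def freeEntry (lam : ℂ) (i : Fin 2) (t : ℝ) : ℂ :=
  if i = 0 then Complex.exp (-Complex.I * lam * t) else Complex.exp (Complex.I * lam * t)

theorem ext_V_gauge_fst (φ : L2c) (lam : ℂ) (f : XX) {t : ℝ} (ht : t ∈ Icc (0 : ℝ) 1) :
    ext (V (0, gauge φ lam) f).1 t =
      ∫ s in (0 : ℝ)..t, Complex.I * φ.fst s * Complex.exp (2 * Complex.I * lam * s) * ext f.2 s := by
  rw [ext_V_fst _ _ ht]
  refine intervalIntegral.integral_congr_ae ?_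
  filter_upwards [gauge_fst φ lam] with s hs hst
  rw [uIoc_of_le ht.1] at hst
  rw [hs ⟨hst.1.le, hst.2.trans ht.2⟩]
  ring

theorem ext_V_gauge_snd (φ : L2c) (lam : ℂ) (f : XX) {t : ℝ} (ht : t ∈ Icc (0 : ℝ) 1) :
    ext (V (0, gauge φ lam) f).2 t =
      ∫ s in (0 : ℝ)..t,
        -Complex.I * φ.snd s * Complex.exp (-(2 * Complex.I * lam) * s) * ext f.1 s := by
  rw [ext_V_snd _ _ ht]
  refine intervalIntegral.integral_congr_ae ?_
  filter_upwards [gauge_snd φ lam] with s hs hst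
  rw [uIoc_of_le ht.1] at hst
  rw [hs ⟨hst.1.le, hst.2.trans ht.2⟩]
  ring

theorem ext_constXX_fst (c₁ c₂ : ℂ) (t : ℝ) : ext (constXX c₁ c₂).1 t = c₁ := by
  change ext (c₁ • 1 : X) t = _
  rw [ext_smul, ext_one, mul_one]

theorem ext_constXX_snd (c₁ c₂ : ℂ) (t : ℝ) : ext (constXX c₁ c₂).2 t = c₂ := by
  change ext (c₂ • 1 : X) t = _
  rw [ext_smul, ext_one, mul_one]

/-- The series defining the fundamental solution perturbs around the free solution, so it is the
Neumann series of the gauged system at λ = 0, not that of V(λ, φ). -/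
theorem fundTerm_eq (φ : L2c) (lam : ℂ) (n : ℕ) (j : Fin 2) :
    ∀ t ∈ Icc (0 : ℝ) 1, ∀ i, fundTerm φ lam n t i j =
      freeEntry lam i t * comp ((V (0, gauge φ lam) ^ n) (basisXX j)) i t := by
  induction n with
  | zero =>
    intro t ht i
    fin_cases i <;> fin_cases j <;>
      simp [fundTerm, freeSol, freeEntry, comp, basisXX, ext_constXX_fst, ext_constXX_snd]
  | succ n ih =>
    intro t ht i
    have e : (V (0, gauge φ lam) ^ (n + 1)) (basisXX j) =
      V (0, gauge φ lam) ((V (0, gauge φ lam) ^ n) (basisXX j)) := by rw [pow_succ']; rfl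
    rw [e]
    set u := (V (0, gauge φ lam) ^ n) (basisXX j) with hu
    have hmem : ∀ s ∈ uIcc 0 t, s ∈ Icc (0 : ℝ) 1 := fun s hs => by
      rw [uIcc_of_le ht.1] at hs; exact ⟨hs.1, hs.2.trans ht.2⟩
    fin_cases i
    · simp only [fundTerm, Matrix.of_apply, Fin.zero_eta]
      rw [show comp (V (0, gauge φ lam) u) 0 t = ext (V (0, gauge φ lam) u).1 t from rfl,
        ext_V_gauge_fst _ _ _ ht, ← intervalIntegral.integral_const_mul]
      refine intervalIntegral.integral_congr fun s hs => ?_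
      simp only [Matrix.mul_apply, Fin.sum_univ_two, ih s (hmem s hs), freeSol, potMatrix]
      simp only [freeEntry, comp, Matrix.of_apply, Matrix.cons_val', Matrix.cons_val_zero,
        Matrix.cons_val_one, Matrix.cons_val_fin_one, one_ne_zero, if_true, if_false]
      have : Complex.exp (-Complex.I * lam * (t - s : ℝ)) * Complex.exp (Complex.I * lam * s) =
          Complex.exp (-Complex.I * lam * t) * Complex.exp (2 * Complex.I * lam * s) := by
        rw [← Complex.exp_add, ← Complex.exp_add]; congr 1; push_cast; ring
      linear_combination (Complex.I * φ.fst s * ext u.2 s) * this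
    · simp only [fundTerm, Matrix.of_apply, Fin.mk_one]
      rw [show comp (V (0, gauge φ lam) u) 1 t = ext (V (0, gauge φ lam) u).2 t from rfl,
        ext_V_gauge_snd _ _ _ ht, ← intervalIntegral.integral_const_mul]
      refine intervalIntegral.integral_congr fun s hs => ?_
      simp only [Matrix.mul_apply, Fin.sum_univ_two, ih s (hmem s hs), freeSol, potMatrix]
      simp only [freeEntry, comp, Matrix.of_apply, Matrix.cons_val', Matrix.cons_val_zero,
        Matrix.cons_val_one, Matrix.cons_val_fin_one, one_ne_zero, if_true, if_false]
      have : Complex.exp (Complex.I * lam * (t - s : ℝ)) * Complex.exp (-Complex.I * lam * s) =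
          Complex.exp (Complex.I * lam * t) * Complex.exp (-(2 * Complex.I * lam) * s) := by
        rw [← Complex.exp_add, ← Complex.exp_add]; congr 1; push_cast; ring
      linear_combination (-Complex.I * φ.snd s * ext u.1 s) * this

theorem comp_resolvent_hasSum (p : Param) (c : XX) (i : Fin 2) {t : ℝ} (ht : t ∈ Icc (0 : ℝ) 1) :
    HasSum (fun n : ℕ => comp ((V p ^ n) c) i t) (comp (resolvent p c) i t) := by
  have h := (V_pow_summable p).hasSum
  have h1 := (ContinuousLinearMap.apply ℂ XX c).hasSum h
  fin_cases i
  · have := (evalFst ⟨t, ht⟩).hasSum h1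
    simpa only [evalFst_apply] using! this
  · have := (evalSnd ⟨t, ht⟩).hasSum h1
    simpa only [evalSnd_apply] using! this

theorem fundSol_eq (φ : L2c) (lam : ℂ) {t : ℝ} (ht : t ∈ Icc (0 : ℝ) 1) (i j : Fin 2) :
    fundSol φ lam t i j = freeEntry lam i t * comp (resolvent (0, gauge φ lam) (basisXX j)) i t := by
  rw [fundSol, Matrix.of_apply, ← (comp_resolvent_hasSum _ (basisXX j) i ht).tsum_eq,
    ← tsum_mul_left]
  exact tsum_congr fun n => fundTerm_eq φ lam n j t ht i

theorem discriminant_eq (φ : L2c) (lam : ℂ) :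
    discriminant φ lam = m11 (lam, φ) 1 + m22 (lam, φ) 1 := by
  obtain ⟨h1, -, -, h2⟩ := gauge_entries φ lam one_mem_unit
  rw [discriminant, Matrix.trace_fin_two, fundSol_eq φ lam one_mem_unit,
    fundSol_eq φ lam one_mem_unit, ← h1, ← h2]
  rfl

theorem discriminant_analyticAt (φ : L2c) (lam : ℂ) : AnalyticAt ℂ (discriminant φ) lam := by
  have e : discriminant φ = fun lam => m11 (lam, φ) 1 + m22 (lam, φ) 1 :=
    funext (discriminant_eq φ)
  have hg : AnalyticAt ℂ (fun lam : ℂ => ((lam, φ) : Param)) lam :=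
    analyticAt_id.prod analyticAt_const
  rw [e]
  exact ((m11_analyticAt (lam, φ)).comp_of_eq hg rfl).add
    ((m22_analyticAt (lam, φ)).comp_of_eq hg rfl)

theorem charFun_analyticAt (φ : L2c) (lam : ℂ) : AnalyticAt ℂ (charFun φ) lam :=
  ((discriminant_analyticAt φ lam).pow 2).sub analyticAt_const

/-! ### Periodic eigenvalues -/

theorem isPeriodicEigenvalue_isSol {φ : L2c} {lam : ℂ} (h : IsPeriodicEigenvalue φ lam) :
    ∃ f₁ f₂ : ℝ → ℂ, IsSol φ.fst φ.snd lam f₁ f₂ ∧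
      ((f₁ 1 = f₁ 0 ∧ f₂ 1 = f₂ 0) ∨ (f₁ 1 = -f₁ 0 ∧ f₂ 1 = -f₂ 0)) ∧
      ∃ t ∈ Icc (0 : ℝ) 1, f₁ t ≠ 0 ∨ f₂ t ≠ 0 := by
  obtain ⟨f₁, f₂, g₁, g₂, h1, h2, h3, h4, h5⟩ := h
  have int : ∀ g : ℝ → ℂ, MemLp g 2 unitVolume → IntervalIntegrable g volume 0 1 := fun g hg => by
    rw [intervalIntegrable_iff_integrableOn_Icc_of_le zero_le_one]
    exact hg.integrable one_le_two
  refine ⟨f₁, f₂, ⟨?_, ?_⟩, h3, h4⟩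
  · refine (ACD.of_integral _ (int _ h1.1) h1.2).congr_deriv ?_
    filter_upwards [ae_unit h5] with s hs hm
    linear_combination (-Complex.I) * (hs hm).1 + g₁ s * Complex.I_mul_I
  · refine (ACD.of_integral _ (int _ h2.1) h2.2).congr_deriv ?_
    filter_upwards [ae_unit h5] with s hs hm
    linear_combination (Complex.I) * (hs hm).2 + g₂ s * Complex.I_mul_I

theorem charFun_factor (φ : L2c) (lam : ℂ) : charFun φ lam =
    (m11 (lam, φ) 1 + m22 (lam, φ) 1 - 2) * (m11 (lam, φ) 1 + m22 (lam, φ) 1 + 2) := by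
  rw [charFun, discriminant_eq]; ring

theorem memLp_mul_continuous (a : L2) {g : ℝ → ℂ} (hg : Continuous g) :
    MemLp (fun t : ℝ => a t * g t) 2 unitVolume := by
  obtain ⟨C, hC⟩ := (isCompact_Icc (a := (0:ℝ)) (b := 1)).exists_bound_of_continuousOn
    hg.continuousOn
  refine MemLp.of_le_mul (c := C) (L2_memLp a) ((L2_memLp a).1.mul hg.aestronglyMeasurable) ?_
  rw [ae_restrict_iff' measurableSet_Icc]
  refine ae_of_all _ fun t ht => ?_
  rw [norm_mul, mul_comm]
  exact mul_le_mul_of_nonneg_right (hC t ht) (norm_nonneg _)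

theorem memLp_continuous {g : ℝ → ℂ} (hg : Continuous g) : MemLp g 2 unitVolume := by
  obtain ⟨C, hC⟩ := (isCompact_Icc (a := (0:ℝ)) (b := 1)).exists_bound_of_continuousOn
    hg.continuousOn
  refine MemLp.of_bound hg.aestronglyMeasurable C ?_
  rw [ae_restrict_iff' measurableSet_Icc]
  exact ae_of_all _ hC

/-- A matrix with determinant one and trace `±2` has an eigenvector for the eigenvalue `±1`. -/
theorem exists_eigenvector {a b c d ε : ℂ} (hdet : a * d - c * b = 1) (hε : ε ^ 2 = 1)
    (htr : a + d = 2 * ε) :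
    ∃ x y : ℂ, (x ≠ 0 ∨ y ≠ 0) ∧ x * a + y * b = ε * x ∧ x * c + y * d = ε * y := by
  by_cases h : b = 0 ∧ a = ε
  · obtain ⟨rfl, rfl⟩ := h
    by_cases hc : c = 0
    · exact ⟨1, 0, by simp, by ring, by rw [hc]; ring⟩
    · exact ⟨d - a, -c, Or.inr (neg_ne_zero.2 hc), by ring, by ring⟩
  · refine ⟨-b, a - ε, ?_, by ring, ?_⟩
    · by_contra! h0
      exact h ⟨neg_eq_zero.1 h0.1, sub_eq_zero.1 h0.2⟩
    · linear_combination hdet - hε - ε * htr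

/-- Since det M = 1, det(M - ε) = 2 - ε tr M for ε = ±1, so fixed or anti-fixed initial vectors
exist exactly when Δ = ±2. -/
theorem isPeriodicEigenvalue_iff (φ : L2c) (lam : ℂ) :
    IsPeriodicEigenvalue φ lam ↔ charFun φ lam = 0 := by
  have hdet := det_eq_one (lam, φ) one_mem_unit
  constructor
  · intro h
    obtain ⟨f₁, f₂, hs, hb, t, ht, hne⟩ := isPeriodicEigenvalue_isSol h
    have h1 := hs.eq_fundamental (lam, φ) one_mem_unit
    have h0 : f₁ 0 ≠ 0 ∨ f₂ 0 ≠ 0 := by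
      by_contra! h0
      have := hs.eq_fundamental (lam, φ) ht
      simp only [h0.1, h0.2, zero_mul, add_zero] at this
      exact hne.elim (fun h => h this.1) (fun h => h this.2)
    rw [charFun_factor]
    rcases hb with ⟨b1, b2⟩ | ⟨b1, b2⟩
    · rw [b1, b2] at h1
      apply mul_eq_zero_of_left
      rcases h0 with h0 | h0
      · apply mul_left_cancel₀ h0
        linear_combination (m22 (lam, φ) 1 - 1) * h1.1 - m12 (lam, φ) 1 * h1.2 +
          f₁ 0 * hdet
      · apply mul_left_cancel₀ h0
        linear_combination (m11 (lam, φ) 1 - 1) * h1.2 - m21 (lam, φ) 1 * h1.1 +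
          f₂ 0 * hdet
    · rw [b1, b2] at h1
      apply mul_eq_zero_of_right
      rcases h0 with h0 | h0
      · apply mul_left_cancel₀ h0
        linear_combination (m22 (lam, φ) 1 + 1) * (-h1.1) + m12 (lam, φ) 1 * h1.2 -
          f₁ 0 * hdet
      · apply mul_left_cancel₀ h0
        linear_combination (m11 (lam, φ) 1 + 1) * (-h1.2) + m21 (lam, φ) 1 * h1.1 -
          f₂ 0 * hdet
  · intro h
    rw [charFun_factor] at h
    obtain ⟨ε, hε, htr, hεs⟩ : ∃ ε : ℂ, ε ^ 2 = 1 ∧ m11 (lam, φ) 1 + m22 (lam, φ) 1 = 2 * ε ∧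
        (ε = 1 ∨ ε = -1) := by
      rcases mul_eq_zero.1 h with h | h
      · exact ⟨1, by norm_num, by linear_combination h, Or.inl rfl⟩
      · exact ⟨-1, by norm_num, by linear_combination h, Or.inr rfl⟩
    obtain ⟨x, y, hne, e1, e2⟩ := exists_eigenvector hdet hε htr
    have hs := sol_isSol (lam, φ) x y
    have h1 := hs.eq_fundamental (lam, φ) one_mem_unit
    simp only [sol_fst_zero, sol_snd_zero] at h1
    refine ⟨ext (sol (lam, φ) x y).1, ext (sol (lam, φ) x y).2,
      fun s => -Complex.I * lam * ext (sol (lam, φ) x y).1 s +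
        Complex.I * φ.fst s * ext (sol (lam, φ) x y).2 s,
      fun s => Complex.I * lam * ext (sol (lam, φ) x y).2 s -
        Complex.I * φ.snd s * ext (sol (lam, φ) x y).1 s, ⟨?_, ?_⟩, ⟨?_, ?_⟩, ?_, ?_, ?_⟩
    · refine (memLp_continuous ((ext_continuous _).const_mul _)).add ?_
      simpa only [mul_assoc] using
        (memLp_mul_continuous φ.fst (ext_continuous (sol (lam, φ) x y).2)).const_mul Complex.I
    · intro t ht
      rw [sol_fst_zero, sol_fst, ext_V_fst _ _ ht]
    · refine (memLp_continuous ((ext_continuous _).const_mul _)).sub ?_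
      simpa only [mul_assoc] using
        (memLp_mul_continuous φ.snd (ext_continuous (sol (lam, φ) x y).1)).const_mul Complex.I
    · intro t ht
      rw [sol_snd_zero, sol_snd, ext_V_snd _ _ ht]
    · rw [sol_fst_zero, sol_snd_zero, h1.1, h1.2, e1, e2]
      rcases hεs with rfl | rfl
      · left; simp
      · right; simp
    · exact ⟨0, zero_mem_unit, by rwa [sol_fst_zero, sol_snd_zero]⟩
    · refine ae_of_all _ fun t => ⟨?_, ?_⟩
      · linear_combination (-lam * ext (sol (lam, φ) x y).1 t +
          φ.fst t * ext (sol (lam, φ) x y).2 t) * Complex.I_mul_I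
      · linear_combination (-lam * ext (sol (lam, φ) x y).2 t +
          φ.snd t * ext (sol (lam, φ) x y).1 t) * Complex.I_mul_I

local notation "conj" => starRingEnd ℂ

/-! ### Potentials of real type -/

theorem L2r_ae {φ : L2c} (hφ : φ ∈ L2r) :
    ∀ᵐ t, t ∈ Icc (0 : ℝ) 1 → φ.snd t = conj (φ.fst t) := ae_unit hφ

/-- The antilinear symmetry behind SU(1,1); it needs real λ. Applied to the columns, it exchanges
their initial values and hence the columns themselves. -/
theorem IsSol.conj_swap {φ : L2c} (hφ : φ ∈ L2r) {x : ℝ} {f₁ f₂ : ℝ → ℂ}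
    (h : IsSol φ.fst φ.snd x f₁ f₂) :
    IsSol φ.fst φ.snd x (fun t => conj (f₂ t)) (fun t => conj (f₁ t)) where
  fst := h.snd.conj.congr_deriv (by
    filter_upwards [L2r_ae hφ] with t ht hm
    simp [ht hm])
  snd := h.fst.conj.congr_deriv (by
    filter_upwards [L2r_ae hφ] with t ht hm
    simp [ht hm]; ring)

theorem conj_symmetry {φ : L2c} (hφ : φ ∈ L2r) (x : ℝ) {t : ℝ} (ht : t ∈ Icc (0 : ℝ) 1) :
    m21 (x, φ) t = conj (m12 (x, φ) t) ∧ m22 (x, φ) t = conj (m11 (x, φ) t) := by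
  have h1 := ((col1_isSol ((x : ℂ), φ)).conj_swap hφ).eq_fundamental (x, φ) ht
  have h2 := ((col2_isSol ((x : ℂ), φ)).conj_swap hφ).eq_fundamental (x, φ) ht
  simp at h1 h2
  exact ⟨h2.2.symm, h1.2.symm⟩

theorem normSq_sub_normSq {φ : L2c} (hφ : φ ∈ L2r) (x : ℝ) {t : ℝ} (ht : t ∈ Icc (0 : ℝ) 1) :
    ‖m11 (x, φ) t‖ ^ 2 - ‖m12 (x, φ) t‖ ^ 2 = 1 := by
  have h := det_eq_one ((x : ℂ), φ) ht
  rw [(conj_symmetry hφ x ht).1, (conj_symmetry hφ x ht).2, Complex.mul_conj, mul_comm,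
    Complex.mul_conj, Complex.normSq_eq_norm_sq, Complex.normSq_eq_norm_sq] at h
  exact_mod_cast h

theorem one_le_norm_m11 {φ : L2c} (hφ : φ ∈ L2r) (x : ℝ) {t : ℝ} (ht : t ∈ Icc (0 : ℝ) 1) :
    1 ≤ ‖m11 (x, φ) t‖ := by
  nlinarith [normSq_sub_normSq hφ x ht, sq_nonneg ‖m12 (x, φ) t‖, norm_nonneg (m11 (x, φ) t)]

/-- The `L²` energy identity. -/
theorem IsSol.energy {φ : L2c} (hφ : φ ∈ L2r) {lam : ℂ} {f₁ f₂ : ℝ → ℂ}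
    (h : IsSol φ.fst φ.snd lam f₁ f₂) :
    ACD (fun t => f₁ t * conj (f₁ t) - f₂ t * conj (f₂ t))
      (fun t => (2 * lam.im * (‖f₁ t‖ ^ 2 + ‖f₂ t‖ ^ 2) : ℝ)) :=
  ((h.fst.mul h.fst.conj).sub (h.snd.mul h.snd.conj)).congr_deriv (by
    filter_upwards [L2r_ae hφ] with t ht hm
    have e1 : ((‖f₁ t‖ ^ 2 : ℝ) : ℂ) = f₁ t * conj (f₁ t) := by
      rw [Complex.mul_conj, Complex.normSq_eq_norm_sq]
    have e2 : ((‖f₂ t‖ ^ 2 : ℝ) : ℂ) = f₂ t * conj (f₂ t) := by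
      rw [Complex.mul_conj, Complex.normSq_eq_norm_sq]
    have e3 : ((2 * lam.im : ℝ) : ℂ) = -Complex.I * (lam - conj lam) := by
      rw [Complex.sub_conj]; push_cast; linear_combination (2 * (lam.im : ℂ)) * Complex.I_mul_I
    rw [Complex.ofReal_mul, Complex.ofReal_add, e1, e2, e3]
    simp [ht hm]
    ring)

/-- Periodic or antiperiodic boundary values give |f₁|² - |f₂|² the same value at 0 and 1, while its
derivative is 2 Im λ (|f₁|² + |f₂|²); a nonzero solution forces Im λ = 0. -/
theorem im_eq_zero_of_eigenvalue {φ : L2c} (hφ : φ ∈ L2r) {lam : ℂ}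
    (h : IsPeriodicEigenvalue φ lam) : lam.im = 0 := by
  obtain ⟨f₁, f₂, hs, hb, t, ht, hne⟩ := isPeriodicEigenvalue_isSol h
  by_contra him
  have c1 := hs.fst.continuousOn
  have c2 := hs.snd.continuousOn
  have hcont : ContinuousOn (fun t => 2 * lam.im * (‖f₁ t‖ ^ 2 + ‖f₂ t‖ ^ 2)) (Icc 0 1) := by
    fun_prop
  have hcontC : ContinuousOn (fun t => ((2 * lam.im * (‖f₁ t‖ ^ 2 + ‖f₂ t‖ ^ 2) : ℝ) : ℂ))
      (Icc 0 1) := Complex.continuous_ofReal.comp_continuousOn hcont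
  have e := (hs.energy hφ).integral_eq (by
    apply ContinuousOn.intervalIntegrable; simpa using hcontC) 1 one_mem_unit
  have e2 : ∫ s in (0 : ℝ)..1, (‖f₁ s‖ ^ 2 + ‖f₂ s‖ ^ 2) = 0 := by
    have e3 : (0 : ℂ) = ∫ s in (0 : ℝ)..1, ((2 * lam.im * (‖f₁ s‖ ^ 2 + ‖f₂ s‖ ^ 2) : ℝ) : ℂ) := by
      rcases hb with ⟨b1, b2⟩ | ⟨b1, b2⟩
      · rw [b1, b2] at e; linear_combination e
      · rw [b1, b2] at e; simp only [map_neg] at e; linear_combination e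
    rw [intervalIntegral.integral_ofReal, intervalIntegral.integral_const_mul] at e3
    have e4 : 2 * lam.im * ∫ s in (0 : ℝ)..1, (‖f₁ s‖ ^ 2 + ‖f₂ s‖ ^ 2) = 0 := by
      exact_mod_cast e3.symm
    simpa [him] using e4
  have hc : ContinuousOn (fun s => ‖f₁ s‖ ^ 2 + ‖f₂ s‖ ^ 2) (Icc 0 1) := by fun_prop
  have := intervalIntegral.integral_pos (a := 0) (b := 1) zero_lt_one hc
    (fun s _ => by positivity) ⟨t, ht, by
      rcases hne with h | h
      · have := norm_pos_iff.2 h; positivity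
      · have := norm_pos_iff.2 h; positivity⟩
  rw [e2] at this
  exact lt_irrefl _ this

/-! ### Derivatives with respect to the spectral parameter -/

/-- `∫₀¹ (|m₁₁|² + |m₁₂|²)`. -/
def pInt (φ : L2c) (x : ℝ) : ℝ := ∫ t in (0 : ℝ)..1, (‖m11 (x, φ) t‖ ^ 2 + ‖m12 (x, φ) t‖ ^ 2)

/-- `2 ∫₀¹ conj m₁₁ m₁₂`. -/
def qInt (φ : L2c) (x : ℝ) : ℂ := ∫ t in (0 : ℝ)..1, 2 * (conj (m11 (x, φ) t) * m12 (x, φ) t)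

/-- From 2|m₁₁||m₁₂| ≤ |m₁₁|² + |m₁₂|², strict at t = 0 where M = Id. This strictness drives all the
monotonicity below. -/
theorem norm_qInt_lt (φ : L2c) (x : ℝ) : ‖qInt φ x‖ < pInt φ x := by
  have c1 := m11_continuous ((x : ℂ), φ)
  have c2 := m12_continuous ((x : ℂ), φ)
  have h1 : ‖qInt φ x‖ ≤ ∫ t in (0 : ℝ)..1, 2 * (‖m11 (x, φ) t‖ * ‖m12 (x, φ) t‖) := by
    refine (intervalIntegral.norm_integral_le_integral_norm zero_le_one).trans_eq ?_
    simp
  refine h1.trans_lt ?_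
  have h2 : 0 < ∫ t in (0 : ℝ)..1, ((‖m11 (x, φ) t‖ ^ 2 + ‖m12 (x, φ) t‖ ^ 2) -
      2 * (‖m11 (x, φ) t‖ * ‖m12 (x, φ) t‖)) := by
    refine intervalIntegral.integral_pos zero_lt_one (by fun_prop) (fun t _ => ?_)
      ⟨0, zero_mem_unit, by simp⟩
    nlinarith [sq_nonneg (‖m11 (x, φ) t‖ - ‖m12 (x, φ) t‖)]
  rw [intervalIntegral.integral_sub] at h2
  · unfold pInt; linarith
  · apply Continuous.intervalIntegrable; fun_prop
  · apply Continuous.intervalIntegrable; fun_prop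

theorem varInt_lambda (u₁ u₂ v₁ v₂ : ℝ → ℂ) : varInt (1, 0) u₁ u₂ v₁ v₂ =
    -Complex.I * ∫ s in (0 : ℝ)..1, (u₁ s * v₂ s + u₂ s * v₁ s) := by
  rw [varInt, ← intervalIntegral.integral_const_mul]
  refine intervalIntegral.integral_congr_ae ?_
  filter_upwards [ae_unit (Lp.coeFn_zero ℂ 2 unitVolume)] with s hs hm
  rw [uIoc_of_le zero_le_one] at hm
  have e : ((0 : L2) : ℝ → ℂ) s = 0 := hs ⟨hm.1.le, hm.2⟩
  simp only [WithLp.zero_fst, WithLp.zero_snd, e]; ring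

theorem integral_m11_m22 {φ : L2c} (hφ : φ ∈ L2r) (x : ℝ) :
    ∫ s in (0 : ℝ)..1, (m11 (x, φ) s * m22 (x, φ) s + m21 (x, φ) s * m12 (x, φ) s) =
      pInt φ x := by
  rw [pInt, ← intervalIntegral.integral_ofReal]
  refine intervalIntegral.integral_congr fun s hs => ?_
  rw [uIcc_of_le zero_le_one] at hs
  simp only [(conj_symmetry hφ x hs).1, (conj_symmetry hφ x hs).2]
  rw [Complex.mul_conj, mul_comm (conj _), Complex.mul_conj, Complex.normSq_eq_norm_sq,
    Complex.normSq_eq_norm_sq, Complex.ofReal_add]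

theorem integral_m12_m22 {φ : L2c} (hφ : φ ∈ L2r) (x : ℝ) :
    ∫ s in (0 : ℝ)..1, (m12 (x, φ) s * m22 (x, φ) s + m22 (x, φ) s * m12 (x, φ) s) =
      qInt φ x := by
  refine intervalIntegral.integral_congr fun s hs => ?_
  rw [uIcc_of_le zero_le_one] at hs
  simp only [(conj_symmetry hφ x hs).2]
  ring

theorem integral_m11_m21 {φ : L2c} (hφ : φ ∈ L2r) (x : ℝ) :
    ∫ s in (0 : ℝ)..1, (m11 (x, φ) s * m21 (x, φ) s + m21 (x, φ) s * m11 (x, φ) s) =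
      conj (qInt φ x) := by
  have : conj (qInt φ x) =
      ∫ t in (0 : ℝ)..1, conj (2 * (conj (m11 (x, φ) t) * m12 (x, φ) t)) :=
    (Complex.conjCLE.toContinuousLinearMap.intervalIntegral_comp_comm (by
      have c1 := m11_continuous ((x : ℂ), φ)
      have c2 := m12_continuous ((x : ℂ), φ)
      have c3 := Complex.continuous_conj
      apply Continuous.intervalIntegrable; fun_prop)).symm
  rw [this]
  refine intervalIntegral.integral_congr fun s hs => ?_
  rw [uIcc_of_le zero_le_one] at hs
  simp only [(conj_symmetry hφ x hs).1, map_mul, Complex.conj_conj, map_ofNat]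
  ring

theorem param_line_hasDerivAt (φ : L2c) (x : ℂ) :
    HasDerivAt (fun lam : ℂ => ((lam, φ) : Param)) (1, 0) x :=
  (hasDerivAt_id x).prodMk (hasDerivAt_const x φ)

theorem m11_hasDerivAt {φ : L2c} (hφ : φ ∈ L2r) (x : ℝ) :
    HasDerivAt (fun x : ℝ => m11 (x, φ) 1)
      (Complex.I * (-(pInt φ x) * m11 (x, φ) 1 + conj (qInt φ x) * m12 (x, φ) 1)) x := by
  obtain ⟨D, hD, hD'⟩ := m11_hasFDerivAt ((x : ℂ), φ)
  have h := (hD.comp_hasDerivAt (x : ℂ) (param_line_hasDerivAt φ x)).comp_ofReal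
  refine h.congr_deriv ?_
  rw [hD', varInt_lambda, varInt_lambda, integral_m11_m22 hφ, integral_m11_m21 hφ]
  ring

theorem m12_hasDerivAt {φ : L2c} (hφ : φ ∈ L2r) (x : ℝ) :
    HasDerivAt (fun x : ℝ => m12 (x, φ) 1)
      (Complex.I * (-(qInt φ x) * m11 (x, φ) 1 + pInt φ x * m12 (x, φ) 1)) x := by
  obtain ⟨D, hD, hD'⟩ := m12_hasFDerivAt ((x : ℂ), φ)
  have h := (hD.comp_hasDerivAt (x : ℂ) (param_line_hasDerivAt φ x)).comp_ofReal
  refine h.congr_deriv ?_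
  rw [hD', varInt_lambda, varInt_lambda, integral_m12_m22 hφ]
  have : ∀ s, m12 (x, φ) s * m21 (x, φ) s + m22 (x, φ) s * m11 (x, φ) s =
      m11 (x, φ) s * m22 (x, φ) s + m21 (x, φ) s * m12 (x, φ) s := fun s => by ring
  simp only [this, integral_m11_m22 hφ]
  ring

/-! ### The phase of `m₁₁` -/

/-- The function `m₂₁ / m₁₁`. -/
def ratio (p : Param) : X := (sol p 1 0).2 * Ring.inverse (sol p 1 0).1

/-- `∫₀¹ i φ₁ m₂₁ / m₁₁`. -/
def logPart (p : Param) : ℂ := Complex.I * ext (B p.2.fst (ratio p)) 1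

/-- A continuous choice of `-arg m₁₁(1)`. -/
def phase (x : ℝ) (φ : L2c) : ℝ := x - (logPart (x, φ)).im

theorem isUnit_m11 {φ : L2c} (hφ : φ ∈ L2r) (x : ℝ) : IsUnit (sol ((x : ℂ), φ) 1 0).1 := by
  rw [ContinuousMap.isUnit_iff_forall_ne_zero]
  intro t h
  have h1 := one_le_norm_m11 hφ x t.2
  rw [m11, ext_of_mem _ t.2, h, norm_zero] at h1
  linarith

theorem ext_ratio {φ : L2c} (hφ : φ ∈ L2r) (x t : ℝ) :
    m11 (x, φ) t * ext (ratio (x, φ)) t = m21 (x, φ) t := by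
  have h : ext ((sol ((x : ℂ), φ) 1 0).1 * ratio (x, φ)) t = m21 (x, φ) t := by
    rw [ratio, mul_left_comm, Ring.mul_inverse_cancel _ (isUnit_m11 hφ x), mul_one]; rfl
  rwa [ext_mul] at h

/-- For real x the entry m₁₁ never vanishes, and m₁₁'/m₁₁ = -ix + iφ₁ m₂₁/m₁₁. Integrating gives a
logarithm that is jointly continuous in x and φ, so no branch has to be chosen. -/
theorem m11_eq_exp {φ : L2c} (hφ : φ ∈ L2r) (x : ℝ) :
    m11 (x, φ) 1 = Complex.exp (-(Complex.I * x) + logPart (x, φ)) := by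
  set p : Param := ((x : ℂ), φ) with hp
  have h1 : ACD (fun t => ext (B φ.fst (ratio p)) t) (fun t => φ.fst t * ext (ratio p) t) :=
    ACD.of_integral 0 (L2_mul_integrable _ (ext_continuous _).continuousOn) fun t ht => by
      rw [ext_B _ _ ht, zero_add]
  have h2 := ((cexp_linear_ACD (Complex.I * x)).mul (h1.const_mul (-Complex.I)).cexp)
  have h3 := ((col1_isSol p).fst.mul h2).eq_const (by
    filter_upwards with t _
    have := ext_ratio hφ x t
    rw [← hp] at this
    rw [← this]
    simp only [hp]
    ring) 1 one_mem_unit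
  have h4 : ext (B φ.fst (ratio p)) 0 = 0 := by rw [ext_B _ _ zero_mem_unit]; simp
  rw [h4] at h3
  simp only [m11_zero, Complex.ofReal_zero, mul_zero, Complex.exp_zero, mul_one,
    Complex.ofReal_one, ← Complex.exp_add] at h3
  have h5 : Complex.exp (Complex.I * x + -Complex.I * ext (B φ.fst (ratio p)) 1) *
    Complex.exp (-(Complex.I * x) + logPart p) = 1 := by
    rw [← Complex.exp_add, logPart, Complex.exp_eq_one_iff]
    exact ⟨0, by simp only [hp]; push_cast; ring⟩
  calc m11 p 1 = m11 p 1 * (Complex.exp (Complex.I * x + -Complex.I * ext (B φ.fst (ratio p)) 1) *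
    Complex.exp (-(Complex.I * x) + logPart p)) := by rw [h5, mul_one]
    _ = _ := by rw [← mul_assoc, h3, one_mul]

theorem m11_eq_phase {φ : L2c} (hφ : φ ∈ L2r) (x : ℝ) :
    m11 (x, φ) 1 = ‖m11 (x, φ) 1‖ * Complex.exp (-(Complex.I * phase x φ)) := by
  have h := m11_eq_exp hφ x
  have h1 : ‖m11 (x, φ) 1‖ = Real.exp (logPart (x, φ)).re := by
    rw [h, Complex.norm_exp]; simp
  rw [h1, Complex.ofReal_exp, ← Complex.exp_add, h]
  congr 1
  conv_lhs => rw [← Complex.re_add_im (logPart (x, φ))]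
  rw [phase]
  push_cast
  ring

theorem sol_continuous (c₁ c₂ : ℂ) : Continuous fun p => sol p c₁ c₂ := resolvent_continuous _

theorem param_continuous : Continuous fun z : ℝ × L2r => (((z.1 : ℂ), (z.2 : L2c)) : Param) := by
  fun_prop

theorem logPart_continuous :
    Continuous fun z : ℝ × L2r => logPart ((z.1 : ℂ), (z.2 : L2c)) := by
  rw [continuous_iff_continuousAt]
  intro z
  have h1 : ContinuousAt (fun z : ℝ × L2r => sol ((z.1 : ℂ), (z.2 : L2c)) 1 0) z :=
    ((sol_continuous 1 0).comp param_continuous).continuousAt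
  have hf : ContinuousAt (fun z : ℝ × L2r => (sol ((z.1 : ℂ), (z.2 : L2c)) 1 0).1) z :=
    (continuous_fst (X := X) (Y := X)).continuousAt.comp h1
  have hs : ContinuousAt (fun z : ℝ × L2r => (sol ((z.1 : ℂ), (z.2 : L2c)) 1 0).2) z :=
    (continuous_snd (X := X) (Y := X)).continuousAt.comp h1
  have hi : ContinuousAt (fun z : ℝ × L2r => Ring.inverse (sol ((z.1 : ℂ), (z.2 : L2c)) 1 0).1) z := by
    obtain ⟨u, hu⟩ := isUnit_m11 z.2.2 z.1
    have := NormedRing.inverse_continuousAt u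
    rw [hu] at this
    exact ContinuousAt.comp (f := fun z : ℝ × L2r => (sol ((z.1 : ℂ), (z.2 : L2c)) 1 0).1) this hf
  have hr : ContinuousAt (fun z : ℝ × L2r => ratio ((z.1 : ℂ), (z.2 : L2c))) z := hs.mul hi
  have hφ : Continuous fun z : ℝ × L2r => B (WithLp.fst (z.2 : L2c)) :=
    B.continuous.comp ((WithLp.fstL 2 ℂ L2 L2).continuous.comp
      (continuous_subtype_val.comp continuous_snd))
  have hB := hφ.continuousAt.clm_apply hr
  have he := ((ContinuousMap.evalCLM ℂ (⟨1, one_mem_unit⟩ : Icc (0:ℝ) 1) :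
    X →L[ℂ] ℂ).continuous.continuousAt).comp hB
  have := he.const_mul Complex.I
  refine this.congr (Eventually.of_forall fun y => ?_)
  simp only [logPart]
  rw [ext_of_mem _ one_mem_unit]
  rfl

theorem phase_continuous : Continuous fun z : ℝ × L2r => phase z.1 (z.2 : L2c) :=
  continuous_fst.sub (Complex.continuous_im.comp logPart_continuous)

/-! ### Asymptotics for large real spectral parameters -/

/-- Dominated convergence along this filter requires it. -/
instance : (cocompact ℝ).IsCountablyGenerated := by
  rw [cocompact_eq_atBot_atTop]; infer_instance

theorem norm_exp_real_phase (c x t : ℝ) : ‖Complex.exp (c * Complex.I * x * t)‖ = 1 := by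
  rw [show (c * Complex.I * x * t : ℂ) = ((c * x * t : ℝ) : ℂ) * Complex.I by push_cast; ring]
  exact Complex.norm_exp_ofReal_mul_I _

theorem norm_gauge_fst_le (φ : L2c) (x : ℝ) : ‖(gauge φ x).fst‖ ≤ ‖φ.fst‖ := by
  refine Lp.norm_le_norm_of_ae_le ?_
  rw [ae_restrict_iff' measurableSet_Icc]
  filter_upwards [gauge_fst φ x] with t ht hm
  rw [ht hm, norm_mul]
  have := norm_exp_real_phase 2 x t
  push_cast at this
  rw [this, mul_one]

theorem norm_gauge_snd_le (φ : L2c) (x : ℝ) : ‖(gauge φ x).snd‖ ≤ ‖φ.snd‖ := by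
  refine Lp.norm_le_norm_of_ae_le ?_
  rw [ae_restrict_iff' measurableSet_Icc]
  filter_upwards [gauge_snd φ x] with t ht hm
  rw [ht hm, norm_mul]
  have := norm_exp_real_phase (-2) x t
  push_cast at this
  rw [show (-(2 * Complex.I * x) * t : ℂ) = -2 * Complex.I * x * t by ring, this, mul_one]

/-- For real x the gauge factor has modulus one, so the coefficient bound at λ = 0 is uniform in x.
-/
theorem gauge_sol_bounded (φ : L2c) : ∃ C : ℝ, 0 ≤ C ∧ ∀ x t : ℝ,
    ‖m11 (0, gauge φ x) t‖ ≤ C ∧ ‖m21 (0, gauge φ x) t‖ ≤ C := by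
  set K : ℝ := ‖φ.fst‖ + ‖φ.snd‖ with hK
  have hK0 : 0 ≤ K := by positivity
  refine ⟨(∑' n : ℕ, K ^ n * Real.sqrt (1 / n.factorial)) * ‖constXX 1 0‖,
    mul_nonneg (tsum_nonneg fun n => by positivity) (norm_nonneg _), fun x t => ?_⟩
  have h1 : coeffBound ((0 : ℂ), gauge φ x) ≤ K := by
    have := norm_gauge_fst_le φ x
    have := norm_gauge_snd_le φ x
    simp only [coeffBound, norm_zero, zero_mul, zero_add]
    linarith
  have h2 : ‖resolvent ((0 : ℂ), gauge φ x)‖ ≤ ∑' n : ℕ, K ^ n * Real.sqrt (1 / n.factorial) := by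
    refine (resolvent_norm_le _).trans ?_
    refine Summable.tsum_le_tsum (fun n => ?_) (summable_pow_mul_sqrt _ (coeffBound_nonneg _))
      (summable_pow_mul_sqrt _ hK0)
    have := coeffBound_nonneg ((0 : ℂ), gauge φ x)
    gcongr
  have h3 : ‖sol ((0 : ℂ), gauge φ x) 1 0‖ ≤
      (∑' n : ℕ, K ^ n * Real.sqrt (1 / n.factorial)) * ‖constXX 1 0‖ :=
    (ContinuousLinearMap.le_opNorm _ _).trans (mul_le_mul_of_nonneg_right h2 (norm_nonneg _))
  exact ⟨(norm_ext_le _ _).trans ((norm_fst_le (E := X) (F := X) _).trans h3),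
    (norm_ext_le _ _).trans ((norm_snd_le (E := X) (F := X) _).trans h3)⟩

/-- `∫₀ᵗ φ₂ e^{-2ixs} ds`. -/
def fourierPart (φ : L2c) (x t : ℝ) : ℂ :=
  ∫ s in (0 : ℝ)..t, φ.snd s * Complex.exp (-(2 * Complex.I * x) * s)

theorem fourierPart_tendsto (φ : L2c) {t : ℝ} (ht : t ∈ Icc (0 : ℝ) 1) :
    Tendsto (fun x => fourierPart φ x t) (cocompact ℝ) (𝓝 0) := by
  have h := Real.tendsto_integral_exp_smul_cocompact (indicator (Ioc 0 t) (φ.snd : ℝ → ℂ))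
  -- The Fourier character is e^{-2πivs}; the phase e^{-2ixs} corresponds to v = x/π.
  have h2 : Tendsto (fun x : ℝ => x * Real.pi⁻¹) (cocompact ℝ) (cocompact ℝ) :=
    (Homeomorph.mulRight₀ Real.pi⁻¹ (by positivity)).isClosedEmbedding.tendsto_cocompact
  refine (h.comp h2).congr fun x => ?_
  rw [fourierPart, intervalIntegral.integral_of_le ht.1, ← integral_indicator measurableSet_Ioc]
  refine integral_congr_ae (ae_of_all _ fun s => ?_)
  by_cases hs : s ∈ Ioc 0 t
  · simp only [indicator_of_mem hs, Circle.smul_def, Real.fourierChar_apply, smul_eq_mul]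
    rw [mul_comm]
    congr 2
    have : (Real.pi : ℂ) ≠ 0 := by exact_mod_cast Real.pi_ne_zero
    push_cast
    field_simp
  · simp [indicator_of_notMem hs]

theorem norm_mul_phase (φ : L2c) (x s : ℝ) :
    ‖φ.snd s * Complex.exp (-(2 * Complex.I * x) * s)‖ = ‖φ.snd s‖ := by
  have := norm_exp_real_phase (-2) x s
  push_cast at this
  rw [norm_mul, show (-(2 * Complex.I * x) * s : ℂ) = -2 * Complex.I * x * s by ring, this, mul_one]

theorem norm_fourierPart_le (φ : L2c) (x : ℝ) {t : ℝ} (ht : t ∈ Icc (0 : ℝ) 1) :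
    ‖fourierPart φ x t‖ ≤ ∫ s in (0 : ℝ)..1, ‖φ.snd s‖ := by
  refine (intervalIntegral.norm_integral_le_integral_norm ht.1).trans ?_
  simp only [norm_mul_phase]
  exact intervalIntegral.integral_mono_interval le_rfl ht.1 ht.2
    (ae_of_all _ fun s => norm_nonneg _) (L2_intervalIntegrable φ.snd).norm

theorem fourierPart_integrable (φ : L2c) (x : ℝ) :
    IntervalIntegrable (fun s : ℝ => φ.snd s * Complex.exp (-(2 * Complex.I * x) * s)) volume 0 1 :=
  L2_mul_integrable φ.snd (by fun_prop)

theorem fourierPart_ACD (φ : L2c) (x : ℝ) : ACD (fourierPart φ x)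
    (fun s => φ.snd s * Complex.exp (-(2 * Complex.I * x) * s)) :=
  ACD.of_integral 0 (fourierPart_integrable φ x) fun t _ => by rw [zero_add]; rfl

theorem fourierPart_weighted_tendsto (φ : L2c) :
    Tendsto (fun x => ∫ s in (0 : ℝ)..1, ‖fourierPart φ x s‖ * ‖φ.fst s‖) (cocompact ℝ) (𝓝 0) := by
  have := intervalIntegral.tendsto_integral_filter_of_dominated_convergence (μ := volume)
    (a := 0) (b := 1) (l := cocompact ℝ)
    (F := fun x s => ‖fourierPart φ x s‖ * ‖φ.fst s‖) (f := fun _ => (0 : ℝ))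
    (fun s => (∫ s in (0 : ℝ)..1, ‖φ.snd s‖) * ‖φ.fst s‖) ?_ ?_ ?_ ?_
  · simpa using this
  · refine Eventually.of_forall fun x => ?_
    have h1 := (L2_intervalIntegrable φ.fst).norm.mul_continuousOn
      (g := fun s => ‖fourierPart φ x s‖) (by
        rw [uIcc_of_le zero_le_one]; exact (fourierPart_ACD φ x).continuousOn.norm)
    simpa only [mul_comm] using h1.def'.aestronglyMeasurable
  · refine Eventually.of_forall fun x => ae_of_all _ fun s hs => ?_
    rw [uIoc_of_le zero_le_one] at hs
    rw [Real.norm_of_nonneg (by positivity)]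
    exact mul_le_mul_of_nonneg_right (norm_fourierPart_le φ x ⟨hs.1.le, hs.2⟩) (norm_nonneg _)
  · exact (L2_intervalIntegrable φ.fst).norm.const_mul _
  · refine ae_of_all _ fun s hs => ?_
    rw [uIoc_of_le zero_le_one] at hs
    have := (fourierPart_tendsto φ ⟨hs.1.le, hs.2⟩).norm.mul_const ‖φ.fst s‖
    simpa using this

/-- Integration by parts against the primitive of the oscillating potential: every term now contains
that primitive, which tends to 0 pointwise, times bounded solution entries. -/
theorem gauge_m21_formula (φ : L2c) (x : ℝ) {t : ℝ} (ht : t ∈ Icc (0 : ℝ) 1) :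
    m21 (0, gauge φ x) t = -Complex.I * (fourierPart φ x t * m11 (0, gauge φ x) t -
      ∫ s in (0 : ℝ)..t, Complex.I * (φ.fst s * (fourierPart φ x s *
        Complex.exp (2 * Complex.I * x * s) * m21 (0, gauge φ x) s))) := by
  set p : Param := ((0 : ℂ), gauge φ x) with hp
  have hm11 : ACD (m11 p) (fun s => Complex.I * (φ.fst s *
      (Complex.exp (2 * Complex.I * x * s) * m21 p s))) :=
    (col1_isSol p).fst.congr_deriv (by
      filter_upwards [gauge_fst φ x] with s hs hm
      have := hs hm
      simp only [hp, this]; ring)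
  have hm21 : ACD (m21 p) (fun s => -Complex.I * (φ.snd s *
      (Complex.exp (-(2 * Complex.I * x) * s) * m11 p s))) :=
    (col1_isSol p).snd.congr_deriv (by
      filter_upwards [gauge_snd φ x] with s hs hm
      have := hs hm
      simp only [hp, this]; ring)
  have hF := (fourierPart_ACD φ x).continuousOn
  have c11 := m11_continuous p
  have c21 := m21_continuous p
  have i1 : IntervalIntegrable (fun s : ℝ => φ.snd s *
      (Complex.exp (-(2 * Complex.I * x) * s) * m11 p s)) volume 0 1 :=
    L2_mul_integrable φ.snd (by fun_prop)
  have i2 : IntervalIntegrable (fun s : ℝ => φ.fst s * (fourierPart φ x s *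
        Complex.exp (2 * Complex.I * x * s) * m21 p s)) volume 0 1 :=
    L2_mul_integrable φ.fst (by fun_prop)
  have hprod := ((fourierPart_ACD φ x).mul hm11).congr_deriv
    (g' := fun s => φ.snd s * (Complex.exp (-(2 * Complex.I * x) * s) * m11 p s) +
      Complex.I * (φ.fst s * (fourierPart φ x s * Complex.exp (2 * Complex.I * x * s) * m21 p s)))
    (ae_of_all _ fun s _ => by ring)
  have e1 := hprod.integral_eq (i1.add (i2.const_mul _)) t ht
  have e2 := hm21.integral_eq (i1.const_mul _) t ht
  have h0 : fourierPart φ x 0 = 0 := by simp [fourierPart]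
  rw [intervalIntegral.integral_add (i1.mono_set (mem_sub_interval ht))
    ((i2.const_mul _).mono_set (mem_sub_interval ht)), h0] at e1
  rw [e2, e1, intervalIntegral.integral_const_mul, hp, m21_zero]
  ring

theorem gauge_m21_tendsto (φ : L2c) {t : ℝ} (ht : t ∈ Icc (0 : ℝ) 1) :
    Tendsto (fun x : ℝ => m21 (0, gauge φ x) t) (cocompact ℝ) (𝓝 0) := by
  obtain ⟨C, hC0, hC⟩ := gauge_sol_bounded φ
  have h1 : Tendsto (fun x => ‖fourierPart φ x t‖ * C +
      (∫ s in (0 : ℝ)..1, ‖fourierPart φ x s‖ * ‖φ.fst s‖) * C) (cocompact ℝ) (𝓝 0) := by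
    have := ((fourierPart_tendsto φ ht).norm.mul_const C).add
      ((fourierPart_weighted_tendsto φ).mul_const C)
    simpa using this
  refine squeeze_zero_norm (fun x => ?_) h1
  rw [gauge_m21_formula φ x ht, norm_mul, norm_neg, Complex.norm_I, one_mul]
  refine (norm_sub_le _ _).trans (add_le_add ?_ ?_)
  · rw [norm_mul]
    exact mul_le_mul_of_nonneg_left (hC x t).1 (norm_nonneg _)
  · have hF := (fourierPart_ACD φ x).continuousOn
    have iw : IntervalIntegrable (fun s => ‖fourierPart φ x s‖ * ‖φ.fst s‖ * C) volume 0 1 := by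
      have := ((L2_intervalIntegrable φ.fst).norm.mul_continuousOn
        (g := fun s => ‖fourierPart φ x s‖) (by
          rw [uIcc_of_le zero_le_one]; exact hF.norm)).mul_const C
      simpa only [mul_comm ‖φ.fst _‖] using this
    rw [← intervalIntegral.integral_mul_const]
    refine (intervalIntegral.norm_integral_le_of_norm_le ht.1 (ae_of_all _ fun s hs => ?_)
      (iw.mono_set (mem_sub_interval ht))).trans ?_
    · have := norm_exp_real_phase 2 x s
      push_cast at this
      rw [norm_mul, norm_mul, norm_mul, norm_mul, this, Complex.norm_I, one_mul, mul_one,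
        ← mul_assoc, mul_comm ‖φ.fst s‖]
      exact mul_le_mul_of_nonneg_left (hC x s).2 (by positivity)
    · exact intervalIntegral.integral_mono_interval le_rfl ht.1 ht.2
        (ae_of_all _ fun s => by positivity) iw

theorem norm_m21_eq (φ : L2c) (x : ℝ) {t : ℝ} (ht : t ∈ Icc (0 : ℝ) 1) :
    ‖m21 (x, φ) t‖ = ‖m21 (0, gauge φ x) t‖ := by
  have := norm_exp_real_phase 1 x t
  rw [Complex.ofReal_one, one_mul] at this
  rw [← (gauge_entries φ x ht).2.1, norm_mul, this, one_mul]

theorem m12_tendsto {φ : L2c} (hφ : φ ∈ L2r) :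
    Tendsto (fun x : ℝ => m12 (x, φ) 1) (cocompact ℝ) (𝓝 0) := by
  rw [tendsto_zero_iff_norm_tendsto_zero]
  have := (gauge_m21_tendsto φ one_mem_unit).norm
  rw [norm_zero] at this
  refine this.congr fun x => ?_
  rw [← norm_m21_eq φ x one_mem_unit, (conj_symmetry hφ x one_mem_unit).1, RCLike.norm_conj]

theorem norm_ratio_le {φ : L2c} (hφ : φ ∈ L2r) (x : ℝ) {t : ℝ} (ht : t ∈ Icc (0 : ℝ) 1) :
    ‖ext (ratio (x, φ)) t‖ ≤ ‖m21 (0, gauge φ x) t‖ := by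
  rw [← norm_m21_eq φ x ht, ← ext_ratio hφ x t, norm_mul]
  exact le_mul_of_one_le_left (norm_nonneg _) (one_le_norm_m11 hφ x ht)

/-- Since |m₁₁| ≥ 1, the quotient m₂₁/m₁₁ inherits the decay and the uniform bound of m₂₁. The limit
normalises the phase at infinity and thereby fixes the index n of each gap. -/
theorem logPart_tendsto {φ : L2c} (hφ : φ ∈ L2r) :
    Tendsto (fun x : ℝ => logPart (x, φ)) (cocompact ℝ) (𝓝 0) := by
  obtain ⟨C, hC0, hC⟩ := gauge_sol_bounded φ
  have := intervalIntegral.tendsto_integral_filter_of_dominated_convergence (μ := volume)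
    (a := 0) (b := 1) (l := cocompact ℝ)
    (F := fun (x : ℝ) s => φ.fst s * ext (ratio ((x : ℂ), φ)) s) (f := fun _ => (0 : ℂ))
    (fun s => ‖φ.fst s‖ * C) ?_ ?_ ?_ ?_
  · have h2 := this.const_mul Complex.I
    simp only [intervalIntegral.integral_zero, mul_zero] at h2
    refine h2.congr fun x => ?_
    rw [logPart, ext_B _ _ one_mem_unit]
  · exact Eventually.of_forall fun x =>
      (L2_mul_integrable φ.fst (ext_continuous _).continuousOn).def'.aestronglyMeasurable
  · refine Eventually.of_forall fun x => ae_of_all _ fun s hs => ?_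
    rw [uIoc_of_le zero_le_one] at hs
    rw [norm_mul]
    exact mul_le_mul_of_nonneg_left
      ((norm_ratio_le hφ x ⟨hs.1.le, hs.2⟩).trans (hC x s).2) (norm_nonneg _)
  · exact (L2_intervalIntegrable φ.fst).norm.mul_const _
  · refine ae_of_all _ fun s hs => ?_
    rw [uIoc_of_le zero_le_one] at hs
    have h1 : Tendsto (fun x : ℝ => ext (ratio ((x : ℂ), φ)) s) (cocompact ℝ) (𝓝 0) := by
      have := (gauge_m21_tendsto φ ⟨hs.1.le, hs.2⟩).norm
      rw [norm_zero] at this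
      exact squeeze_zero_norm (fun x => norm_ratio_le hφ x ⟨hs.1.le, hs.2⟩) this
    simpa using h1.const_mul (φ.fst s)

theorem phase_sub_tendsto {φ : L2c} (hφ : φ ∈ L2r) :
    Tendsto (fun x : ℝ => phase x φ - x) (cocompact ℝ) (𝓝 0) := by
  have := (Complex.continuous_im.tendsto 0).comp (logPart_tendsto hφ)
  have := this.neg
  simp only [Complex.zero_im, neg_zero] at this
  refine this.congr fun x => ?_
  simp [phase]

/-! ### Curves in `SU(1,1)` with the Prüfer monotonicity -/

/-- The disc of radius ‖ζ‖ about 1 is seen from the origin under the half-angle arcsin ‖ζ‖. -/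
theorem abs_arg_one_add_le {ζ : ℂ} (h : ‖ζ‖ < 1) : |(1 + ζ).arg| ≤ Real.arcsin ‖ζ‖ := by
  have hre : 0 < (1 + ζ).re := by
    have := Complex.abs_re_le_norm ζ
    simp only [Complex.add_re, Complex.one_re]
    linarith [neg_abs_le ζ.re]
  have hpos : 0 < ‖1 + ζ‖ := norm_pos_iff.2 fun h0 => by rw [h0] at hre; simp at hre
  have key : |(1 + ζ).im / ‖1 + ζ‖| ≤ ‖ζ‖ := by
    rw [abs_div, abs_of_pos hpos, div_le_iff₀ hpos]
    apply abs_le_of_sq_le_sq _ (by positivity)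
    rw [mul_pow, ← Complex.normSq_eq_norm_sq, ← Complex.normSq_eq_norm_sq, Complex.normSq_apply,
      Complex.normSq_apply]
    simp only [Complex.add_re, Complex.one_re, Complex.add_im, Complex.one_im, zero_add]
    -- With N = |ζ|², the difference N |1 + ζ|² - (Im ζ)² is exactly (Re ζ + N)².
    nlinarith [sq_nonneg (ζ.re + (ζ.re * ζ.re + ζ.im * ζ.im))]
  rw [Complex.arg_of_re_nonneg hre.le, abs_le, ← Real.arcsin_neg]
  exact ⟨Real.monotone_arcsin (abs_le.1 key).1, Real.monotone_arcsin (abs_le.1 key).2⟩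

/-- The bound is attained at the two tangent points: after rotating ζ to r = ‖ζ‖, the unit vector -r
+ εic with c² = 1 - r² gives 1 + r(-r + εic) = c(c + εir). -/
theorem exists_arg_one_add_eq {ζ : ℂ} (h : ‖ζ‖ < 1) {ε : ℝ} (hε : ε = 1 ∨ ε = -1) :
    ∃ w : ℂ, ‖w‖ = 1 ∧ (1 + ζ * w).arg = ε * Real.arcsin ‖ζ‖ := by
  set r := ‖ζ‖ with hr
  have hr0 : 0 ≤ r := norm_nonneg _
  have hε2 : ε ^ 2 = 1 := by rcases hε with rfl | rfl <;> norm_num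
  have hcs : 0 < 1 - r ^ 2 := by nlinarith
  set c := Real.sqrt (1 - r ^ 2) with hc
  have hc0 : 0 < c := Real.sqrt_pos.2 hcs
  have hc2 : c ^ 2 = 1 - r ^ 2 := Real.sq_sqrt hcs.le
  have hu : ζ * Complex.exp (-(ζ.arg * Complex.I)) = r := by
    calc ζ * Complex.exp (-(ζ.arg * Complex.I)) =
        (‖ζ‖ * Complex.exp (ζ.arg * Complex.I)) * Complex.exp (-(ζ.arg * Complex.I)) := by
          rw [Complex.norm_mul_exp_arg_mul_I]
      _ = r := by rw [mul_assoc, ← Complex.exp_add, add_neg_cancel, Complex.exp_zero, mul_one]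
  refine ⟨Complex.exp (-(ζ.arg * Complex.I)) * (-r + ε * c * Complex.I), ?_, ?_⟩
  · have h1 : ‖Complex.exp (-(ζ.arg * Complex.I))‖ = 1 := by
      rw [← neg_mul, ← Complex.ofReal_neg]; exact Complex.norm_exp_ofReal_mul_I _
    have h2 : ‖(-r + ε * c * Complex.I : ℂ)‖ ^ 2 = 1 := by
      rw [← Complex.normSq_eq_norm_sq, Complex.normSq_apply]
      simp
      nlinarith
    rw [norm_mul, h1, one_mul]
    nlinarith [norm_nonneg (-r + ε * c * Complex.I : ℂ)]
  · have hcos : Real.cos (ε * Real.arcsin r) = c := by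
      rcases hε with rfl | rfl
      · rw [one_mul, Real.cos_arcsin]
      · rw [neg_one_mul, Real.cos_neg, Real.cos_arcsin]
    have hsin : Real.sin (ε * Real.arcsin r) = ε * r := by
      rcases hε with rfl | rfl
      · rw [one_mul, Real.sin_arcsin (by linarith) h.le, one_mul]
      · rw [neg_one_mul, Real.sin_neg, Real.sin_arcsin (by linarith) h.le, neg_one_mul]
    have hmem : ε * Real.arcsin r ∈ Ioc (-Real.pi) Real.pi := by
      have h1 := Real.arcsin_le_pi_div_two r
      have h2 := Real.neg_pi_div_two_le_arcsin r
      have h3 := Real.pi_pos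
      rcases hε with rfl | rfl <;> constructor <;> linarith
    have key : 1 + ζ * (Complex.exp (-(ζ.arg * Complex.I)) * (-r + ε * c * Complex.I)) =
        c * (Complex.cos ((ε * Real.arcsin r : ℝ) : ℂ) +
          Complex.sin ((ε * Real.arcsin r : ℝ) : ℂ) * Complex.I) := by
      rw [← mul_assoc, hu, ← Complex.ofReal_cos, ← Complex.ofReal_sin, hcos, hsin]
      have : (c : ℂ) ^ 2 = 1 - (r : ℂ) ^ 2 := by exact_mod_cast hc2
      push_cast
      linear_combination -this
    rw [key, Complex.arg_mul_cos_add_sin_mul_I hc0 hmem]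

/-- A continuous choice of `-arg z` is differentiable. -/
theorem hasDerivAt_phase {z : ℝ → ℂ} {r h : ℝ → ℝ} {z' : ℂ} {x₀ : ℝ} (hz : HasDerivAt z z' x₀)
    (hr : ∀ x, 0 < r x) (hh : ContinuousAt h x₀)
    (e : ∀ x, z x = r x * Complex.exp (-(Complex.I * h x))) :
    HasDerivAt h (-(z' / z x₀).im) x₀ := by
  have hz0 : z x₀ ≠ 0 := by
    rw [e]; exact mul_ne_zero (by exact_mod_cast (hr _).ne') (Complex.exp_ne_zero _)
  have h1 : HasDerivAt (fun x => Complex.log (z x / z x₀)) (z' / z x₀) x₀ := by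
    have := (hz.div_const (z x₀)).clog_real (by rw [div_self hz0]; simp)
    rwa [div_self hz0, div_one] at this
  have h2 : HasDerivAt (fun x => (Complex.log (z x / z x₀)).im) (z' / z x₀).im x₀ :=
    Complex.imCLM.hasFDerivAt.comp_hasDerivAt x₀ h1
  have h3 : HasDerivAt (fun x => h x₀ - (Complex.log (z x / z x₀)).im) (-(z' / z x₀).im) x₀ :=
    h2.const_sub _
  refine h3.congr_of_eventuallyEq ?_
  -- Within distance π of the base phase, the principal logarithm of z(x)/z(x₀) recovers the
  -- difference of phases.
  have h4 : ∀ᶠ x in 𝓝 x₀, |h x - h x₀| < Real.pi := by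
    have := Metric.continuousAt_iff'.1 hh Real.pi Real.pi_pos
    simpa [Real.dist_eq] using this
  filter_upwards [h4] with x hx
  rw [abs_lt] at hx
  have h5 : z x / z x₀ = ((r x / r x₀ : ℝ) : ℂ) *
      (Complex.cos ((h x₀ - h x : ℝ) : ℂ) + Complex.sin ((h x₀ - h x : ℝ) : ℂ) * Complex.I) := by
    rw [← Complex.exp_mul_I, div_eq_iff hz0, e x, e x₀, Complex.ofReal_div]
    have : (r x₀ : ℂ) ≠ 0 := by exact_mod_cast (hr _).ne'
    field_simp
    rw [mul_assoc, ← Complex.exp_add]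
    congr 2
    push_cast; ring
  rw [Complex.log_im, h5, Complex.arg_mul_cos_add_sin_mul_I (div_pos (hr _) (hr _))
    ⟨by linarith, by linarith⟩]
  ring

/-- The data of a curve `(a, b)` in `SU(1,1)` moving monotonically, with a phase. -/
structure SpectralCurve where
  (a b q : ℝ → ℂ) (p θ : ℝ → ℝ)
  ha : ∀ x, HasDerivAt a (Complex.I * (-(p x) * a x + conj (q x) * b x)) x
  hb : ∀ x, HasDerivAt b (Complex.I * (-(q x) * a x + p x * b x)) x
  hpq : ∀ x, ‖q x‖ < p x
  det : ∀ x, ‖a x‖ ^ 2 - ‖b x‖ ^ 2 = 1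
  phase : ∀ x, a x = ‖a x‖ * Complex.exp (-(Complex.I * θ x))
  cont : Continuous θ
  lim : Tendsto (fun x => θ x - x) (cocompact ℝ) (𝓝 0)
  limb : Tendsto b (cocompact ℝ) (𝓝 0)

namespace SpectralCurve

variable (S : SpectralCurve)

theorem one_le_norm_a (x : ℝ) : 1 ≤ ‖S.a x‖ := by
  nlinarith [S.det x, sq_nonneg ‖S.b x‖, norm_nonneg (S.a x)]

theorem norm_b_lt (x : ℝ) : ‖S.b x‖ < ‖S.a x‖ := by
  nlinarith [S.det x, norm_nonneg (S.b x), norm_nonneg (S.a x)]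

theorem a_pos (x : ℝ) : 0 < ‖S.a x‖ := zero_lt_one.trans_le (S.one_le_norm_a x)

theorem a_ne (x : ℝ) : S.a x ≠ 0 := norm_pos_iff.1 (S.a_pos x)

theorem norm_ratio_lt (x : ℝ) : ‖S.b x / S.a x‖ < 1 := by
  rw [norm_div, div_lt_one (S.a_pos x)]; exact S.norm_b_lt x

/-- The half-width of the interval of phases. -/
def ρ (x : ℝ) : ℝ := Real.arcsin (‖S.b x / S.a x‖)

/-- The upper phase. -/
def gp (x : ℝ) : ℝ := S.θ x + S.ρ x

/-- The lower phase. -/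
def gm (x : ℝ) : ℝ := S.θ x - S.ρ x

theorem ρ_nonneg (x : ℝ) : 0 ≤ S.ρ x := Real.arcsin_nonneg.2 (norm_nonneg _)

theorem ρ_lt (x : ℝ) : S.ρ x < Real.pi / 2 := Real.arcsin_lt_pi_div_two.2 (S.norm_ratio_lt x)

theorem a_continuous : Continuous S.a :=
  continuous_iff_continuousAt.2 fun x => (S.ha x).continuousAt

theorem b_continuous : Continuous S.b :=
  continuous_iff_continuousAt.2 fun x => (S.hb x).continuousAt

theorem ratio_continuous : Continuous fun x => S.b x / S.a x :=
  S.b_continuous.div S.a_continuous S.a_ne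

theorem ρ_continuous : Continuous S.ρ := Real.continuous_arcsin.comp S.ratio_continuous.norm

theorem gp_continuous : Continuous S.gp := S.cont.add S.ρ_continuous

theorem gm_continuous : Continuous S.gm := S.cont.sub S.ρ_continuous

/-- The phase of `a + b w`. -/
def dirPhase (w : ℂ) (x : ℝ) : ℝ := S.θ x - (1 + S.b x / S.a x * w).arg

theorem norm_ratio_mul {w : ℂ} (hw : ‖w‖ = 1) (x : ℝ) :
    ‖S.b x / S.a x * w‖ = ‖S.b x / S.a x‖ := by rw [norm_mul, hw, mul_one]

theorem dirPhase_le_gp {w : ℂ} (hw : ‖w‖ = 1) (x : ℝ) : S.dirPhase w x ≤ S.gp x := by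
  have h := abs_arg_one_add_le ((S.norm_ratio_mul hw x).trans_lt (S.norm_ratio_lt x))
  rw [S.norm_ratio_mul hw] at h
  have := (abs_le.1 h).1
  simp only [dirPhase, gp, ρ]
  linarith

theorem gm_le_dirPhase {w : ℂ} (hw : ‖w‖ = 1) (x : ℝ) : S.gm x ≤ S.dirPhase w x := by
  have h := abs_arg_one_add_le ((S.norm_ratio_mul hw x).trans_lt (S.norm_ratio_lt x))
  rw [S.norm_ratio_mul hw] at h
  have := (abs_le.1 h).2
  simp only [dirPhase, gm, ρ]
  linarith

/-- With z = a + b w, the determinant relation and |w| = 1 collapse Im(z' conj z) to -(p + Re(q w)),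
which is negative because |q| < p. -/
theorem im_derivative_neg {w : ℂ} (hw : ‖w‖ = 1) (x : ℝ) :
    ((Complex.I * (-(S.p x) * S.a x + conj (S.q x) * S.b x) +
      Complex.I * (-(S.q x) * S.a x + S.p x * S.b x) * w) / (S.a x + S.b x * w)).im < 0 := by
  have hz : S.a x + S.b x * w ≠ 0 := by
    intro h
    have : ‖S.a x‖ = ‖S.b x‖ := by
      rw [eq_neg_of_add_eq_zero_left h, norm_neg, norm_mul, hw, mul_one]
    exact (S.norm_b_lt x).ne this.symm
  have hdet := S.det x
  have hpq := S.hpq x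
  generalize S.a x = a at *
  generalize S.b x = b at *
  generalize S.q x = q at *
  generalize S.p x = p at *
  have hw2 : ‖w‖ ^ 2 = 1 := by rw [hw, one_pow]
  rw [← Complex.normSq_eq_norm_sq, Complex.normSq_apply] at hw2
  rw [← Complex.normSq_eq_norm_sq, ← Complex.normSq_eq_norm_sq, Complex.normSq_apply,
    Complex.normSq_apply] at hdet
  have hqw : -p < (q * w).re := by
    have h1 := Complex.abs_re_le_norm (q * w)
    rw [norm_mul, hw, mul_one] at h1
    linarith [neg_abs_le (q * w).re]
  have hN : 0 < Complex.normSq (a + b * w) := Complex.normSq_pos.2 hz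
  have key : ((Complex.I * (-p * a + conj q * b) + Complex.I * (-q * a + p * b) * w) *
      conj (a + b * w)).im = -(p + (q * w).re) := by
    simp only [Complex.mul_im, Complex.mul_re, Complex.add_re, Complex.add_im, Complex.I_re,
      Complex.I_im, Complex.neg_re, Complex.neg_im, Complex.conj_re, Complex.conj_im,
      Complex.ofReal_re, Complex.ofReal_im]
    linear_combination (-(p + (q.re * w.re - q.im * w.im))) * hdet +
      (p * (b.re * b.re + b.im * b.im) -
        ((q.re * a.re - q.im * a.im) * b.re + (q.re * a.im + q.im * a.re) * b.im)) * hw2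
  rw [div_eq_mul_inv, Complex.inv_def, ← mul_assoc, Complex.im_mul_ofReal, key]
  exact mul_neg_of_neg_of_pos (by linarith) (inv_pos.2 hN)

theorem dirPhase_strictMono {w : ℂ} (hw : ‖w‖ = 1) : StrictMono (S.dirPhase w) := by
  have hd : ∀ x, HasDerivAt (S.dirPhase w) (-((Complex.I * (-(S.p x) * S.a x +
      conj (S.q x) * S.b x) + Complex.I * (-(S.q x) * S.a x + S.p x * S.b x) * w) /
      (S.a x + S.b x * w)).im) x := by
    intro x
    have hpos : ∀ x, 0 < (1 + S.b x / S.a x * w).re := fun x => by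
      have h1 := Complex.abs_re_le_norm (S.b x / S.a x * w)
      rw [S.norm_ratio_mul hw] at h1
      have := S.norm_ratio_lt x
      simp only [Complex.add_re, Complex.one_re]
      linarith [neg_abs_le (S.b x / S.a x * w).re]
    refine hasDerivAt_phase (z := fun x => S.a x + S.b x * w)
      (r := fun x => ‖S.a x‖ * ‖1 + S.b x / S.a x * w‖)
      ((S.ha x).add ((S.hb x).mul_const w)) (fun x => mul_pos (S.a_pos x) ?_) ?_ fun x => ?_
    · exact norm_pos_iff.2 fun h0 => by have := hpos x; rw [h0] at this; simp at this
    · refine S.cont.continuousAt.sub ?_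
      have hc : ContinuousAt (fun x => 1 + S.b x / S.a x * w) x :=
        (continuous_const.add (S.ratio_continuous.mul continuous_const)).continuousAt
      exact ContinuousAt.comp (g := Complex.arg)
        (Complex.continuousAt_arg (Or.inl (hpos x))) hc
    · have e1 : S.a x + S.b x * w = S.a x * (1 + S.b x / S.a x * w) := by
        field_simp [S.a_ne x]
      have e2 := Complex.norm_mul_exp_arg_mul_I (1 + S.b x / S.a x * w)
      calc S.a x + S.b x * w = (‖S.a x‖ * Complex.exp (-(Complex.I * S.θ x))) *
          (‖1 + S.b x / S.a x * w‖ * Complex.exp ((1 + S.b x / S.a x * w).arg * Complex.I)) := by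
            rw [← S.phase x, e2, e1]
        _ = _ := by
            rw [mul_mul_mul_comm, ← Complex.exp_add, dirPhase]
            push_cast
            congr 2
            ring
  refine strictMono_of_deriv_pos fun x => ?_
  rw [(hd x).deriv]
  linarith [S.im_derivative_neg hw x]

/-- An envelope argument, which avoids differentiating ρ where b = 0. The direction attaining the
upper envelope is chosen at the left point; for the lower envelope it is chosen at the right point.
-/
theorem gp_strictMono : StrictMono S.gp := by
  intro x y hxy
  obtain ⟨w, hw, h⟩ := exists_arg_one_add_eq (S.norm_ratio_lt x) (ε := -1) (Or.inr rfl)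
  have h1 : S.dirPhase w x = S.gp x := by rw [dirPhase, h, gp, ρ]; ring
  rw [← h1]
  exact (S.dirPhase_strictMono hw hxy).trans_le (S.dirPhase_le_gp hw y)

theorem gm_strictMono : StrictMono S.gm := by
  intro x y hxy
  obtain ⟨w, hw, h⟩ := exists_arg_one_add_eq (S.norm_ratio_lt y) (ε := 1) (Or.inl rfl)
  have h1 : S.dirPhase w y = S.gm y := by rw [dirPhase, h, gm, ρ]; ring
  rw [← h1]
  exact (S.gm_le_dirPhase hw x).trans_lt (S.dirPhase_strictMono hw hxy)

theorem ρ_tendsto : Tendsto S.ρ (cocompact ℝ) (𝓝 0) := by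
  have h1 : Tendsto (fun x => ‖S.b x / S.a x‖) (cocompact ℝ) (𝓝 0) := by
    have h2 := S.limb.norm
    rw [norm_zero] at h2
    refine squeeze_zero (fun _ => norm_nonneg _) (fun x => ?_) h2
    rw [norm_div]
    exact div_le_self (norm_nonneg _) (S.one_le_norm_a x)
  have := (Real.continuous_arcsin.tendsto 0).comp h1
  rwa [Real.arcsin_zero] at this

theorem gp_lim : Tendsto (fun x => S.gp x - x) (cocompact ℝ) (𝓝 0) := by
  have := S.lim.add S.ρ_tendsto
  rw [add_zero] at this
  exact this.congr fun x => by simp only [gp]; ring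

theorem gm_lim : Tendsto (fun x => S.gm x - x) (cocompact ℝ) (𝓝 0) := by
  have := S.lim.sub S.ρ_tendsto
  rw [sub_zero] at this
  exact this.congr fun x => by simp only [gm]; ring

theorem surjective_of_lim {g : ℝ → ℝ} (hc : Continuous g)
    (hl : Tendsto (fun x => g x - x) (cocompact ℝ) (𝓝 0)) : Function.Surjective g := by
  rw [cocompact_eq_atBot_atTop, tendsto_sup] at hl
  refine hc.surjective ?_ ?_
  · have := hl.2.add_atTop tendsto_id
    simpa using this
  · have := hl.1.add_atBot tendsto_id
    simpa using this

/-- A large value |g x| pushes x out of the compact interval on which g x and x may differ by π/4 or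
more. -/
theorem eventually_close {g : ℝ → ℝ} (hm : StrictMono g)
    (hl : Tendsto (fun x => g x - x) (cocompact ℝ) (𝓝 0)) :
    ∃ N : ℤ, ∀ n : ℤ, N < |n| → ∀ x, g x = n * Real.pi → |x - n * Real.pi| < Real.pi / 4 := by
  have h1 : ∀ᶠ x in cocompact ℝ, |g x - x| < Real.pi / 4 := by
    have := hl.eventually (Metric.ball_mem_nhds 0 (show 0 < Real.pi / 4 by positivity))
    simpa [Real.dist_eq] using this
  rw [cocompact_eq_atBot_atTop, eventually_sup] at h1
  obtain ⟨A, hA⟩ := eventually_atBot.1 h1.1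
  obtain ⟨B, hB⟩ := eventually_atTop.1 h1.2
  refine ⟨⌈(|g A| + |g B|) / Real.pi⌉, fun n hn x hx => ?_⟩
  have h2 : (|g A| + |g B|) < |(n : ℝ)| * Real.pi := by
    have h3 : ((⌈(|g A| + |g B|) / Real.pi⌉ : ℤ) : ℝ) < ((|n| : ℤ) : ℝ) := by exact_mod_cast hn
    rw [Int.cast_abs] at h3
    rw [← div_lt_iff₀ Real.pi_pos]
    exact (Int.le_ceil _).trans_lt h3
  have h4 : |g x| = |(n : ℝ)| * Real.pi := by rw [hx, abs_mul, abs_of_pos Real.pi_pos]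
  rw [← h4] at h2
  have h5 : |g x - x| < Real.pi / 4 := by
    by_contra hcon
    have hxA : A < x := by by_contra! h; exact hcon (hA x h)
    have hxB : x < B := by by_contra! h; exact hcon (hB x h)
    have h6 := hm hxA
    have h7 := hm hxB
    have : |g x| ≤ |g A| + |g B| := by
      rw [abs_le]
      constructor
      · linarith [neg_abs_le (g A), abs_nonneg (g B)]
      · linarith [le_abs_self (g B), abs_nonneg (g A)]
    linarith
  rw [← hx, abs_sub_comm]
  exact h5

/-- The lower end of the `n`-th gap. -/
def lm (n : ℤ) : ℝ := (surjective_of_lim S.gp_continuous S.gp_lim (n * Real.pi)).choose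

/-- The upper end of the `n`-th gap. -/
def lp (n : ℤ) : ℝ := (surjective_of_lim S.gm_continuous S.gm_lim (n * Real.pi)).choose

theorem gp_lm (n : ℤ) : S.gp (S.lm n) = n * Real.pi :=
  (surjective_of_lim S.gp_continuous S.gp_lim (n * Real.pi)).choose_spec

theorem gm_lp (n : ℤ) : S.gm (S.lp n) = n * Real.pi :=
  (surjective_of_lim S.gm_continuous S.gm_lim (n * Real.pi)).choose_spec

theorem lm_eq_iff (n : ℤ) (x : ℝ) : S.lm n = x ↔ n * Real.pi = S.gp x := by
  rw [← S.gp_lm n]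
  exact ⟨fun h => by rw [h], fun h => S.gp_strictMono.injective h⟩

theorem lp_eq_iff (n : ℤ) (x : ℝ) : S.lp n = x ↔ n * Real.pi = S.gm x := by
  rw [← S.gm_lp n]
  exact ⟨fun h => by rw [h], fun h => S.gm_strictMono.injective h⟩

theorem lm_le_lp (n : ℤ) : S.lm n ≤ S.lp n := by
  rw [← S.gp_strictMono.le_iff_le, S.gp_lm, ← S.gm_lp]
  have := S.ρ_nonneg (S.lp n)
  simp only [gp, gm]; linarith

/-- At λ⁺_n the upper phase is nπ + 2ρ < (n+1)π. -/
theorem lp_lt_lm (n : ℤ) : S.lp n < S.lm (n + 1) := by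
  rw [← S.gp_strictMono.lt_iff_lt, S.gp_lm]
  have h1 := S.ρ_lt (S.lp n)
  have h2 := S.gm_lp n
  simp only [gp, gm] at *
  push_cast
  linarith

theorem lm_eq_lp_iff (n : ℤ) : S.lm n = S.lp n ↔ ∃ x, S.θ x = n * Real.pi ∧ S.b x = 0 := by
  constructor
  · intro h
    have h1 := S.gp_lm n
    have h2 := S.gm_lp n
    rw [← h] at h2
    simp only [gp, gm] at h1 h2
    refine ⟨S.lm n, by linarith, ?_⟩
    have h3 : S.ρ (S.lm n) = 0 := by linarith
    rw [ρ, Real.arcsin_eq_zero_iff, norm_eq_zero, div_eq_zero_iff] at h3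
    exact h3.resolve_right (S.a_ne _)
  · rintro ⟨x, h1, h2⟩
    have h3 : S.ρ x = 0 := by rw [ρ, h2]; simp
    rw [(S.lm_eq_iff n x).2 (by simp only [gp]; linarith),
      (S.lp_eq_iff n x).2 (by simp only [gm]; linarith)]

/-- An open gap is witnessed by strict inequalities at one fixed point x. This form is stable under
perturbing the potential and gives closedness of the collapsed sets. -/
theorem lm_lt_lp_iff (n : ℤ) :
    S.lm n < S.lp n ↔ ∃ x, S.gm x < n * Real.pi ∧ n * Real.pi < S.gp x := by
  constructor
  · intro h
    obtain ⟨x, h1, h2⟩ := exists_between h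
    refine ⟨x, ?_, ?_⟩
    · rw [← S.gm_lp n]; exact S.gm_strictMono h2
    · rw [← S.gp_lm n]; exact S.gp_strictMono h1
  · rintro ⟨x, h1, h2⟩
    rw [← S.gm_lp n, S.gm_strictMono.lt_iff_lt] at h1
    rw [← S.gp_lm n, S.gp_strictMono.lt_iff_lt] at h2
    exact h2.trans h1

/-! ### Multiplicities -/

theorem im_a (x : ℝ) : (S.a x).im = -(‖S.a x‖ * Real.sin (S.θ x)) := by
  have h : S.a x = ‖S.a x‖ * Complex.exp ((-(S.θ x) : ℝ) * Complex.I) := by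
    conv_lhs => rw [S.phase x]
    congr 2; push_cast; ring
  conv_lhs => rw [h]
  rw [Complex.im_ofReal_mul, Complex.exp_ofReal_mul_I_im, Real.sin_neg]; ring

theorem norm_b_eq (x : ℝ) : ‖S.b x‖ = ‖S.a x‖ * Real.sin (S.ρ x) := by
  have h := S.norm_ratio_lt x
  rw [ρ, Real.sin_arcsin (by linarith [norm_nonneg (S.b x / S.a x)]) h.le, norm_div,
    mul_div_cancel₀ _ (S.a_pos x).ne']

theorem re_sq_sub_one (x : ℝ) : (S.a x).re ^ 2 - 1 = ‖S.b x‖ ^ 2 - (S.a x).im ^ 2 := by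
  have h := S.det x
  have h2 : ‖S.a x‖ ^ 2 = (S.a x).re ^ 2 + (S.a x).im ^ 2 := by
    rw [← Complex.normSq_eq_norm_sq, Complex.normSq_apply]; ring
  linarith

theorem re_sq_sub_one_eq_sin (x : ℝ) :
    (S.a x).re ^ 2 - 1 = -(‖S.a x‖ ^ 2 * (Real.sin (S.gp x) * Real.sin (S.gm x))) := by
  rw [S.re_sq_sub_one, S.im_a, S.norm_b_eq, gp, gm, Real.sin_add, Real.sin_sub]
  have h1 := Real.sin_sq_add_cos_sq (S.θ x)
  have h2 := Real.sin_sq_add_cos_sq (S.ρ x)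
  linear_combination (‖S.a x‖ ^ 2 * Real.sin (S.θ x) ^ 2) * h2 -
    (‖S.a x‖ ^ 2 * Real.sin (S.ρ x) ^ 2) * h1

theorem encard_eq (y : ℝ) :
    {n : ℤ | n * Real.pi = y}.encard = if Real.sin y = 0 then 1 else 0 := by
  split_ifs with h
  · obtain ⟨n, hn⟩ := Real.sin_eq_zero_iff.1 h
    rw [encard_eq_one]
    refine ⟨n, ?_⟩
    ext m
    simp only [mem_ofPred_eq, mem_singleton_iff]
    rw [← hn]
    constructor
    · intro hm
      exact_mod_cast mul_right_cancel₀ Real.pi_ne_zero hm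
    · rintro rfl; rfl
  · rw [encard_eq_zero, eq_empty_iff_forall_notMem]
    exact fun n hn => h (Real.sin_eq_zero_iff.2 ⟨n, hn⟩)

end SpectralCurve

/-- The order of a complex zero can be read off along the real axis, which is where the phase
description is available. -/
theorem analyticOrderAt_of_real_limit {f : ℂ → ℂ} {x₀ : ℝ} (hf : AnalyticAt ℂ f x₀) {k : ℕ} {L : ℂ}
    (hL : L ≠ 0) (h : Tendsto (fun x : ℝ => f x / ((x : ℂ) - x₀) ^ k) (𝓝[≠] x₀) (𝓝 L)) :
    analyticOrderAt f x₀ = k := by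
  have hofReal : Tendsto (fun x : ℝ => (x : ℂ)) (𝓝[≠] x₀) (𝓝 (x₀ : ℂ)) :=
    (Complex.continuous_ofReal.tendsto x₀).mono_left nhdsWithin_le_nhds
  have hsub : ∀ j : ℕ, j ≠ 0 →
      Tendsto (fun x : ℝ => ((x : ℂ) - x₀) ^ j) (𝓝[≠] x₀) (𝓝 0) := fun j hj => by
    have := (hofReal.sub_const (x₀ : ℂ)).pow j
    simpa [hj] using this
  have hne : ∀ᶠ x : ℝ in 𝓝[≠] x₀, (x : ℂ) - x₀ ≠ 0 := by
    filter_upwards [self_mem_nhdsWithin] with x hx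
    rw [sub_ne_zero]; exact_mod_cast hx
  by_cases htop : analyticOrderAt f x₀ = ⊤
  · rw [analyticOrderAt_eq_top] at htop
    exfalso
    have h0 : Tendsto (fun x : ℝ => f x / ((x : ℂ) - x₀) ^ k) (𝓝[≠] x₀) (𝓝 0) := by
      refine tendsto_const_nhds.congr' ?_
      filter_upwards [hofReal.eventually htop] with x hx
      rw [hx, zero_div]
    exact hL (tendsto_nhds_unique h h0)
  · obtain ⟨m, hm⟩ := ENat.ne_top_iff_exists.1 htop
    obtain ⟨g, hg, hg0, hfg⟩ := (hf.analyticOrderAt_eq_natCast (n := m)).1 hm.symm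
    rw [← hm]
    have hgt : Tendsto (fun x : ℝ => g x) (𝓝[≠] x₀) (𝓝 (g x₀)) :=
      hg.continuousAt.tendsto.comp hofReal
    have hfg' := hofReal.eventually hfg
    rcases lt_trichotomy m k with hlt | heq | hgt'
    · exfalso
      have h1 := (hsub (k - m) (by omega)).mul h
      rw [zero_mul] at h1
      refine hg0 (tendsto_nhds_unique hgt (h1.congr' ?_))
      filter_upwards [hfg', hne] with x hx hx0
      rw [hx, smul_eq_mul]
      have : ((x : ℂ) - x₀) ^ k = ((x : ℂ) - x₀) ^ (k - m) * ((x : ℂ) - x₀) ^ m := by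
        rw [← pow_add]; congr 1; omega
      rw [this]
      field_simp
    · rw [heq]
    · exfalso
      have h1 := (hsub (m - k) (by omega)).mul hgt
      rw [zero_mul] at h1
      refine hL (tendsto_nhds_unique h (h1.congr' ?_))
      filter_upwards [hfg', hne] with x hx hx0
      rw [hx, smul_eq_mul]
      have : ((x : ℂ) - x₀) ^ m = ((x : ℂ) - x₀) ^ (m - k) * ((x : ℂ) - x₀) ^ k := by
        rw [← pow_add]; congr 1; omega
      rw [this]
      field_simp

namespace SpectralCurve

variable (S : SpectralCurve) {χ : ℂ → ℂ}

/-- Both sines vanishing forces sin 2ρ = 0, hence ρ = 0, b = 0 and a = ±1. Then (Re a)² - 1 = |b|² -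
(Im a)² has leading coefficient |b'|² - (Im a')² = |q|² - p² < 0. -/
theorem order_of_both (hχ : ∀ x : ℝ, χ x = ((4 * ((S.a x).re ^ 2 - 1) : ℝ) : ℂ)) {x₀ : ℝ}
    (han : AnalyticAt ℂ χ x₀) (h1 : Real.sin (S.gp x₀) = 0) (h2 : Real.sin (S.gm x₀) = 0) :
    analyticOrderAt χ x₀ = (2 : ℕ) := by
  have hρ : Real.sin (2 * S.ρ x₀) = 0 := by
    rw [show 2 * S.ρ x₀ = S.gp x₀ - S.gm x₀ by simp only [gp, gm]; ring, Real.sin_sub, h1, h2]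
    ring
  have hρ0 : S.ρ x₀ = 0 := by
    by_contra hne
    have hpos := lt_of_le_of_ne (S.ρ_nonneg x₀) (Ne.symm hne)
    have := Real.sin_pos_of_pos_of_lt_pi (x := 2 * S.ρ x₀) (by linarith) (by linarith [S.ρ_lt x₀])
    linarith
  have hb0 : S.b x₀ = 0 := by
    have := S.norm_b_eq x₀
    rw [hρ0, Real.sin_zero, mul_zero] at this
    exact norm_eq_zero.1 this
  have him : (S.a x₀).im = 0 := by
    rw [S.im_a]
    rw [gp, hρ0, add_zero] at h1
    rw [h1]; simp
  have hre : (S.a x₀).re ^ 2 = 1 := by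
    have := S.re_sq_sub_one x₀
    rw [hb0, him, norm_zero] at this
    linarith
  refine analyticOrderAt_of_real_limit han (L := ((4 * (‖S.q x₀‖ ^ 2 - S.p x₀ ^ 2) : ℝ) : ℂ)) ?_ ?_
  · have := S.hpq x₀
    have h3 : ‖S.q x₀‖ ^ 2 - S.p x₀ ^ 2 < 0 := by nlinarith [norm_nonneg (S.q x₀)]
    exact_mod_cast (by linarith : 4 * (‖S.q x₀‖ ^ 2 - S.p x₀ ^ 2) < 0).ne
  · have e1 := ((hasDerivAt_iff_tendsto_slope.1 (S.hb x₀)).norm).pow 2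
    have e2 := ((Complex.continuous_im.tendsto _).comp
      (hasDerivAt_iff_tendsto_slope.1 (S.ha x₀))).pow 2
    have e3 := (e1.sub e2).const_mul 4
    have e4 : 4 * (‖Complex.I * (-S.q x₀ * S.a x₀ + S.p x₀ * S.b x₀)‖ ^ 2 -
        (Complex.I * (-(S.p x₀) * S.a x₀ + conj (S.q x₀) * S.b x₀)).im ^ 2) =
        4 * (‖S.q x₀‖ ^ 2 - S.p x₀ ^ 2) := by
      have hn : ‖S.a x₀‖ ^ 2 = 1 := by
        have := S.det x₀; rw [hb0, norm_zero] at this; linarith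
      rw [hb0]
      simp only [mul_zero, add_zero, norm_mul, Complex.norm_I, norm_neg, one_mul, mul_pow, hn]
      simp [him, mul_pow, hre]
    rw [e4] at e3
    refine ((Complex.continuous_ofReal.tendsto _).comp e3).congr' ?_
    filter_upwards [self_mem_nhdsWithin] with x hx
    have hx' : x - x₀ ≠ 0 := sub_ne_zero.2 hx
    rw [hχ, S.re_sq_sub_one]
    simp only [Function.comp, slope, vsub_eq_sub, hb0, sub_zero, norm_smul, Complex.smul_im,
      Complex.sub_im, him, smul_eq_mul, norm_inv, mul_pow, inv_pow, Real.norm_eq_abs, sq_abs]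
    rw [← Complex.ofReal_sub, ← Complex.ofReal_pow, ← Complex.ofReal_div]
    congr 1
    field_simp

/-- Here |Im a| = |b| ≠ 0, and Re a' = p Im a - Im(conj q · b) cannot vanish because |q| < p. So the
zero is simple. -/
theorem order_of_one (hχ : ∀ x : ℝ, χ x = ((4 * ((S.a x).re ^ 2 - 1) : ℝ) : ℂ)) {x₀ : ℝ}
    (han : AnalyticAt ℂ χ x₀) (h0 : Real.sin (S.gp x₀) * Real.sin (S.gm x₀) = 0)
    (h1 : ¬(Real.sin (S.gp x₀) = 0 ∧ Real.sin (S.gm x₀) = 0)) :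
    analyticOrderAt χ x₀ = (1 : ℕ) := by
  have hb0 : S.b x₀ ≠ 0 := by
    intro hb
    have h3 : S.ρ x₀ = 0 := by rw [ρ, hb]; simp
    have h4 : S.gp x₀ = S.gm x₀ := by simp only [gp, gm, h3]; ring
    rw [h4] at h0 h1
    have := mul_self_eq_zero.1 h0
    exact h1 ⟨this, this⟩
  have hsq : (S.a x₀).re ^ 2 - 1 = 0 := by rw [S.re_sq_sub_one_eq_sin, h0]; ring
  have hre : (S.a x₀).re ≠ 0 := by
    intro h; rw [h] at hsq; norm_num at hsq
  have hbim : |(S.a x₀).im| = ‖S.b x₀‖ := by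
    rw [← abs_norm (S.b x₀), ← sq_eq_sq_iff_abs_eq_abs]
    linarith [S.re_sq_sub_one x₀]
  set D := (Complex.I * (-(S.p x₀) * S.a x₀ + conj (S.q x₀) * S.b x₀)).re with hD
  have hD0 : D ≠ 0 := by
    have e : D = S.p x₀ * (S.a x₀).im - (conj (S.q x₀) * S.b x₀).im := by
      simp only [hD, Complex.I_mul_re, Complex.add_im, Complex.mul_im, Complex.neg_re,
        Complex.neg_im, Complex.ofReal_re, Complex.ofReal_im]
      ring
    intro h
    rw [e, sub_eq_zero] at h
    have h5 : |S.p x₀ * (S.a x₀).im| ≤ ‖S.q x₀‖ * ‖S.b x₀‖ := by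
      rw [h]
      refine (Complex.abs_im_le_norm _).trans_eq ?_
      rw [norm_mul, RCLike.norm_conj]
    rw [abs_mul, hbim] at h5
    have h6 := le_of_mul_le_mul_right h5 (norm_pos_iff.2 hb0)
    linarith [le_abs_self (S.p x₀), S.hpq x₀]
  have hder : HasDerivAt (fun x => 4 * ((S.a x).re ^ 2 - 1)) (4 * (2 * (S.a x₀).re * D)) x₀ := by
    have hr : HasDerivAt (fun x => (S.a x).re) D x₀ :=
      Complex.reCLM.hasFDerivAt.comp_hasDerivAt x₀ (S.ha x₀)
    have := ((hr.pow 2).sub_const 1).const_mul 4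
    simpa using this
  refine analyticOrderAt_of_real_limit han (L := ((4 * (2 * (S.a x₀).re * D) : ℝ) : ℂ)) ?_ ?_
  · exact_mod_cast mul_ne_zero four_ne_zero (mul_ne_zero (mul_ne_zero two_ne_zero hre) hD0)
  · refine ((Complex.continuous_ofReal.tendsto _).comp
      (hasDerivAt_iff_tendsto_slope.1 hder)).congr' ?_
    filter_upwards [self_mem_nhdsWithin] with x hx
    rw [hχ]
    simp only [Function.comp, slope, vsub_eq_sub, smul_eq_mul, hsq, mul_zero, sub_zero]
    push_cast
    rw [pow_one, div_eq_inv_mul]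

theorem order_eq (hχ : ∀ x : ℝ, χ x = ((4 * ((S.a x).re ^ 2 - 1) : ℝ) : ℂ)) {x₀ : ℝ}
    (han : AnalyticAt ℂ χ x₀) :
    (if Real.sin (S.gp x₀) = 0 then (1 : ℕ∞) else 0) +
      (if Real.sin (S.gm x₀) = 0 then 1 else 0) = analyticOrderAt χ x₀ := by
  split_ifs with h1 h2 h2
  · rw [S.order_of_both hχ han h1 h2]; rfl
  · rw [S.order_of_one hχ han (by rw [h1, zero_mul]) (fun h => h2 h.2)]; rfl
  · rw [S.order_of_one hχ han (by rw [h2, mul_zero]) (fun h => h1 h.1)]; rfl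
  · rw [add_zero, eq_comm, han.analyticOrderAt_eq_zero, hχ, S.re_sq_sub_one_eq_sin]
    have h3 : 4 * -(‖S.a x₀‖ ^ 2 * (Real.sin (S.gp x₀) * Real.sin (S.gm x₀))) ≠ 0 := by
      simp [S.a_ne x₀, h1, h2]
    exact_mod_cast h3

end SpectralCurve

/-! ### Existence and uniqueness of the enumeration of the periodic spectrum -/

/-- The curve `(m₁₁(1), m₁₂(1))` of a potential of real type. -/
def curve (φ : L2r) : SpectralCurve where
  a x := m11 (x, φ) 1
  b x := m12 (x, φ) 1
  q := qInt φ
  p := pInt φ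
  θ x := phase x φ
  ha := m11_hasDerivAt φ.2
  hb := m12_hasDerivAt φ.2
  hpq := norm_qInt_lt φ
  det x := normSq_sub_normSq φ.2 x one_mem_unit
  phase := m11_eq_phase φ.2
  cont := phase_continuous.comp (continuous_id.prodMk continuous_const)
  lim := phase_sub_tendsto φ.2
  limb := m12_tendsto φ.2

theorem charFun_real (φ : L2r) (x : ℝ) :
    charFun φ x = ((4 * (((curve φ).a x).re ^ 2 - 1) : ℝ) : ℂ) := by
  have e : discriminant φ x = ((2 * ((curve φ).a x).re : ℝ) : ℂ) := by
    rw [discriminant_eq, (conj_symmetry φ.2 x one_mem_unit).2, Complex.add_conj]; rfl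
  rw [charFun, e]; push_cast; ring

theorem curve_order (φ : L2r) (x : ℝ) :
    (if Real.sin ((curve φ).gp x) = 0 then (1 : ℕ∞) else 0) +
      (if Real.sin ((curve φ).gm x) = 0 then 1 else 0) = analyticOrderAt (charFun φ) x :=
  (curve φ).order_eq (charFun_real φ) (charFun_analyticAt φ x)

theorem charFun_ne_zero_of_im {φ : L2c} (hφ : φ ∈ L2r) {lam : ℂ} (h : lam.im ≠ 0) :
    charFun φ lam ≠ 0 := fun h0 =>
  h (im_eq_zero_of_eigenvalue hφ ((isPeriodicEigenvalue_iff φ lam).2 h0))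

theorem charFun_order_ne_top (φ : L2r) (lam : ℂ) : analyticOrderAt (charFun φ) lam ≠ ⊤ := by
  by_cases h : lam.im = 0
  · have e : lam = (lam.re : ℂ) := Complex.ext rfl (by simpa using h)
    rw [e, ← curve_order]
    split_ifs <;> decide
  · rw [(charFun_analyticAt φ lam).analyticOrderAt_eq_zero.2 (charFun_ne_zero_of_im φ.2 h)]
    exact ENat.zero_ne_top

theorem curve_mult (φ : L2r) (lam : ℂ) :
    {n | ((curve φ).lm n : ℂ) = lam}.encard + {n | ((curve φ).lp n : ℂ) = lam}.encard =
      analyticOrderAt (charFun φ) lam := by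
  by_cases h : lam.im = 0
  · have e : lam = (lam.re : ℂ) := Complex.ext rfl (by simpa using h)
    rw [e, ← curve_order, ← SpectralCurve.encard_eq, ← SpectralCurve.encard_eq]
    simp only [Complex.ofReal_inj, SpectralCurve.lm_eq_iff, SpectralCurve.lp_eq_iff]
  · rw [(charFun_analyticAt φ lam).analyticOrderAt_eq_zero.2 (charFun_ne_zero_of_im φ.2 h)]
    have e : ∀ f : ℤ → ℝ, {n | (f n : ℂ) = lam} = ∅ := fun f => by
      rw [eq_empty_iff_forall_notMem]
      rintro n rfl
      exact h (Complex.ofReal_im _)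
    rw [e, e, encard_empty, add_zero]

theorem curve_isPeriodicSpectrum (φ : L2r) : IsPeriodicSpectrum φ
    (fun n => ((curve φ).lm n : ℂ)) (fun n => ((curve φ).lp n : ℂ)) where
  mem_iff lam := by
    rw [isPeriodicEigenvalue_iff, ← (charFun_analyticAt φ lam).analyticOrderAt_ne_zero,
      ← curve_mult, Ne, add_eq_zero, encard_eq_zero, encard_eq_zero, not_and_or, ← Ne, ← Ne,
      ← nonempty_iff_ne_empty, ← nonempty_iff_ne_empty]
    rfl
  mult := curve_mult φ
  lm_le_lp n := by
    rcases ((curve φ).lm_le_lp n).lt_or_eq with h | h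
    · left; simpa using h
    · right; simp [h]
  lp_le_lm n := by
    left; simpa using (curve φ).lp_lt_lm n
  mem_disc := by
    obtain ⟨N₁, h₁⟩ := SpectralCurve.eventually_close (curve φ).gp_strictMono (curve φ).gp_lim
    obtain ⟨N₂, h₂⟩ := SpectralCurve.eventually_close (curve φ).gm_strictMono (curve φ).gm_lim
    have e : ∀ (n : ℤ) (x : ℝ), |x - n * Real.pi| < Real.pi / 4 →
        (x : ℂ) ∈ Metric.ball ((n : ℂ) * Real.pi) (Real.pi / 4) := fun n x h => by
      rw [Metric.mem_ball, Complex.dist_eq]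
      rw [show (x : ℂ) - n * Real.pi = ((x - n * Real.pi : ℝ) : ℂ) by push_cast; ring,
        Complex.norm_real]
      exact h
    exact ⟨max N₁ N₂, fun n hn =>
      ⟨e _ _ (h₁ n ((le_max_left _ _).trans_lt hn) _ ((curve φ).gp_lm n)),
        e _ _ (h₂ n ((le_max_right _ _).trans_lt hn) _ ((curve φ).gm_lp n))⟩⟩

/-- Position of an eigenvalue in the merged sequence. -/
def position : ℤ ⊕ ℤ → ℤ := Sum.elim (fun n => 2 * n) (fun n => 2 * n + 1)

theorem position_injective : Function.Injective position := by
  rintro (m | m) (n | n) h <;> simp only [position, Sum.elim_inl, Sum.elim_inr] at h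
  · congr 1; omega
  · omega
  · omega
  · congr 1; omega

theorem monotone_of_interlacing {l r : ℤ → ℝ} (h1 : ∀ n, l n ≤ r n) (h2 : ∀ n, r n ≤ l (n + 1))
    {i j : ℤ ⊕ ℤ} (h : position i ≤ position j) : Sum.elim l r i ≤ Sum.elim l r j := by
  let c : ℤ → ℝ := fun k => if k % 2 = 0 then l (k / 2) else r (k / 2)
  have hc : Monotone c := monotone_int_of_le_succ fun k => by
    rcases Int.emod_two_eq_zero_or_one k with hk | hk
    · have e1 : (k + 1) % 2 ≠ 0 := by omega
      have e2 : (k + 1) / 2 = k / 2 := by omega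
      simp only [c, if_pos hk, if_neg e1, e2]
      exact h1 _
    · have e0 : k % 2 ≠ 0 := by omega
      have e1 : (k + 1) % 2 = 0 := by omega
      have e2 : (k + 1) / 2 = k / 2 + 1 := by omega
      simp only [c, if_neg e0, if_pos e1, e2]
      exact h2 _
  have e : ∀ i, Sum.elim l r i = c (position i) := by
    rintro (n | n)
    · have e1 : (2 * n) % 2 = 0 := by omega
      have e2 : (2 * n) / 2 = n := by omega
      simp only [c, position, Sum.elim_inl, if_pos e1, e2]
    · have e1 : (2 * n + 1) % 2 ≠ 0 := by omega
      have e2 : (2 * n + 1) / 2 = n := by omega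
      simp only [c, position, Sum.elim_inr, if_neg e1, e2]
  rw [e, e]
  exact hc h

/-- Both sequences list the same values with the same multiplicities. If the second were larger at
`i₀`, a value-preserving bijection would map a finite window of n + 1 positions ending at `i₀` into
the n positions before `i₀`, contradicting injectivity. -/
theorem le_of_equiv {l r l' r' : ℤ → ℝ}
    (h1 : ∀ n, l n ≤ r n) (h2 : ∀ n, r n ≤ l (n + 1))
    (h1' : ∀ n, l' n ≤ r' n) (h2' : ∀ n, r' n ≤ l' (n + 1))
    (e : ℤ ⊕ ℤ ≃ ℤ ⊕ ℤ) (he : ∀ i, Sum.elim l' r' (e i) = Sum.elim l r i) {N : ℤ}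
    (hN : ∀ n : ℤ, N < |n| → |l n - n * Real.pi| < Real.pi / 4)
    (hN' : ∀ n : ℤ, N < |n| → |r' n - n * Real.pi| < Real.pi / 4) (i₀ : ℤ ⊕ ℤ) :
    Sum.elim l' r' i₀ ≤ Sum.elim l r i₀ := by
  by_contra! hlt
  obtain ⟨M, hM0, hMN, hMi⟩ : ∃ M : ℤ, 0 ≤ M ∧ N < M ∧ -2 * M ≤ position i₀ :=
    ⟨max 0 (max (N + 1) (-position i₀)), by omega, by omega, by omega⟩
  let P : Set (ℤ ⊕ ℤ) := {i | -2 * M ≤ position i ∧ position i < position i₀}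
  have hPfin : P.Finite :=
    (Set.finite_Ico (-2 * M) (position i₀)).preimage position_injective.injOn
  -- The window starts at λ⁻_{-M}. Values from there on exceed -Mπ - π/4, while earlier terms of the
  -- other sequence stay below -(M+1)π + π/4, so nothing escapes to the left; the assumed strict
  -- inequality prevents escape to the right.
  have hmap : ∀ i ∈ insert i₀ P, e i ∈ P := by
    intro i hi
    have hi1 : -2 * M ≤ position i ∧ position i ≤ position i₀ := by
      rcases hi with rfl | hi
      · exact ⟨hMi, le_rfl⟩
      · exact ⟨hi.1, hi.2.le⟩
    have hlow : -(M : ℝ) * Real.pi - Real.pi / 4 < Sum.elim l r i := by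
      have g1 := monotone_of_interlacing h1 h2 (i := Sum.inl (-M)) (j := i)
        (by simp only [position, Sum.elim_inl] at hi1 ⊢; omega)
      have g2 := (abs_lt.1 (hN (-M) (by rw [abs_neg, abs_of_nonneg hM0]; exact hMN))).1
      simp only [Sum.elim_inl] at g1
      push_cast at g2
      linarith
    have hup := monotone_of_interlacing h1 h2 hi1.2
    rw [← he i] at hlow hup
    constructor
    · by_contra! hcon
      have g1 := monotone_of_interlacing h1' h2' (i := e i) (j := Sum.inr (-M - 1))
        (by simp only [position, Sum.elim_inr] at hcon ⊢; omega)
      have g2 := (abs_lt.1 (hN' (-M - 1)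
        (by rw [abs_of_nonpos (by omega)]; omega))).2
      simp only [Sum.elim_inr] at g1
      push_cast at g2
      have := Real.pi_pos
      linarith
    · by_contra! hcon
      have := monotone_of_interlacing h1' h2' hcon
      linarith
  have hsub : e '' (insert i₀ P) ⊆ P := by rintro _ ⟨i, hi, rfl⟩; exact hmap i hi
  have hcard := Set.ncard_le_ncard hsub hPfin
  rw [Set.ncard_image_of_injective _ e.injective,
    Set.ncard_insert_of_notMem (fun h => lt_irrefl _ h.2) hPfin] at hcard
  omega

theorem encard_elim (l r : ℤ → ℂ) (v : ℂ) : {i | Sum.elim l r i = v}.encard =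
    {n | l n = v}.encard + {n | r n = v}.encard := by
  have e : {i | Sum.elim l r i = v} = Sum.inl '' {n | l n = v} ∪ Sum.inr '' {n | r n = v} := by
    ext (n | n) <;> simp
  rw [e, encard_union_eq (by
    rw [Set.disjoint_left]; rintro _ ⟨m, _, rfl⟩ ⟨n, _, h⟩; simp at h),
    Sum.inl_injective.encard_image, Sum.inr_injective.encard_image]

theorem exists_equiv_of_mult {F F' : ℤ ⊕ ℤ → ℂ}
    (h : ∀ v, {i | F i = v}.encard = {i | F' i = v}.encard)
    (hfin : ∀ v, {i | F i = v}.encard ≠ ⊤) :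
    ∃ e : ℤ ⊕ ℤ ≃ ℤ ⊕ ℤ, ∀ i, F' (e i) = F i := by
  have h1 : ∀ v, Nonempty ({i // F i = v} ≃ {i // F' i = v}) := fun v => by
    have f1 : {i | F i = v}.Finite := encard_ne_top_iff.1 (hfin v)
    have f2 : {i | F' i = v}.Finite := encard_ne_top_iff.1 (h v ▸ hfin v)
    have : Finite {i // F i = v} := f1
    have : Finite {i // F' i = v} := f2
    refine Finite.card_eq.1 ?_
    have := congrArg ENat.toNat (h v)
    exact this
  exact ⟨Equiv.ofFiberEquiv fun v => (h1 v).some, fun i => Equiv.ofFiberEquiv_map _ i⟩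

theorem LexLE.re_le {a b : ℂ} (h : LexLE a b) : a.re ≤ b.re :=
  h.elim le_of_lt fun h => h.1.le

theorem abs_re_sub_of_mem_ball {z : ℂ} {n : ℤ}
    (h : z ∈ Metric.ball ((n : ℂ) * Real.pi) (Real.pi / 4)) :
    |z.re - n * Real.pi| < Real.pi / 4 := by
  rw [Metric.mem_ball, Complex.dist_eq] at h
  refine lt_of_le_of_lt ?_ h
  have := Complex.abs_re_le_norm (z - n * Real.pi)
  simpa using this

theorem IsPeriodicSpectrum.re_le {φ : L2r} {lm lp lm' lp' : ℤ → ℂ}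
    (h : IsPeriodicSpectrum φ lm lp) (h' : IsPeriodicSpectrum φ lm' lp') (i : ℤ ⊕ ℤ) :
    (Sum.elim lm' lp' i).re ≤ (Sum.elim lm lp i).re := by
  obtain ⟨N, hN⟩ := h.mem_disc
  obtain ⟨N', hN'⟩ := h'.mem_disc
  obtain ⟨e, he⟩ := exists_equiv_of_mult (F := Sum.elim lm lp) (F' := Sum.elim lm' lp')
    (fun v => by rw [encard_elim, encard_elim, h.mult, h'.mult])
    (fun v => by rw [encard_elim, h.mult]; exact charFun_order_ne_top φ v)
  have hre : ∀ (l r : ℤ → ℂ) (i : ℤ ⊕ ℤ),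
      (Sum.elim l r i).re = Sum.elim (fun n => (l n).re) (fun n => (r n).re) i := by
    rintro l r (n | n) <;> rfl
  rw [hre, hre]
  exact le_of_equiv (N := max N N') (fun n => (h.lm_le_lp n).re_le) (fun n => (h.lp_le_lm n).re_le)
    (fun n => (h'.lm_le_lp n).re_le) (fun n => (h'.lp_le_lm n).re_le) e
    (fun i => by rw [← hre, ← hre, he])
    (fun n hn => abs_re_sub_of_mem_ball (hN n (by omega)).1)
    (fun n hn => abs_re_sub_of_mem_ball (hN' n (by omega)).2) i

theorem IsPeriodicSpectrum.unique {φ : L2r} {lm lp lm' lp' : ℤ → ℂ}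
    (h : IsPeriodicSpectrum φ lm lp) (h' : IsPeriodicSpectrum φ lm' lp') :
    lm' = lm ∧ lp' = lp := by
  have hre : ∀ i, (Sum.elim lm' lp' i).re = (Sum.elim lm lp i).re := fun i =>
    le_antisymm (h.re_le h' i) (h'.re_le h i)
  constructor
  · funext n
    refine Complex.ext (hre (Sum.inl n)) ?_
    rw [im_eq_zero_of_eigenvalue φ.2 ((h.mem_iff _).1 (Or.inl ⟨n, rfl⟩)),
      im_eq_zero_of_eigenvalue φ.2 ((h'.mem_iff _).1 (Or.inl ⟨n, rfl⟩))]
  · funext n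
    refine Complex.ext (hre (Sum.inr n)) ?_
    rw [im_eq_zero_of_eigenvalue φ.2 ((h.mem_iff _).1 (Or.inr ⟨n, rfl⟩)),
      im_eq_zero_of_eigenvalue φ.2 ((h'.mem_iff _).1 (Or.inr ⟨n, rfl⟩))]

theorem existsUnique_isPeriodicSpectrum (φ : L2r) :
    ∃! p : (ℤ → ℂ) × (ℤ → ℂ), IsPeriodicSpectrum (φ : L2c) p.1 p.2 :=
  ⟨(fun n => ((curve φ).lm n : ℂ), fun n => ((curve φ).lp n : ℂ)), curve_isPeriodicSpectrum φ,
    fun _ hp => Prod.ext ((curve_isPeriodicSpectrum φ).unique hp).1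
      ((curve_isPeriodicSpectrum φ).unique hp).2⟩

/-- Uniqueness makes the arbitrary choice in `periodicSpectrum` agree with the enumeration built
from the phases. -/
theorem periodicSpectrum_eq (φ : L2r) : lamMinus φ = (fun n => ((curve φ).lm n : ℂ)) ∧
    lamPlus φ = (fun n => ((curve φ).lp n : ℂ)) := by
  have h : IsPeriodicSpectrum φ (periodicSpectrum φ).1 (periodicSpectrum φ).2 :=
    Classical.epsilon_spec (p := fun p : (ℤ → ℂ) × (ℤ → ℂ) => IsPeriodicSpectrum φ p.1 p.2)
      ⟨(fun n => ((curve φ).lm n : ℂ), fun n => ((curve φ).lp n : ℂ)),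
        curve_isPeriodicSpectrum φ⟩
  exact (curve_isPeriodicSpectrum φ).unique h

/-! ### Collapsed gaps through the phase; closedness -/

theorem lam_eq_iff (φ : L2r) (n : ℤ) :
    lamMinus φ n = lamPlus φ n ↔ (curve φ).lm n = (curve φ).lp n := by
  rw [(periodicSpectrum_eq φ).1, (periodicSpectrum_eq φ).2, Complex.ofReal_inj]

theorem mem_collapsed_iff (φ : L2r) (n : ℤ) :
    φ ∈ collapsed n ↔ ∃ x : ℝ, phase x φ = n * Real.pi ∧ m12 ((x : ℂ), (φ : L2c)) 1 = 0 :=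
  (lam_eq_iff φ n).trans ((curve φ).lm_eq_lp_iff n)

theorem m11_real_continuous : Continuous fun z : ℝ × L2r => m11 ((z.1 : ℂ), (z.2 : L2c)) 1 :=
  (continuous_iff_continuousAt.2 fun _ => (m11_analyticAt _).continuousAt).comp param_continuous

theorem m12_real_continuous : Continuous fun z : ℝ × L2r => m12 ((z.1 : ℂ), (z.2 : L2c)) 1 :=
  (continuous_iff_continuousAt.2 fun _ => (m12_analyticAt _).continuousAt).comp param_continuous

theorem continuous_slice {A B C : Type*} [TopologicalSpace A] [TopologicalSpace B]
    [TopologicalSpace C] {f : A → B → C} (hf : Continuous fun z : A × B => f z.1 z.2) (x : A) :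
    Continuous (f x) := hf.comp (Continuous.prodMk_right x)

theorem gp_gm_continuous (x : ℝ) : Continuous (fun φ : L2r => (curve φ).gp x) ∧
    Continuous (fun φ : L2r => (curve φ).gm x) := by
  have hθ := continuous_slice (f := fun (x : ℝ) (φ : L2r) => phase x φ) phase_continuous x
  have h1 := continuous_slice (f := fun (x : ℝ) (φ : L2r) => m11 ((x : ℂ), (φ : L2c)) 1)
    m11_real_continuous x
  have h2 := continuous_slice (f := fun (x : ℝ) (φ : L2r) => m12 ((x : ℂ), (φ : L2c)) 1)
    m12_real_continuous x
  have hρ := Real.continuous_arcsin.comp (h2.div h1 fun φ => (curve φ).a_ne x).norm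
  exact ⟨hθ.add hρ, hθ.sub hρ⟩

theorem isClosed_collapsed (n : ℤ) : IsClosed (collapsed n) := by
  rw [← isOpen_compl_iff, isOpen_iff_mem_nhds]
  intro φ hφ
  have h1 : (curve φ).lm n < (curve φ).lp n :=
    lt_of_le_of_ne ((curve φ).lm_le_lp n) fun h => hφ ((lam_eq_iff φ n).2 h)
  obtain ⟨x, h2, h3⟩ := ((curve φ).lm_lt_lp_iff n).1 h1
  have e2 := ((gp_gm_continuous x).2.tendsto φ).eventually_lt_const h2
  have e3 := ((gp_gm_continuous x).1.tendsto φ).eventually_const_lt h3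
  filter_upwards [e2, e3] with ψ g2 g3 hψ
  exact (((curve ψ).lm_lt_lp_iff n).2 ⟨x, g2, g3⟩).ne ((lam_eq_iff ψ n).1 hψ)

/-! ### Analytic inverse and implicit functions, level sets of analytic submersions -/

section Geometry

variable {E : Type*} [NormedAddCommGroup E] [NormedSpace ℝ E] [CompleteSpace E]

theorem exists_analytic_chart {f : E → E} {x : E} {i : E ≃L[ℝ] E} (hf : AnalyticAt ℝ f x)
    (hi : HasFDerivAt f (i : E →L[ℝ] E) x) {U : Set E} (hU : U ∈ 𝓝 x) :
    ∃ e : OpenPartialHomeomorph E E, (∀ y, e y = f y) ∧ x ∈ e.source ∧ e.source ⊆ U ∧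
      AnalyticOnNhd ℝ e e.source ∧ AnalyticOnNhd ℝ e.symm e.target := by
  have hs : HasStrictFDerivAt f (i : E →L[ℝ] E) x := by
    rw [← hi.fderiv]; exact hf.hasStrictFDerivAt
  -- Invertibility is an open condition. Shrinking the source to where the derivative stays
  -- invertible makes the inverse analytic on the whole target, not only at the image of the base
  -- point.
  have h1 : ∀ᶠ y in 𝓝 x, fderiv ℝ f y ∈ range ((↑) : (E ≃L[ℝ] E) → E →L[ℝ] E) := by
    refine hf.fderiv.continuousAt.eventually_mem ?_
    rw [hi.fderiv]
    exact ContinuousLinearEquiv.nhds i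
  obtain ⟨O, hO, hOo, hxO⟩ :=
    eventually_nhds_iff.1 ((hf.eventually_analyticAt.and h1).and hU)
  have hsrc : ((hs.toOpenPartialHomeomorph f).restrOpen O hOo).source =
      (hs.toOpenPartialHomeomorph f).source ∩ O := OpenPartialHomeomorph.restrOpen_source _ _ _
  set e := (hs.toOpenPartialHomeomorph f).restrOpen O hOo with he
  have hef : (e : E → E) = f := rfl
  refine ⟨e, fun y => rfl, ?_, fun y hy => ?_, fun y hy => ?_, fun y hy => ?_⟩
  · rw [hsrc]
    exact ⟨hs.mem_toOpenPartialHomeomorph_source, hxO⟩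
  · rw [hsrc] at hy
    exact (hO y hy.2).2
  · rw [hsrc] at hy
    rw [hef]
    exact (hO y hy.2).1.1
  · have hy' := e.map_target hy
    rw [hsrc] at hy'
    obtain ⟨⟨ha, j, hj⟩, -⟩ := hO _ hy'.2
    exact e.analyticAt_symm hy (by rw [hef]; exact ha) (by rw [hef]; exact hj.symm)

/-- The inverse function theorem is applied to (x, φ) ↦ (g(x, φ), φ), whose derivative is triangular
and hence invertible. -/
theorem exists_implicit {g : ℝ × E → ℝ} {z₀ : ℝ × E} {D : ℝ × E →L[ℝ] ℝ}
    (hg : AnalyticAt ℝ g z₀) (hD : HasFDerivAt g D z₀) (h0 : g z₀ = 0) (hc : D (1, 0) ≠ 0) :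
    ∃ Λ : E → ℝ, AnalyticAt ℝ Λ z₀.2 ∧ Λ z₀.2 = z₀.1 ∧ (∀ᶠ φ in 𝓝 z₀.2, g (Λ φ, φ) = 0) ∧
      ∀ᶠ z in 𝓝 z₀, g z = 0 → z.1 = Λ z.2 := by
  have hdec : ∀ (r : ℝ) (ψ : E), D (r, ψ) = r * D (1, 0) + D (0, ψ) := fun r ψ => by
    rw [show ((r, ψ) : ℝ × E) = r • (1, 0) + (0, ψ) by simp, map_add, map_smul, smul_eq_mul]
  let i : (ℝ × E) ≃L[ℝ] (ℝ × E) := ContinuousLinearEquiv.equivOfInverse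
    (D.prod (ContinuousLinearMap.snd ℝ ℝ E))
    (((D (1, 0))⁻¹ • (ContinuousLinearMap.fst ℝ ℝ E -
      D.comp ((ContinuousLinearMap.inr ℝ ℝ E).comp (ContinuousLinearMap.snd ℝ ℝ E)))).prod
      (ContinuousLinearMap.snd ℝ ℝ E))
    (fun z => by
      refine Prod.ext ?_ rfl
      change (D (1, 0))⁻¹ * (D z - D (0, z.2)) = z.1
      have h := hdec z.1 z.2
      rw [Prod.mk.eta] at h
      rw [h, add_sub_cancel_right, mul_comm, mul_assoc, mul_inv_cancel₀ hc, mul_one])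
    (fun z => by
      refine Prod.ext ?_ rfl
      change D ((D (1, 0))⁻¹ * (z.1 - D (0, z.2)), z.2) = z.1
      rw [hdec]
      field_simp
      ring)
  obtain ⟨e, hef, hz, -, -, hsymm⟩ := exists_analytic_chart (f := fun z : ℝ × E => (g z, z.2))
    (i := i) (hg.prod analyticAt_snd) (hD.prodMk hasFDerivAt_snd) univ_mem
  have hez : e z₀ = (0, z₀.2) := by rw [hef, h0]
  have htgt : ((0 : ℝ), z₀.2) ∈ e.target := by rw [← hez]; exact e.map_source hz
  have hleft : e.symm (0, z₀.2) = z₀ := by rw [← hez]; exact e.left_inv hz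
  refine ⟨fun φ => (e.symm (0, φ)).1, ?_, congrArg Prod.fst hleft, ?_, ?_⟩
  · have h1 : AnalyticAt ℝ (fun φ : E => ((0 : ℝ), φ)) z₀.2 := analyticAt_const.prod analyticAt_id
    exact analyticAt_fst.comp ((hsymm _ htgt).comp (f := fun φ : E => ((0 : ℝ), φ)) h1)
  · have h1 : Continuous fun φ : E => ((0 : ℝ), φ) := by fun_prop
    filter_upwards [h1.continuousAt.eventually_mem (e.open_target.mem_nhds htgt)] with φ hφ
    have h2 := e.right_inv hφ
    rw [hef] at h2
    have h3 : (e.symm (0, φ)).2 = φ := congrArg Prod.snd h2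
    have h4 : g (e.symm (0, φ)) = 0 := congrArg Prod.fst h2
    rwa [show e.symm (0, φ) = ((e.symm (0, φ)).1, φ) from Prod.ext rfl h3] at h4
  · filter_upwards [e.open_source.mem_nhds hz] with z hzs hgz
    have h2 := e.left_inv hzs
    rw [hef, hgz] at h2
    rw [h2]

/-- With s a right inverse of D, continuous because ℂ is finite-dimensional, the map x ↦ x - p + s(F
x - D(x - p)) has derivative the identity at p, and D of it equals F x. It therefore straightens the
zero set to ker D, whose quotient is ℂ. -/
theorem exists_submersion_chart {F : E → ℂ} {p : E} {D : E →L[ℝ] ℂ} {S : Set E}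
    (hF : AnalyticAt ℝ F p) (hD : HasFDerivAt F D p) (hsurj : Function.Surjective D)
    (hS : ∀ᶠ x in 𝓝 p, x ∈ S ↔ F x = 0) :
    ∃ (G : Submodule ℝ E) (e : OpenPartialHomeomorph E E),
      IsClosed (G : Set E) ∧ Module.rank ℝ (E ⧸ G) = (2 : ℕ) ∧ p ∈ e.source ∧
      AnalyticOnNhd ℝ e e.source ∧ AnalyticOnNhd ℝ e.symm e.target ∧
      ∀ x ∈ e.source, x ∈ S ↔ e x ∈ G := by
  obtain ⟨s₀, hs₀⟩ := LinearMap.exists_rightInverse_of_surjective (D : E →ₗ[ℝ] ℂ)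
    (LinearMap.range_eq_top.2 hsurj)
  let s : ℂ →L[ℝ] E := s₀.toContinuousLinearMap
  have hs : ∀ w, D (s w) = w := fun w => LinearMap.congr_fun hs₀ w
  have hfa : AnalyticAt ℝ (fun x => x - p + s (F x - D (x - p))) p :=
    (analyticAt_id.sub analyticAt_const).add ((s.analyticAt _).comp
      (f := fun x => F x - D (x - p)) (hF.sub ((D.analyticAt _).comp
      (f := fun x => x - p) (analyticAt_id.sub analyticAt_const))))
  have hsub : HasFDerivAt (fun x : E => x - p) (ContinuousLinearMap.id ℝ E) p :=
    (hasFDerivAt_id p).sub_const p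
  have hfd : HasFDerivAt (fun x => x - p + s (F x - D (x - p)))
      ((ContinuousLinearEquiv.refl ℝ E : E ≃L[ℝ] E) : E →L[ℝ] E) p := by
    have h1 := hsub.add (s.hasFDerivAt.comp p (hD.sub (D.hasFDerivAt.comp p hsub)))
    refine h1.congr_fderiv ?_
    ext v
    simp
  obtain ⟨e, hef, hp, hU, ha, ha'⟩ := exists_analytic_chart hfa hfd hS
  refine ⟨(D : E →ₗ[ℝ] ℂ).ker, e, D.isClosed_ker, ?_, hp, ha, ha', fun x hx => ?_⟩
  · have h1 := ((D : E →ₗ[ℝ] ℂ).quotKerEquivOfSurjective hsurj).lift_rank_eq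
    rw [Complex.rank_real_complex] at h1
    rw [← Cardinal.lift_inj, h1]
    simp
  · rw [show (x ∈ S ↔ F x = 0) from hU hx, hef, LinearMap.mem_ker]
    change F x = 0 ↔ D (x - p + s (F x - D (x - p))) = 0
    rw [map_add, hs, add_sub_cancel]

/-- The projection along the first factor of the common zero set of two analytic functions. -/
theorem exists_projection_chart {g : ℝ × E → ℝ} {b : ℝ × E → ℂ} {x₀ : ℝ} {φ₀ : E}
    {Dg : ℝ × E →L[ℝ] ℝ} {Db : ℝ × E →L[ℝ] ℂ} {S : Set E}
    (hg : AnalyticAt ℝ g (x₀, φ₀)) (hb : AnalyticAt ℝ b (x₀, φ₀))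
    (hDg : HasFDerivAt g Dg (x₀, φ₀)) (hDb : HasFDerivAt b Db (x₀, φ₀))
    (hg0 : g (x₀, φ₀) = 0) (hc : Dg (1, 0) ≠ 0)
    (hsurj : ∀ w, ∃ ψ, Db (0, ψ) - ((Dg (0, ψ) / Dg (1, 0) : ℝ) : ℂ) * Db (1, 0) = w)
    (hS : ∀ᶠ z in 𝓝 (x₀, φ₀), g z = 0 → b z = 0 → z.2 ∈ S)
    (hS' : ∀ V ∈ 𝓝 x₀, ∀ᶠ φ in 𝓝 φ₀, φ ∈ S → ∃ x ∈ V, g (x, φ) = 0 ∧ b (x, φ) = 0) :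
    ∃ (G : Submodule ℝ E) (e : OpenPartialHomeomorph E E),
      IsClosed (G : Set E) ∧ Module.rank ℝ (E ⧸ G) = (2 : ℕ) ∧ φ₀ ∈ e.source ∧
      AnalyticOnNhd ℝ e e.source ∧ AnalyticOnNhd ℝ e.symm e.target ∧
      ∀ x ∈ e.source, x ∈ S ↔ e x ∈ G := by
  obtain ⟨Λ, hΛ, hΛ0, hΛg, hΛu⟩ := exists_implicit hg hDg hg0 hc
  simp only at hΛ hΛ0 hΛg
  have hgr : AnalyticAt ℝ (fun φ => (Λ φ, φ)) φ₀ := hΛ.prod analyticAt_id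
  have hgr0 : (fun φ => (Λ φ, φ)) φ₀ = (x₀, φ₀) := by simp only [hΛ0]
  have hΛd := hΛ.differentiableAt.hasFDerivAt
  have hgd := hΛd.prodMk (hasFDerivAt_id φ₀)
  have hΛt : Tendsto (fun φ => (Λ φ, φ)) (𝓝 φ₀) (𝓝 (x₀, φ₀)) := by
    rw [← hgr0]; exact hgr.continuousAt
  have hdec : ∀ (r : ℝ) (ψ : E), (r, ψ) = r • ((1, 0) : ℝ × E) + (0, ψ) := fun r ψ => by simp
  -- Implicit differentiation of g(Λ(φ), φ) = 0.
  have hdΛ : ∀ ψ, fderiv ℝ Λ φ₀ ψ = -(Dg (0, ψ) / Dg (1, 0)) := fun ψ => by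
    have h1 : HasFDerivAt (fun φ => g (Λ φ, φ)) _ φ₀ :=
      HasFDerivAt.comp (g := g) φ₀ (by rw [hΛ0]; exact hDg) hgd
    have h2 : HasFDerivAt (fun φ => g (Λ φ, φ)) (0 : E →L[ℝ] ℝ) φ₀ :=
      (hasFDerivAt_const (0 : ℝ) φ₀).congr_of_eventuallyEq hΛg
    have h3 := DFunLike.congr_fun (h1.unique h2) ψ
    change Dg (fderiv ℝ Λ φ₀ ψ, ψ) = 0 at h3
    rw [hdec, map_add, map_smul, smul_eq_mul] at h3
    field_simp
    linarith
  have hFd : HasFDerivAt (fun φ => b (Λ φ, φ)) _ φ₀ :=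
    HasFDerivAt.comp (g := b) φ₀ (by rw [hΛ0]; exact hDb) hgd
  refine exists_submersion_chart (F := fun φ => b (Λ φ, φ)) ?_ hFd ?_ ?_
  · exact AnalyticAt.comp (g := b) (by rw [hΛ0]; exact hb) hgr
  · intro w
    obtain ⟨ψ, hψ⟩ := hsurj w
    refine ⟨ψ, ?_⟩
    change Db (fderiv ℝ Λ φ₀ ψ, ψ) = w
    rw [hdec, map_add, map_smul, hdΛ, ← hψ, Complex.real_smul]
    push_cast
    ring
  · obtain ⟨V, hV, W, hW, hVW⟩ := mem_nhds_prod_iff.1 hΛu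
    filter_upwards [hΛg, hΛt.eventually hS, hS' V hV, hW] with φ h1 h2 h3 h4
    refine ⟨fun h => ?_, h2 h1⟩
    obtain ⟨x, hx, hgx, hbx⟩ := h3 h
    have : x = Λ φ := hVW (mk_mem_prod hx h4) hgx
    rw [← this]; exact hbx

end Geometry

/-- A chart would carry an interior point to an interior point of the model subspace, forcing that
subspace to be everything and the codimension to be 0. -/
theorem IsAnalyticSubmanifold.interior_eq_empty {E : Type*} [NormedAddCommGroup E]
    [NormedSpace ℝ E] {S : Set E} {k : ℕ}
    (h : IsAnalyticSubmanifold S k) (hk : k ≠ 0) : interior S = ∅ := by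
  by_contra hne
  obtain ⟨p, hp⟩ := nonempty_iff_ne_empty.2 hne
  obtain ⟨G, e, -, hrk, hpe, -, -, hSG⟩ := h p (interior_subset hp)
  have hop : IsOpen (e '' (e.source ∩ interior S)) :=
    e.isOpen_image_of_subset_source (e.open_source.inter isOpen_interior) inter_subset_left
  have hsub : e '' (e.source ∩ interior S) ⊆ G := by
    rintro _ ⟨x, ⟨hx, hxS⟩, rfl⟩
    exact (hSG x hx).1 (interior_subset hxS)
  have hG : G = ⊤ := Submodule.eq_top_of_nonempty_interior' G
    ⟨e p, interior_maximal hsub hop ⟨p, ⟨hpe, hp⟩, rfl⟩⟩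
  subst hG
  rw [rank_subsingleton'] at hrk
  exact hk (by exact_mod_cast hrk.symm)

/-! ### Collapsed gaps form a submanifold -/

/-- The real-type potentials form the graph of the continuous conjugation on L². Closedness gives
completeness, hence the inverse function and Baire theorems. -/
theorem isClosed_L2r : IsClosed (L2r : Set L2c) := by
  let c : L2 →L[ℝ] L2 := ContinuousLinearMap.compLpL 2 unitVolume (Complex.conjCLE : ℂ →L[ℝ] ℂ)
  have hc : ∀ a : L2, ∀ᵐ t ∂unitVolume, c a t = conj (a t) := fun a =>
    ContinuousLinearMap.coeFn_compLpL _ a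
  have e : (L2r : Set L2c) = {φ | φ.snd = c φ.fst} := by
    ext φ
    refine ⟨fun h => Lp.ext ?_, fun h => ?_⟩
    · filter_upwards [hc φ.fst, (h : ∀ᵐ t ∂unitVolume, φ.snd t = star (φ.fst t))] with t h1 h2
      rw [h1, h2]; rfl
    · change ∀ᵐ t ∂unitVolume, φ.snd t = star (φ.fst t)
      rw [show φ.snd = c φ.fst from h]
      filter_upwards [hc φ.fst] with t h1
      rw [h1]; rfl
  rw [e]
  exact isClosed_eq (WithLp.sndL 2 ℂ L2 L2).continuous
    (c.continuous.comp (WithLp.fstL 2 ℂ L2 L2).continuous)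

instance : CompleteSpace L2r := isClosed_L2r.completeSpace_coe

theorem dense_of_mem_residual_of_complete {E : Type*} [NormedAddCommGroup E] [CompleteSpace E]
    {S : Set E} (h : S ∈ residual E) : Dense S := dense_of_mem_residual h

/-- The potential of real type whose first component is a given continuous function. -/
def ofContinuous {g : ℝ → ℂ} (hg : Continuous g) : L2r :=
  ⟨WithLp.toLp 2 ((memLp_continuous hg).toLp g,
    (memLp_continuous (Complex.continuous_conj.comp hg)).toLp (fun t => conj (g t))), by
    change ∀ᵐ t ∂unitVolume, (memLp_continuous (Complex.continuous_conj.comp hg)).toLp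
      (fun t => conj (g t)) t = star ((memLp_continuous hg).toLp g t)
    filter_upwards [(memLp_continuous hg).coeFn_toLp,
      (memLp_continuous (Complex.continuous_conj.comp hg)).coeFn_toLp] with t h1 h2
    exact h2.trans (congrArg star h1.symm)⟩

theorem ofContinuous_fst {g : ℝ → ℂ} (hg : Continuous g) :
    ∀ᵐ t ∂unitVolume, (ofContinuous hg : L2c).fst t = g t := (memLp_continuous hg).coeFn_toLp

theorem functional_eq (f : ℂ →ₗ[ℝ] ℝ) (z : ℂ) :
    f z = (((f 1 : ℂ) - f Complex.I * Complex.I) * z).re := by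
  have h : z = z.re • (1 : ℂ) + z.im • Complex.I := by
    simp only [Complex.real_smul, mul_one]; exact (Complex.re_add_im z).symm
  conv_lhs => rw [h]
  rw [map_add, map_smul, map_smul, smul_eq_mul, smul_eq_mul]
  simp
  ring

/-- A proper real subspace of ℂ is annihilated by some nonzero z ↦ Re(yz). Composed with T this is ψ
↦ Re ∫ ψ₁ κ with κ = y k₁ + conj(y k₂), and testing on ψ₁ = conj κ gives ∫ |κ|². That is positive
because κ(0) = y k₁(0) ≠ 0. -/
theorem integral_functional_surjective {k₁ k₂ : ℝ → ℂ} (h₁ : Continuous k₁) (h₂ : Continuous k₂)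
    (h10 : k₁ 0 ≠ 0) (h20 : k₂ 0 = 0) (T : L2r →ₗ[ℝ] ℂ)
    (hT : ∀ ψ : L2r, T ψ = ∫ t in (0 : ℝ)..1,
      ((ψ : L2c).fst t * k₁ t + conj ((ψ : L2c).fst t) * k₂ t)) : Function.Surjective T := by
  rw [← LinearMap.range_eq_top]
  by_contra hne
  obtain ⟨f, hf0, hf⟩ := Submodule.exists_le_ker_of_lt_top _ (lt_top_iff_ne_top.2 hne)
  obtain ⟨y, hy⟩ : ∃ y : ℂ, ∀ z, f z = (y * z).re := ⟨_, functional_eq f⟩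
  have hy0 : y ≠ 0 := by
    rintro rfl
    exact hf0 (LinearMap.ext fun z => by rw [hy]; simp)
  let κ : ℝ → ℂ := fun t => y * k₁ t + conj (y * k₂ t)
  have hκ : Continuous κ := (h₁.const_mul y).add (Complex.continuous_conj.comp (h₂.const_mul y))
  have hκc : Continuous fun t => conj (κ t) := Complex.continuous_conj.comp hκ
  have h0 : f (T (ofContinuous hκc)) = 0 := hf ⟨_, rfl⟩
  have hint : IntervalIntegrable (fun t => y * (conj (κ t) * k₁ t + κ t * k₂ t)) volume 0 1 :=
    (((hκc.mul h₁).add (hκ.mul h₂)).const_mul y).intervalIntegrable _ _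
  have h1 : f (T (ofContinuous hκc)) = ∫ t in (0 : ℝ)..1, ‖κ t‖ ^ 2 := by
    rw [hy, hT, ← intervalIntegral.integral_const_mul,
      intervalIntegral.integral_congr_ae (g := fun t => y * (conj (κ t) * k₁ t + κ t * k₂ t))]
    · rw [← Complex.reCLM_apply, ← Complex.reCLM.intervalIntegral_comp_comm hint]
      refine intervalIntegral.integral_congr fun t _ => ?_
      simp only [Complex.reCLM_apply]
      have e1 : (κ t * (y * k₂ t)).re = (conj (κ t) * conj (y * k₂ t)).re := by
        rw [← map_mul, Complex.conj_re]
      rw [← Complex.ofReal_re (‖κ t‖ ^ 2)]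
      push_cast
      rw [← Complex.conj_mul', mul_add, Complex.add_re,
        show y * (κ t * k₂ t) = κ t * (y * k₂ t) by ring, e1, ← Complex.add_re]
      congr 1
      simp only [κ]
      ring
    · filter_upwards [ae_unit (ofContinuous_fst hκc)] with t ht hm
      rw [uIoc_of_le zero_le_one] at hm
      rw [ht ⟨hm.1.le, hm.2⟩, Complex.conj_conj]
  have h2 : 0 < ∫ t in (0 : ℝ)..1, ‖κ t‖ ^ 2 := by
    refine intervalIntegral.integral_pos zero_lt_one (hκ.norm.pow 2).continuousOn
      (fun t _ => by positivity) ⟨0, zero_mem_unit, ?_⟩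
    have : κ 0 ≠ 0 := by simp [κ, h20, hy0, h10]
    positivity
  linarith

/-- The inclusion of the real parameters in the complex ones. -/
def realParam : ℝ × L2r →L[ℝ] Param :=
  (Complex.ofRealCLM.comp (ContinuousLinearMap.fst ℝ ℝ L2r)).prod
    (L2r.subtypeL.comp (ContinuousLinearMap.snd ℝ ℝ L2r))

theorem realParam_apply (z : ℝ × L2r) : realParam z = ((z.1 : ℂ), (z.2 : L2c)) := rfl

theorem m11_real_analyticAt (z : ℝ × L2r) :
    AnalyticAt ℝ (fun z : ℝ × L2r => m11 (realParam z) 1) z :=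
  (m11_analyticAt (realParam z)).restrictScalars.comp (f := realParam) (realParam.analyticAt z)

theorem m12_real_analyticAt (z : ℝ × L2r) :
    AnalyticAt ℝ (fun z : ℝ × L2r => m12 (realParam z) 1) z :=
  (m12_analyticAt (realParam z)).restrictScalars.comp (f := realParam) (realParam.analyticAt z)

theorem curve_eq_of_mem {φ : L2r} {x : ℝ} {n : ℤ} (h1 : phase x φ = n * Real.pi)
    (h2 : m12 ((x : ℂ), (φ : L2c)) 1 = 0) :
    (curve φ).gp x = n * Real.pi ∧ (m11 ((x : ℂ), (φ : L2c)) 1).im = 0 := by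
  constructor
  · have hb : (curve φ).b x = 0 := h2
    have hθ : (curve φ).θ x = n * Real.pi := h1
    rw [SpectralCurve.gp, SpectralCurve.ρ, hb, hθ]; simp
  · have h := (curve φ).im_a x
    have hθ : (curve φ).θ x = n * Real.pi := h1
    rw [hθ, Real.sin_int_mul_pi, mul_zero, neg_zero] at h
    exact h

/-- Im a = 0 only puts the phase in πℤ; joint continuity of the phase keeps the integer equal to n
nearby. -/
theorem eventually_mem_collapsed {φ₀ : L2r} {x₀ : ℝ} {n : ℤ} (h : phase x₀ φ₀ = n * Real.pi) :
    ∀ᶠ z : ℝ × L2r in 𝓝 (x₀, φ₀), (m11 (realParam z) 1).im = 0 → m12 (realParam z) 1 = 0 →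
      z.2 ∈ collapsed n := by
  have h1 : ∀ᶠ z : ℝ × L2r in 𝓝 (x₀, φ₀), |phase z.1 z.2 - n * Real.pi| < Real.pi := by
    have hc : Continuous fun z : ℝ × L2r => |phase z.1 (z.2 : L2c) - n * Real.pi| :=
      (phase_continuous.sub continuous_const).abs
    refine (hc.tendsto (x₀, φ₀)).eventually_lt_const ?_
    simp only [h, sub_self, abs_zero]
    exact Real.pi_pos
  filter_upwards [h1] with z hz him hb
  refine (mem_collapsed_iff z.2 n).2 ⟨z.1, ?_, hb⟩
  have h2 := (curve z.2).im_a z.1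
  have him' : ((curve z.2).a z.1).im = 0 := him
  have h3 : Real.sin (phase z.1 z.2) = 0 := by
    rw [him', eq_comm, neg_eq_zero] at h2
    exact (mul_eq_zero.1 h2).resolve_left ((curve z.2).a_pos z.1).ne'
  obtain ⟨k, hk⟩ := Real.sin_eq_zero_iff.1 h3
  rw [← hk, ← sub_mul, abs_mul, abs_of_pos Real.pi_pos, mul_lt_iff_lt_one_left Real.pi_pos] at hz
  have h4 : |k - n| < 1 := by exact_mod_cast hz
  rw [Int.abs_lt_one_iff, sub_eq_zero] at h4
  rw [← hk, h4]

/-- The double eigenvalue cannot jump: the upper phase lies strictly below nπ at l and above it at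
u, this persists for nearby potentials, and monotonicity traps the eigenvalue in (l, u). -/
theorem eventually_exists_of_mem_collapsed {φ₀ : L2r} {x₀ : ℝ} {n : ℤ}
    (h1 : phase x₀ φ₀ = n * Real.pi) (h2 : m12 ((x₀ : ℂ), (φ₀ : L2c)) 1 = 0) {V : Set ℝ}
    (hV : V ∈ 𝓝 x₀) : ∀ᶠ φ : L2r in 𝓝 φ₀, φ ∈ collapsed n →
      ∃ x ∈ V, (m11 (realParam (x, φ)) 1).im = 0 ∧ m12 (realParam (x, φ)) 1 = 0 := by
  obtain ⟨l, u, hx, hlu⟩ := mem_nhds_iff_exists_Ioo_subset.1 hV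
  have h0 := (curve_eq_of_mem h1 h2).1
  have hl : (curve φ₀).gp l < n * Real.pi := h0 ▸ (curve φ₀).gp_strictMono hx.1
  have hu : n * Real.pi < (curve φ₀).gp u := h0 ▸ (curve φ₀).gp_strictMono hx.2
  filter_upwards [((gp_gm_continuous l).1.tendsto φ₀).eventually_lt_const hl,
    ((gp_gm_continuous u).1.tendsto φ₀).eventually_const_lt hu] with φ g1 g2 hφ
  obtain ⟨x, e1, e2⟩ := (mem_collapsed_iff φ n).1 hφ
  obtain ⟨e3, e4⟩ := curve_eq_of_mem e1 e2
  rw [← e3] at g1 g2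
  exact ⟨x, hlu ⟨(curve φ).gp_strictMono.lt_iff_lt.1 g1, (curve φ).gp_strictMono.lt_iff_lt.1 g2⟩,
    e4, e2⟩

theorem varInt_potential (ψ : L2r) (u₁ u₂ v₁ v₂ : ℝ → ℂ) :
    varInt (realParam (0, ψ)) u₁ u₂ v₁ v₂ = ∫ t in (0 : ℝ)..1,
      Complex.I * ((ψ : L2c).fst t * (u₂ t * v₂ t) + conj ((ψ : L2c).fst t) * (u₁ t * v₁ t)) := by
  rw [varInt]
  refine intervalIntegral.integral_congr_ae ?_
  filter_upwards [L2r_ae ψ.2] with t ht hm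
  rw [uIoc_of_le zero_le_one] at hm
  simp only [realParam_apply]
  rw [ht ⟨hm.1.le, hm.2⟩]
  push_cast
  ring

theorem integrable_pairing (ψ : L2r) {k₁ k₂ : ℝ → ℂ} (h₁ : Continuous k₁) (h₂ : Continuous k₂) :
    IntervalIntegrable (fun t => (ψ : L2c).fst t * k₁ t + conj ((ψ : L2c).fst t) * k₂ t)
      volume 0 1 := by
  refine (L2_mul_integrable _ h₁.continuousOn).add ?_
  refine (L2_mul_integrable (ψ : L2c).snd h₂.continuousOn).congr_ae ?_
  rw [uIoc_of_le zero_le_one, Filter.EventuallyEq, ae_restrict_iff' measurableSet_Ioc]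
  filter_upwards [L2r_ae ψ.2] with t ht hm
  rw [ht ⟨hm.1.le, hm.2⟩]

/-- By the conjugation symmetry the two summands of the pairing are conjugate to each other, so the
pairing is real and taking the imaginary part merely removes the factor i. -/
theorem im_varInt_potential (φ ψ : L2r) (x : ℝ) :
    ((varInt (realParam (0, ψ)) (m11 (x, φ)) (m21 (x, φ)) (m12 (x, φ)) (m22 (x, φ))).im : ℂ) =
      ∫ t in (0 : ℝ)..1, ((ψ : L2c).fst t * (m21 (x, φ) t * m22 (x, φ) t) +
        conj ((ψ : L2c).fst t) * (m11 (x, φ) t * m12 (x, φ) t)) := by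
  rw [varInt_potential, intervalIntegral.integral_const_mul, Complex.I_mul_im]
  have e : ∫ t in (0 : ℝ)..1, ((ψ : L2c).fst t * (m21 (x, φ) t * m22 (x, φ) t) +
        conj ((ψ : L2c).fst t) * (m11 (x, φ) t * m12 (x, φ) t)) =
      ((∫ t in (0 : ℝ)..1, 2 * ((ψ : L2c).fst t * (m21 (x, φ) t * m22 (x, φ) t)).re : ℝ) : ℂ) := by
    rw [← intervalIntegral.integral_ofReal]
    refine intervalIntegral.integral_congr fun t ht => ?_
    rw [uIcc_of_le zero_le_one] at ht
    rw [← Complex.add_conj, map_mul, map_mul, (conj_symmetry φ.2 x ht).1,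
      (conj_symmetry φ.2 x ht).2, Complex.conj_conj, Complex.conj_conj,
      mul_comm (m11 (x, φ) t)]
  rw [e, Complex.ofReal_re]

theorem collapsed_isAnalyticSubmanifold (n : ℤ) : IsAnalyticSubmanifold (collapsed n) 2 := by
  intro φ₀ hφ₀
  obtain ⟨x₀, hθ, hb⟩ := (mem_collapsed_iff φ₀ n).1 hφ₀
  have him := (curve_eq_of_mem hθ hb).2
  set p₀ : Param := ((x₀ : ℂ), (φ₀ : L2c)) with hp₀
  obtain ⟨D₁, hD₁, hD₁'⟩ := m11_hasFDerivAt p₀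
  obtain ⟨D₂, hD₂, hD₂'⟩ := m12_hasFDerivAt p₀
  -- At a collapsed gap b = 0, so each derivative of the monodromy entries reduces to its first
  -- term.
  simp only [hb, zero_mul, sub_zero] at hD₁' hD₂'
  obtain ⟨σ, hσ⟩ : ∃ σ : ℝ, m11 p₀ 1 = σ :=
    ⟨(m11 p₀ 1).re, Complex.ext rfl (by rw [him, Complex.ofReal_im])⟩
  have hσ0 : σ ≠ 0 := by
    rintro rfl
    exact (curve φ₀).a_ne x₀ (hσ.trans Complex.ofReal_zero)
  rw [hσ] at hD₁' hD₂'
  have hι : HasFDerivAt realParam realParam (x₀, φ₀) := realParam.hasFDerivAt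
  have hDa : HasFDerivAt (fun z : ℝ × L2r => m11 (realParam z) 1)
      ((D₁.restrictScalars ℝ).comp realParam) (x₀, φ₀) :=
    (HasFDerivAt.restrictScalars ℝ hD₁).comp (f := realParam) (x₀, φ₀) hι
  have hDb : HasFDerivAt (fun z : ℝ × L2r => m12 (realParam z) 1)
      ((D₂.restrictScalars ℝ).comp realParam) (x₀, φ₀) :=
    (HasFDerivAt.restrictScalars ℝ hD₂).comp (f := realParam) (x₀, φ₀) hι
  have hDg : HasFDerivAt (fun z : ℝ × L2r => (m11 (realParam z) 1).im)
      (Complex.imCLM.comp ((D₁.restrictScalars ℝ).comp realParam)) (x₀, φ₀) :=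
    Complex.imCLM.hasFDerivAt.comp (x₀, φ₀) hDa
  have hg : AnalyticAt ℝ (fun z : ℝ × L2r => (m11 (realParam z) 1).im) (x₀, φ₀) :=
    (Complex.imCLM.analyticAt _).comp (f := fun z : ℝ × L2r => m11 (realParam z) 1)
      (m11_real_analyticAt _)
  have hr1 : realParam ((1 : ℝ), (0 : L2r)) = (1, 0) := by rw [realParam_apply]; simp
  -- The derivative of Im a in x is -σp, with p > |q| ≥ 0.
  have hc : (Complex.imCLM.comp ((D₁.restrictScalars ℝ).comp realParam)) (1, 0) ≠ 0 := by
    change (D₁ (realParam (1, 0))).im ≠ 0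
    rw [hr1, hD₁', varInt_lambda, integral_m11_m22 φ₀.2]
    have hp : pInt φ₀ x₀ ≠ 0 := ((norm_nonneg _).trans_lt (norm_qInt_lt φ₀ x₀)).ne'
    simp [hσ0, hp]
  set Dg := Complex.imCLM.comp ((D₁.restrictScalars ℝ).comp realParam) with hDgdef
  set Db := (D₂.restrictScalars ℝ).comp realParam with hDbdef
  refine exists_projection_chart hg (m12_real_analyticAt _) hDg hDb him hc ?_
    (eventually_mem_collapsed hθ) (fun V hV => eventually_exists_of_mem_collapsed hθ hb hV)
  obtain ⟨β, hβ⟩ : ∃ β : ℂ, β = Db (1, 0) / (Dg (1, 0) : ℂ) := ⟨_, rfl⟩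
  -- The differential at φ₀ of φ ↦ b(Λ(φ), φ); the β term accounts for the motion of Λ.
  let T : L2r →L[ℝ] ℂ := Db.comp (ContinuousLinearMap.inr ℝ ℝ L2r) -
    (Complex.ofRealCLM.comp (Dg.comp (ContinuousLinearMap.inr ℝ ℝ L2r))).smulRight β
  have hTapp : ∀ ψ, T ψ = Db (0, ψ) - (Dg (0, ψ) : ℂ) * β := fun ψ => rfl
  have c11 := m11_continuous p₀
  have c12 := m12_continuous p₀
  have c21 := m21_continuous p₀
  have c22 := m22_continuous p₀
  -- Since M(0) = Id, the kernels at t = 0 are σi ≠ 0 and 0, whatever β is.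
  have hT := integral_functional_surjective
    (k₁ := fun t => σ * (Complex.I * (m22 p₀ t * m22 p₀ t) - β * (m21 p₀ t * m22 p₀ t)))
    (k₂ := fun t => σ * (Complex.I * (m12 p₀ t * m12 p₀ t) - β * (m11 p₀ t * m12 p₀ t)))
    (by fun_prop) (by fun_prop) (by simp [hσ0]) (by simp) (T : L2r →ₗ[ℝ] ℂ) (fun ψ => by
      have e1 : Db (0, ψ) = σ * varInt (realParam (0, ψ)) (m12 p₀) (m22 p₀) (m12 p₀) (m22 p₀) :=
        hD₂' _
      have e2 : (Dg (0, ψ) : ℂ) = σ * ((varInt (realParam (0, ψ)) (m11 p₀) (m21 p₀) (m12 p₀)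
          (m22 p₀)).im : ℂ) := by
        rw [← Complex.ofReal_mul, ← Complex.im_ofReal_mul, ← hD₁']; rfl
      change T ψ = _
      rw [hTapp, e1, e2, im_varInt_potential, varInt_potential,
        intervalIntegral.integral_const_mul, ← hp₀]
      have i1 := integrable_pairing ψ (k₁ := fun t => m22 p₀ t * m22 p₀ t)
        (k₂ := fun t => m12 p₀ t * m12 p₀ t) (c22.mul c22) (c12.mul c12)
      have i2 := integrable_pairing ψ (k₁ := fun t => m21 p₀ t * m22 p₀ t)
        (k₂ := fun t => m11 p₀ t * m12 p₀ t) (c21.mul c22) (c11.mul c12)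
      rw [show ∀ A B : ℂ, σ * (Complex.I * A) - σ * B * β = (σ * Complex.I) * A - (σ * β) * B
        from fun A B => by ring, ← intervalIntegral.integral_const_mul,
        ← intervalIntegral.integral_const_mul,
        ← intervalIntegral.integral_sub (i1.const_mul _) (i2.const_mul _)]
      refine intervalIntegral.integral_congr fun t _ => ?_
      ring)
  intro w
  obtain ⟨ψ, hψ⟩ := hT w
  refine ⟨ψ, ?_⟩
  rw [← hψ]
  change _ = T ψ
  rw [hTapp, hβ]
  push_cast
  ring

/-! ### Nowhere density and the residual set of potentials with all gaps open -/

theorem collapsed_isNowhereDense (n : ℤ) : IsOpen (collapsed n)ᶜ ∧ Dense (collapsed n)ᶜ :=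
  ⟨(isClosed_collapsed n).isOpen_compl, interior_eq_empty_iff_dense_compl.1
    ((collapsed_isAnalyticSubmanifold n).interior_eq_empty two_ne_zero)⟩

theorem allOpen_mem_residual :
    {φ : L2r | ∀ n : ℤ, lamMinus (φ : L2c) n ≠ lamPlus (φ : L2c) n} ∈ residual L2r := by
  have e : {φ : L2r | ∀ n : ℤ, lamMinus (φ : L2c) n ≠ lamPlus (φ : L2c) n} =
      ⋂ n : ℤ, (collapsed n)ᶜ := by
    ext φ
    simp only [mem_iInter]
    rfl
  rw [e]
  exact countable_iInter_mem.2 fun n =>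
    residual_of_dense_open (collapsed_isNowhereDense n).1 (collapsed_isNowhereDense n).2

end

end ZS

theorem mainTheorem8 :
    (∀ φ : ZS.L2r, ∃! p : (ℤ → ℂ) × (ℤ → ℂ), ZS.IsPeriodicSpectrum (φ : ZS.L2c) p.1 p.2) ∧
    (∀ n : ℤ, ZS.IsAnalyticSubmanifold (ZS.collapsed n) 2) ∧
    {φ : ZS.L2r | ∀ n : ℤ, ZS.lamMinus (φ : ZS.L2c) n ≠ ZS.lamPlus (φ : ZS.L2c) n}
      ∈ residual ZS.L2r ∧
    Dense {φ : ZS.L2r | ∀ n : ℤ,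
      ZS.lamMinus (φ : ZS.L2c) n ≠ ZS.lamPlus (φ : ZS.L2c) n} :=
  ⟨ZS.existsUnique_isPeriodicSpectrum, ZS.collapsed_isAnalyticSubmanifold,
    ZS.allOpen_mem_residual, ZS.dense_of_mem_residual_of_complete ZS.allOpen_mem_residual⟩
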